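/- **Setting.** Let $T>0$, $\gamma>1$, $\mu>0$, $\lambda+\tfrac23\mu\ge0$, $\alpha,\alpha_0,\nu_s\ge0$, $\varepsilon,\nu,\bar\varrho>0$; put $p(s)=s^\gamma$, $\mathbb S(A)=\mu(A+A^\top)+\lambda(\operatorname{tr}A)\mathbb I$, $\Gamma=\mathbb T^2$, $\mathbf e_3=(0,0,1)^\top$. For $w:[0,T]\times\Gamma\to(-1,\infty)$ let $\Omega^w(t)=\{(x,x_3):x\in\Gamma,\ 0<x_3<1+w(t,x)\}$, $Q_T^w=\bigcup_{t\in(0,T)}\{t\}\times\Omega^w(t)$, $\Gamma_T=(0,T)\times\Gamma$, $\Phi_w(t,x)=(x,1+w(t,x))$, $\Gamma^w(t)=\Phi_w(t,\Gamma)$, $\Gamma_0=\Gamma\times\{0\}$, and $\mathbf n^w=(-\nabla w,1)^\top$, transported to $\Gamma^w(t)$ by $\Phi_w$ (as are functions on $\Gamma$). Let $\mathbf v_{\tau^w}$, $\mathbf v_{\tau^0}$ be the orthogonal projections of $\mathbf v$ onto $(\mathbf n^w)^\perp$, $\mathbf e_3^\perp$; $d\mathcal H^2=\sqrt{1+|\nabla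 w|^2}\,dx$ on $\Gamma^w(t)$. Let $X_T=L^\infty(0,T;H^2(\Gamma))\cap W^{1,\infty}(0,T;L^2(\Gamma))\cap H^1(0,T;H^1(\Gamma))$. Smooth functions on $\overline{Q_T^w}$ are restrictions of smooth functions on $\mathbb R\times\Gamma\times\mathbb R$. Let $\mathcal K$ be any class of functions with $C^\infty([0,T]\times\Gamma)\subset\mathcal K\subset H^1(0,T;L^2(\Gamma))\cap L^2(0,T;H^2(\Gamma))$ (for instance either of the two extreme choices). A pair $(\boldsymbol\varphi,\psi)$ is *compatible with $w$* if $\boldsymbol\varphi\cdot\mathbf n^w=\psi$ on $\Gamma^w(t)$ for a.e. $t$ and $\boldsymbol\varphi\cdot\mathbf e_3=0$ on $\Gamma_0$. **Weak solutions.** Initial data: $\varrho_0\ge0$, $\varrho_0\in L^\gamma(\Omega^{w_0})$, $\varrho_0|\mathbf u_0|^2\in L^1(\Omega^{w_0})$, $w_0\in H^2(\Gamma)$, $w_1\in L^2(\Gamma)$. A (bounded energy) weak solution of the rescaled fluid–structure system, tested with $\mathcal K$, is a triple $(\varrho,\mathbf u,w)$ with: $\varrho\ge0$, $\varrho\in C_w([0,T];L^\gamma)$;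 $\mathbf u\in L^2(0,T;W^{1,q}(\Omega^w(t)))$ for all $q<2$; $\varrho|\mathbf u|^2\in L^\infty(0,T;L^1)$; $w\in X_T$ continuous on $[0,T]\times\Gamma$, $w>-1$, $w(0)=w_0$; traces satisfying $\mathbf u\cdot\mathbf n^w=\partial_tw$ on $\Gamma^w(t)$ and $\mathbf u\cdot\mathbf e_3=0$ on $\Gamma_0$; finite dissipation; and, for a.e. $\tau\in(0,T)$: (i) for all smooth $\varphi$ and all $b\in C^1[0,\infty)$ with $b(0)=0$ such that either $b'$ vanishes for large arguments or $b(z)=z$, $$\int_0^\tau\!\!\int_{\Omega^w(t)}\! b(\varrho)(\partial_t\varphi+\mathbf u\cdot\nabla\varphi)+(b(\varrho)-b'(\varrho)\varrho)\operatorname{div}\mathbf u\,\varphi\,dx\,dt=\int_{\Omega^w(\tau)}\! b(\varrho)\varphi(\tau)\,dx-\int_{\Omega^{w_0}}\! b(\varrho_0)\varphi(0)\,dx ;$$ (ii) for all smooth $\boldsymbol\varphi$ and $\psi\in\mathcal K$ that are compatible with $w$, $$\begin{aligned}&\int_0^\tau\!\!\int_{\Omega^w(t)}\varrho\mathbf u\cdot\partial_t\boldsymbol\varphi+\varrho\mathbf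 u\otimes\mathbf u:\nabla\boldsymbol\varphi+\tfrac1{\varepsilon^2}(p(\varrho)-p(\bar\varrho))\operatorname{div}\boldsymbol\varphi-\nu\,\mathbb S(\nabla\mathbf u):\nabla\boldsymbol\varphi\,dx\,dt\\&+\int_0^\tau\!\!\int_\Gamma\partial_tw\,\partial_t\psi-\Delta w\Delta\psi-\nu_s\nabla\partial_tw\cdot\nabla\psi\,dx\,dt-\alpha\nu\int_0^\tau\!\!\int_{\Gamma^w(t)}(\mathbf u-\partial_tw\,\mathbf e_3)_{\tau^w}\cdot(\boldsymbol\varphi-\psi\mathbf e_3)_{\tau^w}\,d\mathcal H^2dt-\alpha_0\nu\int_0^\tau\!\!\int_{\Gamma_0}\mathbf u_{\tau^0}\cdot\boldsymbol\varphi_{\tau^0}\,dx\,dt\\&=\int_{\Omega^w(\tau)}\varrho\mathbf u\cdot\boldsymbol\varphi(\tau)\,dx+\int_\Gamma\partial_tw\,\psi(\tau)\,dx-\int_{\Omega^{w_0}}\varrho_0\mathbf u_0\cdot\boldsymbol\varphi(0)\,dx-\int_\Gamma w_1\psi(0)\,dx;\end{aligned}$$ (iii) the energy inequality $$\begin{aligned}&\int_{\Omega^w(\tau)}\tfrac12\varrho|\mathbf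 u|^2+\tfrac1{\varepsilon^2}\Big(\tfrac{p(\varrho)}{\gamma-1}+p(\bar\varrho)\Big)dx+\int_\Gamma\tfrac12|\partial_tw|^2+\tfrac12|\Delta w|^2\,dx+\nu\int_0^\tau\!\!\int_{\Omega^w(t)}\mathbb S(\nabla\mathbf u):\nabla\mathbf u\,dx\,dt\\&+\alpha\nu\int_0^\tau\!\!\int_{\Gamma^w(t)}|(\mathbf u-\partial_tw\,\mathbf e_3)_{\tau^w}|^2d\mathcal H^2dt+\alpha_0\nu\int_0^\tau\!\!\int_{\Gamma_0}|\mathbf u_{\tau^0}|^2dx\,dt+\nu_s\int_0^\tau\!\!\int_\Gamma|\nabla\partial_tw|^2dx\,dt\\&\le\int_{\Omega^{w_0}}\tfrac12\varrho_0|\mathbf u_0|^2+\tfrac1{\varepsilon^2}\Big(\tfrac{p(\varrho_0)}{\gamma-1}+p(\bar\varrho)\Big)dx+\int_\Gamma\tfrac12|w_1|^2+\tfrac12|\Delta w_0|^2\,dx .\end{aligned}$$ **Statement.** Let $(\varrho,\mathbf u,w)$ be such a weak solution. Let $r,\mathbf U$ be smooth on $\overline{Q_T^w}$, $r>0$ on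 $\overline{Q_T^w}$, and let $W\in X_T$ with $\partial_tW\in\mathcal K$, $\nabla\Delta W\in L^2(\Gamma_T)$, such that $(\mathbf U,\partial_tW)$ is compatible with $w$. Put $$\mathcal E(\tau)=\int_{\Omega^w(\tau)}\tfrac12\varrho|\mathbf u-\mathbf U|^2+\tfrac1{\varepsilon^2(\gamma-1)}\big(p(\varrho)-p'(r)(\varrho-r)-p(r)\big)dx+\int_\Gamma\tfrac12|\partial_tw-\partial_tW|^2+\tfrac12|\Delta w-\Delta W|^2\,dx,$$ where at $\tau=0$ the functions $\varrho,\mathbf u,w,\partial_tw$ are replaced by $\varrho_0,\mathbf u_0,w_0,w_1$. Then all integrands below are integrable, and for a.e. $\tau\in(0,T)$ $$\begin{aligned}&\mathcal E(\tau)+\nu\int_0^\tau\!\!\int_{\Omega^w(t)}(\mathbb S(\nabla\mathbf u)-\mathbb S(\nabla\mathbf U)):(\nabla\mathbf u-\nabla\mathbf U)\,dx\,dt+\alpha\nu\int_0^\tau\!\!\int_{\Gamma^w(t)}|(\mathbf u-\mathbf U-(\partial_tw-\partial_tW)\mathbf e_3)_{\tau^w}|^2d\mathcal H^2dt\\&+\alpha_0\nu\int_0^\tau\!\!\int_{\Gamma_0}|(\mathbf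 u-\mathbf U)_{\tau^0}|^2dx\,dt+\nu_s\int_0^\tau\!\!\int_\Gamma|\nabla\partial_tw-\nabla\partial_tW|^2dx\,dt\ \le\ \mathcal E(0)+\int_0^\tau\mathcal R(t)\,dt,\end{aligned}$$ $$\begin{aligned}\mathcal R(t)=&-\int_{\Omega^w(t)}\varrho(\mathbf u-\mathbf U)\cdot(\partial_t+\mathbf u\cdot\nabla)\mathbf U\,dx-\tfrac1{\varepsilon^2}\int_{\Omega^w(t)}(p(\varrho)-p(r))\operatorname{div}\mathbf U\,dx\\&+\tfrac1{\varepsilon^2}\int_\Gamma\big[(p(r)-p(\bar\varrho))(\mathbf u-\mathbf U)\big]\!\circ\Phi_w\cdot\mathbf n^w\,dx-\nu\int_{\Omega^w(t)}\mathbb S(\nabla\mathbf U):(\nabla\mathbf u-\nabla\mathbf U)\,dx\\&-\int_\Gamma(\partial_tw-\partial_tW)(\partial_t^2W+\Delta^2W-\nu_s\Delta\partial_tW)\,dx\\&-\tfrac1{\varepsilon^2}\int_{\Omega^w(t)}\tfrac1{\gamma-1}\big[(\varrho-r)(\partial_t+\mathbf U\cdot\nabla)p'(r)+\varrho(\mathbf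 u-\mathbf U)\cdot\nabla p'(r)\big]dx\\&-\alpha\nu\int_{\Gamma^w(t)}(\mathbf U-\partial_tW\,\mathbf e_3)_{\tau^w}\cdot\big((\mathbf u-\mathbf U)-(\partial_tw-\partial_tW)\mathbf e_3\big)_{\tau^w}d\mathcal H^2-\alpha_0\nu\int_{\Gamma_0}\mathbf U_{\tau^0}\cdot(\mathbf u-\mathbf U)_{\tau^0}\,dx ,\end{aligned}$$ where $\Delta^2W\in H^{-1}(\Gamma)$ is paired with $f=\partial_tw-\partial_tW\in H^1(\Gamma)$ by duality, $\int_\Gamma f\,\Delta^2W\,dx:=-\int_\Gamma\nabla\Delta W\cdot\nabla f\,dx$. -/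

import Mathlib

open MeasureTheory Set
open scoped ContDiff ENNReal NNReal

noncomputable section

namespace FSI

/-! ### Flat periodic geometry

The torus `Γ = ℝ² / ℤ²` is represented by the fundamental cell `[0,1)²`: functions on `Γ`
(on `Γ × ℝ`) are functions on `ℝ²` (on `ℝ³`) that are `ℤ²`-periodic in the horizontal
variables, and integrals over `Γ` are integrals over the cell. -/

abbrev E2 : Type := Fin 2 → ℝ

abbrev E3 : Type := Fin 3 → ℝ

def cell : Set E2 := Set.pi univ fun _ => Ico (0 : ℝ) 1

/-- The horizontal part of a point of `ℝ³`. -/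
def base (y : E3) : E2 := ![y 0, y 1]

/-- The point of `ℝ³` over `x` at height `z`. -/
def pt (x : E2) (z : ℝ) : E3 := ![x 0, x 1, z]

def Periodic2 {β : Type} (f : E2 → β) : Prop :=
  ∀ (x : E2) (k : Fin 2 → ℤ), f (x + fun i => (k i : ℝ)) = f x

def Periodic3 {β : Type} (f : E3 → β) : Prop :=
  ∀ (y : E3) (k : Fin 2 → ℤ), f (y + ![(k 0 : ℝ), (k 1 : ℝ), 0]) = f y

/-- The fluid domain `Ω^w(t) = {0 < x₃ < 1 + w(t,x)}` over one cell. -/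
def Omega (w : ℝ → E2 → ℝ) (t : ℝ) : Set E3 :=
  {y | base y ∈ cell ∧ 0 < y 2 ∧ y 2 < 1 + w t (base y)}

/-- The moving space-time cylinder `Q_T^w`. -/
def QT (w : ℝ → E2 → ℝ) (T : ℝ) : Set (ℝ × E3) :=
  {p | p.1 ∈ Ioo 0 T ∧ p.2 ∈ Omega w p.1}

/-- The cylinder `Γ_T`. -/
def GammaT (T : ℝ) : Set (ℝ × E2) := Ioo 0 T ×ˢ cell

/-- The parametrization `Φ_w(t,x) = (x, 1 + w(t,x))` of the moving boundary `Γ^w(t)`. -/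
def Phi (w : ℝ → E2 → ℝ) (t : ℝ) (x : E2) : E3 := pt x (1 + w t x)

def e3 : E3 := ![0, 0, 1]

/-- The weighted normal `n^w = (-∇w, 1)`, as a function of `∇w`. -/
def normal (g : E2) : E3 := ![-g 0, -g 1, 1]

/-- The area Jacobian `√(1 + |∇w|²)` of the parametrization of `Γ^w(t)`: the surface measure
of `Γ^w(t)` is `area (∇w) dx`. -/
def area (g : E2) : ℝ := Real.sqrt (1 + g ⬝ᵥ g)

/-- Orthogonal projection of `v` onto the plane orthogonal to `N` (`N` need not be a unit
vector). -/
def tang (N v : E3) : E3 := v - ((v ⬝ᵥ N) / (N ⬝ᵥ N)) • N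

/-! ### Classical and weak derivatives -/

/-- `(gradE f y) j = ∂_j f (y)`. -/
def gradE (f : E3 → ℝ) (y : E3) : E3 := fun j => fderiv ℝ f y (Pi.single j 1)

/-- `(jac F y) i j = ∂_j F_i (y)`. -/
def jac (F : E3 → E3) (y : E3) : Fin 3 → Fin 3 → ℝ := fun i => gradE (fun z => F z i) y

/-- `(dt F t y)` is the time derivative. -/
def dt {β : Type} [NormedAddCommGroup β] [NormedSpace ℝ β] (F : ℝ → E3 → β) (t : ℝ) (y : E3) :
    β := deriv (fun s => F s y) t

def tr3 (A : Fin 3 → Fin 3 → ℝ) : ℝ := ∑ i, A i i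

/-- The Frobenius product `A : B`. -/
def frob (A B : Fin 3 → Fin 3 → ℝ) : ℝ := ∑ i, ∑ j, A i j * B i j

/-- `(advect v A)_i = Σ_j v_j A_ij`; with `A = ∇F` this is `(v · ∇) F`. -/
def advect (v : E3) (A : Fin 3 → Fin 3 → ℝ) : E3 := fun i => ∑ j, v j * A i j

/-- The trace of a Hessian. -/
def lap (H : Fin 2 → Fin 2 → ℝ) : ℝ := ∑ i, H i i

/-- Weak gradient on the torus, tested with smooth periodic functions. -/
def IsWeakGrad (f : E2 → ℝ) (g : E2 → E2) : Prop :=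
  ∀ φ : E2 → ℝ, ContDiff ℝ ∞ φ → Periodic2 φ → ∀ i : Fin 2,
    ∫ x in cell, f x * fderiv ℝ φ x (Pi.single i 1) = -∫ x in cell, g x i * φ x

/-- Weak Hessian: the `i`-th row is the weak gradient of the `i`-th partial derivative. -/
def IsWeakHess (g : E2 → E2) (H : E2 → Fin 2 → Fin 2 → ℝ) : Prop :=
  ∀ i : Fin 2, IsWeakGrad (fun x => g x i) (fun x => H x i)

/-- `A = ∇v` weakly in `Ω^w(t)`, tested with smooth periodic functions that vanish near the
top and the bottom of `Ω^w(t)`. -/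
def IsWeakJac (w : ℝ → E2 → ℝ) (t : ℝ) (v : E3 → E3) (A : E3 → Fin 3 → Fin 3 → ℝ) : Prop :=
  ∀ φ : E3 → ℝ, ContDiff ℝ ∞ φ → Periodic3 φ →
    (∃ δ > 0, ∀ y, φ y ≠ 0 → δ ≤ y 2 ∧ y 2 ≤ 1 + w t (base y) - δ) →
    ∀ i j : Fin 3,
      ∫ y in Omega w t, v y i * gradE φ y j = -∫ y in Omega w t, A y i j * φ y

/-- `vTop` (pulled back to `Γ` by `Φ_w`) and `vBot` are the traces of `v` on `Γ^w(t)` and on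
`Γ₀`: integration by parts in the vertical direction, where `n₃ dℋ² = dx` on `Γ^w(t)`. -/
def IsTrace (w : ℝ → E2 → ℝ) (t : ℝ) (v : E3 → E3) (A : E3 → Fin 3 → Fin 3 → ℝ)
    (vTop vBot : E2 → E3) : Prop :=
  ∀ φ : E3 → ℝ, ContDiff ℝ ∞ φ → Periodic3 φ → ∀ i : Fin 3,
    ∫ y in Omega w t, (v y i * gradE φ y 2 + A y i 2 * φ y) =
      ∫ x in cell, (vTop x i * φ (Phi w t x) - vBot x i * φ (pt x 0))

/-! ### Parameters, data, unknowns -/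

/-- Time horizon, adiabatic exponent, viscosities, friction coefficients, structural damping,
Mach number, reciprocal Reynolds number, reference density. -/
structure Params where
  T : ℝ
  γ : ℝ
  μ : ℝ
  lam : ℝ
  α : ℝ
  α₀ : ℝ
  νs : ℝ
  ε : ℝ
  ν : ℝ
  ρbar : ℝ
  T_pos : 0 < T
  γ_gt : 1 < γ
  μ_pos : 0 < μ
  lam_ge : 0 ≤ lam + 2 * μ / 3
  α_nonneg : 0 ≤ α
  α₀_nonneg : 0 ≤ α₀
  νs_nonneg : 0 ≤ νs
  ε_pos : 0 < ε
  ν_pos : 0 < ν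
  ρbar_pos : 0 < ρbar

/-- The pressure `p(ρ) = ρ^γ`. -/
def Params.p (P : Params) (ρ : ℝ) : ℝ := ρ ^ P.γ

/-- `p'(ρ) = γ ρ^(γ-1)`. -/
def Params.p' (P : Params) (ρ : ℝ) : ℝ := P.γ * ρ ^ (P.γ - 1)

/-- The viscous stress `S(A) = μ (A + Aᵀ) + λ (tr A) I`. -/
def Params.S (P : Params) (A : Fin 3 → Fin 3 → ℝ) : Fin 3 → Fin 3 → ℝ := fun i j =>
  P.μ * (A i j + A j i) + if i = j then P.lam * tr3 A else 0

/-- Initial density, velocity, displacement, and displacement velocity. -/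
structure InitialData where
  ρ₀ : E3 → ℝ
  u₀ : E3 → E3
  w₀ : E2 → ℝ
  w₁ : E2 → ℝ

/-- A plate displacement together with `∇w`, `∇²w`, `∂ₜw`, `∇∂ₜw`; that these are the derivatives
is part of `PlateFields.EnergyClass`. -/
structure PlateFields where
  val : ℝ → E2 → ℝ
  grad : ℝ → E2 → E2
  hess : ℝ → E2 → Fin 2 → Fin 2 → ℝ
  vel : ℝ → E2 → ℝ
  velGrad : ℝ → E2 → E2

/-- The class `L^∞(0,T;H²(Γ)) ∩ W^{1,∞}(0,T;L²(Γ)) ∩ H¹(0,T;H¹(Γ))`. The displacement is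
the (weakly continuous in `H²`) representative, which has its spatial derivatives at all times. -/
structure PlateFields.EnergyClass (T : ℝ) (w : PlateFields) : Prop where
  periodic : ∀ t, Periodic2 (w.val t)
  meas_val : AEStronglyMeasurable (fun p : ℝ × E2 => w.val p.1 p.2) (volume.restrict (GammaT T))
  meas_grad : AEStronglyMeasurable (fun p : ℝ × E2 => w.grad p.1 p.2) (volume.restrict (GammaT T))
  meas_hess : AEStronglyMeasurable (fun p : ℝ × E2 => w.hess p.1 p.2) (volume.restrict (GammaT T))
  weakGrad : ∀ t ∈ Icc 0 T, IsWeakGrad (w.val t) (w.grad t)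
  weakHess : ∀ t ∈ Icc 0 T, IsWeakHess (w.grad t) (w.hess t)
  memLp_slice : ∀ t ∈ Icc 0 T, MemLp (w.val t) 2 (volume.restrict cell) ∧
    MemLp (w.grad t) 2 (volume.restrict cell) ∧ MemLp (w.hess t) 2 (volume.restrict cell)
  bound : ∃ C : ℝ≥0, ∀ t ∈ Icc 0 T, eLpNorm (w.val t) 2 (volume.restrict cell) ≤ C ∧
    eLpNorm (w.grad t) 2 (volume.restrict cell) ≤ C ∧
    eLpNorm (w.hess t) 2 (volume.restrict cell) ≤ C
  primitive : ∀ t ∈ Icc 0 T, ∀ᵐ x ∂(volume.restrict cell),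
    w.val t x = w.val 0 x + ∫ s in (0)..t, w.vel s x
  vel_memLp : MemLp (fun p : ℝ × E2 => w.vel p.1 p.2) 2 (volume.restrict (GammaT T))
  vel_bound : ∃ C : ℝ≥0, ∀ᵐ t ∂(volume.restrict (Ioo 0 T)),
    eLpNorm (w.vel t) 2 (volume.restrict cell) ≤ C
  vel_weakGrad : ∀ᵐ t ∂(volume.restrict (Ioo 0 T)), IsWeakGrad (w.vel t) (w.velGrad t)
  velGrad_memLp : MemLp (fun p : ℝ × E2 => w.velGrad p.1 p.2) 2 (volume.restrict (GammaT T))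

/-- `ψ ∈ H¹(0,T;L²(Γ)) ∩ L²(0,T;H²(Γ))`, with time derivative `ψt`, gradient `ψg` and Hessian `ψh`;
`ψ` is the representative that is continuous in time with values in `L²(Γ)`. -/
structure IsPlateTest (T : ℝ) (ψ ψt : ℝ → E2 → ℝ) (ψg : ℝ → E2 → E2)
    (ψh : ℝ → E2 → Fin 2 → Fin 2 → ℝ) : Prop where
  periodic : ∀ t, Periodic2 (ψ t)
  memLp : MemLp (fun p : ℝ × E2 => ψ p.1 p.2) 2 (volume.restrict (GammaT T))
  memLp_dt : MemLp (fun p : ℝ × E2 => ψt p.1 p.2) 2 (volume.restrict (GammaT T))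
  memLp_grad : MemLp (fun p : ℝ × E2 => ψg p.1 p.2) 2 (volume.restrict (GammaT T))
  memLp_hess : MemLp (fun p : ℝ × E2 => ψh p.1 p.2) 2 (volume.restrict (GammaT T))
  primitive : ∀ t ∈ Icc 0 T, ∀ᵐ x ∂(volume.restrict cell),
    ψ t x = ψ 0 x + ∫ s in (0)..t, ψt s x
  weakGrad : ∀ᵐ t ∂(volume.restrict (Ioo 0 T)), IsWeakGrad (ψ t) (ψg t)
  weakHess : ∀ᵐ t ∂(volume.restrict (Ioo 0 T)), IsWeakHess (ψg t) (ψh t)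

/-- An admissible class of plate test functions: it contains all smooth functions on
`[0,T] × Γ` and is contained in `H¹(0,T;L²(Γ)) ∩ L²(0,T;H²(Γ))`. -/
structure IsPlateTestClass (T : ℝ) (K : Set (ℝ → E2 → ℝ)) : Prop where
  smooth_mem : ∀ ψ : ℝ → E2 → ℝ, ContDiff ℝ ∞ (fun p : ℝ × E2 => ψ p.1 p.2) →
    (∀ t, Periodic2 (ψ t)) → ψ ∈ K
  regular : ∀ ψ ∈ K, ∃ ψt ψg ψh, IsPlateTest T ψ ψt ψg ψh

/-- Smooth functions on the closed cylinder (restrictions of smooth functions on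
`ℝ × Γ × ℝ`). -/
def IsSmoothField {β : Type} [NormedAddCommGroup β] [NormedSpace ℝ β] (F : ℝ → E3 → β) : Prop :=
  ContDiff ℝ ∞ (fun p : ℝ × E3 => F p.1 p.2) ∧ ∀ t, Periodic3 (F t)

/-- Density, velocity, velocity gradient, traces of the velocity on the moving boundary
(pulled back to `Γ`) and on the rigid bottom, and plate displacement. -/
structure State where
  ρ : ℝ → E3 → ℝ
  u : ℝ → E3 → E3
  Du : ℝ → E3 → Fin 3 → Fin 3 → ℝ
  uTop : ℝ → E2 → E3
  uBot : ℝ → E2 → E3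
  w : PlateFields

/-- `Ω^w(t)` for the displacement of the state. -/
abbrev State.dom (X : State) (t : ℝ) : Set E3 := Omega X.w.val t

/-- The normal `n^w` at `Φ_w(t,x)`. -/
abbrev State.nrm (X : State) (t : ℝ) (x : E2) : E3 := normal (X.w.grad t x)

/-- The slip velocity `(v - s e₃)_τ` at `Φ_w(t,x)`, for a fluid velocity `v` and a plate
velocity `s`. -/
def State.slip (X : State) (t : ℝ) (x : E2) (v : E3) (s : ℝ) : E3 :=
  tang (X.nrm t x) (v - s • e3)

/-! ### Weak solutions -/

/-- Energy density of the fluid. The constant `p(ρbar)` accounts for the exterior pressure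
`p(ρbar)/ε²` against which the volume of `Ω^w(t)` changes. -/
def fluidEnergy (P : Params) (ρ : ℝ) (u : E3) : ℝ :=
  1 / 2 * ρ * (u ⬝ᵥ u) + 1 / P.ε ^ 2 * (P.p ρ / (P.γ - 1) + P.p P.ρbar)

def plateEnergy (v l : ℝ) : ℝ := 1 / 2 * v ^ 2 + 1 / 2 * l ^ 2

/-- Integrand over `Γ` of the dissipation: friction on `Γ^w(t)` and on `Γ₀`, structural
damping. -/
def plateDissipation (P : Params) (X : State) (t : ℝ) (x : E2) : ℝ :=
  P.α * P.ν * (X.slip t x (X.uTop t x) (X.w.vel t x) ⬝ᵥ X.slip t x (X.uTop t x) (X.w.vel t x))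
      * area (X.w.grad t x)
    + P.α₀ * P.ν * (tang e3 (X.uBot t x) ⬝ᵥ tang e3 (X.uBot t x))
    + P.νs * (X.w.velGrad t x ⬝ᵥ X.w.velGrad t x)

/-- Integrand over `Ω^w(t)` of the weak momentum equation. -/
def momentumBulk (P : Params) (X : State) (φ : ℝ → E3 → E3) (t : ℝ) (y : E3) : ℝ :=
  X.ρ t y * (X.u t y ⬝ᵥ dt φ t y)
    + X.ρ t y * (X.u t y ⬝ᵥ advect (X.u t y) (jac (φ t) y))
    + 1 / P.ε ^ 2 * (P.p (X.ρ t y) - P.p P.ρbar) * tr3 (jac (φ t) y)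
    - P.ν * frob (P.S (X.Du t y)) (jac (φ t) y)

/-- Integrand over `Γ` of the weak momentum equation. -/
def momentumPlate (P : Params) (X : State) (φ : ℝ → E3 → E3) (ψ ψt : ℝ → E2 → ℝ)
    (ψg : ℝ → E2 → E2) (ψh : ℝ → E2 → Fin 2 → Fin 2 → ℝ) (t : ℝ) (x : E2) : ℝ :=
  X.w.vel t x * ψt t x - lap (X.w.hess t x) * lap (ψh t x)
    - P.νs * (X.w.velGrad t x ⬝ᵥ ψg t x)
    - P.α * P.ν * (X.slip t x (X.uTop t x) (X.w.vel t x)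
        ⬝ᵥ X.slip t x (φ t (Phi X.w.val t x)) (ψ t x)) * area (X.w.grad t x)
    - P.α₀ * P.ν * (tang e3 (X.uBot t x) ⬝ᵥ tang e3 (φ t (pt x 0)))

/-- The kinematic condition for a pair (fluid field, plate function): `φ · n^w = ψ` on
`Γ^w(t)` for a.e. `t`, and impermeability `φ · e₃ = 0` of the bottom. -/
def Compatible (P : Params) (X : State) (φ : ℝ → E3 → E3) (ψ : ℝ → E2 → ℝ) : Prop :=
  (∀ᵐ t ∂(volume.restrict (Ioo 0 P.T)), ∀ᵐ x ∂(volume.restrict cell),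
      φ t (Phi X.w.val t x) ⬝ᵥ X.nrm t x = ψ t x) ∧
    ∀ t ∈ Icc 0 P.T, ∀ x : E2, φ t (pt x 0) ⬝ᵥ e3 = 0

/-- Admissible nonlinearities in the renormalized continuity equation; `b(z) = z` gives the
continuity equation itself. -/
def IsRenorm (b : ℝ → ℝ) : Prop :=
  ContDiffOn ℝ 1 b (Ici 0) ∧ b 0 = 0 ∧
    ((∃ R : ℝ, ∀ z ≥ R, 0 ≤ z → derivWithin b (Ici 0) z = 0) ∨ ∀ z ≥ 0, b z = z)

/-- Bounded energy weak solutions of the rescaled system, with plate test functions in `K`. -/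
structure IsWeakSolution (P : Params) (D : InitialData) (K : Set (ℝ → E2 → ℝ)) (X : State) :
    Prop where
  -- initial data
  ρ₀_nonneg : ∀ y, 0 ≤ D.ρ₀ y
  ρ₀_memLp : MemLp D.ρ₀ (ENNReal.ofReal P.γ) (volume.restrict (X.dom 0))
  u₀_meas : AEStronglyMeasurable D.u₀ (volume.restrict (X.dom 0))
  kinetic₀ : IntegrableOn (fun y => D.ρ₀ y * (D.u₀ y ⬝ᵥ D.u₀ y)) (X.dom 0)
  w₁_memLp : MemLp D.w₁ 2 (volume.restrict cell)
  w_init : ∀ x, X.w.val 0 x = D.w₀ x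
  -- displacement, nondegenerate fluid domain
  w_class : X.w.EnergyClass P.T
  w_cont : ContinuousOn (fun p : ℝ × E2 => X.w.val p.1 p.2) (Icc 0 P.T ×ˢ univ)
  w_gt : ∀ t ∈ Icc 0 P.T, ∀ x, -1 < X.w.val t x
  -- density, weakly continuous in time
  ρ_periodic : ∀ t, Periodic3 (X.ρ t)
  ρ_nonneg : ∀ t y, 0 ≤ X.ρ t y
  ρ_meas : AEStronglyMeasurable (fun p : ℝ × E3 => X.ρ p.1 p.2)
    (volume.restrict (QT X.w.val P.T))
  ρ_memLp : ∀ t ∈ Icc 0 P.T, MemLp (X.ρ t) (ENNReal.ofReal P.γ) (volume.restrict (X.dom t))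
  ρ_weakCont : ∀ g : E3 → ℝ,
    MemLp g (ENNReal.ofReal (P.γ / (P.γ - 1))) (volume.restrict (base ⁻¹' cell)) →
    ContinuousOn (fun t => ∫ y in X.dom t, X.ρ t y * g y) (Icc 0 P.T)
  -- velocity
  u_periodic : ∀ t, Periodic3 (X.u t)
  u_meas : AEStronglyMeasurable (fun p : ℝ × E3 => X.u p.1 p.2)
    (volume.restrict (QT X.w.val P.T))
  Du_meas : AEStronglyMeasurable (fun p : ℝ × E3 => X.Du p.1 p.2)
    (volume.restrict (QT X.w.val P.T))
  u_sobolev : ∀ q : ℝ, 1 ≤ q → q < 2 →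
    (∫⁻ t in Ioo 0 P.T, eLpNorm (X.u t) (ENNReal.ofReal q) (volume.restrict (X.dom t)) ^ 2) < ⊤ ∧
    (∫⁻ t in Ioo 0 P.T, eLpNorm (X.Du t) (ENNReal.ofReal q) (volume.restrict (X.dom t)) ^ 2) < ⊤
  u_weakJac : ∀ᵐ t ∂(volume.restrict (Ioo 0 P.T)), IsWeakJac X.w.val t (X.u t) (X.Du t)
  kinetic : ∃ C : ℝ≥0, ∀ᵐ t ∂(volume.restrict (Ioo 0 P.T)),
    (∫⁻ y in X.dom t, ENNReal.ofReal (X.ρ t y * (X.u t y ⬝ᵥ X.u t y))) ≤ C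
  -- traces and kinematic coupling
  uTop_int : IntegrableOn (fun p : ℝ × E2 => X.uTop p.1 p.2) (GammaT P.T)
  uBot_int : IntegrableOn (fun p : ℝ × E2 => X.uBot p.1 p.2) (GammaT P.T)
  u_trace : ∀ᵐ t ∂(volume.restrict (Ioo 0 P.T)),
    IsTrace X.w.val t (X.u t) (X.Du t) (X.uTop t) (X.uBot t)
  coupling_top : ∀ᵐ t ∂(volume.restrict (Ioo 0 P.T)), ∀ᵐ x ∂(volume.restrict cell),
    X.uTop t x ⬝ᵥ X.nrm t x = X.w.vel t x
  coupling_bot : ∀ᵐ t ∂(volume.restrict (Ioo 0 P.T)), ∀ᵐ x ∂(volume.restrict cell),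
    X.uBot t x ⬝ᵥ e3 = 0
  -- renormalized continuity equation
  continuity : ∀ b : ℝ → ℝ, IsRenorm b → ∀ φ : ℝ → E3 → ℝ, IsSmoothField φ →
    ∀ᵐ τ ∂(volume.restrict (Ioo 0 P.T)),
      (∫ t in (0)..τ, ∫ y in X.dom t,
        (b (X.ρ t y) * (dt φ t y + X.u t y ⬝ᵥ gradE (φ t) y)
          + (b (X.ρ t y) - derivWithin b (Ici 0) (X.ρ t y) * X.ρ t y) * tr3 (X.Du t y) * φ t y))
      = (∫ y in X.dom τ, b (X.ρ τ y) * φ τ y) - ∫ y in X.dom 0, b (D.ρ₀ y) * φ 0 y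
  -- coupled momentum equation
  momentum : ∀ φ : ℝ → E3 → E3, IsSmoothField φ → ∀ ψ ∈ K, ∀ ψt ψg ψh,
    IsPlateTest P.T ψ ψt ψg ψh → Compatible P X φ ψ →
    ∀ᵐ τ ∂(volume.restrict (Ioo 0 P.T)),
      (∫ t in (0)..τ, ∫ y in X.dom t, momentumBulk P X φ t y)
        + (∫ t in (0)..τ, ∫ x in cell, momentumPlate P X φ ψ ψt ψg ψh t x)
      = (∫ y in X.dom τ, X.ρ τ y * (X.u τ y ⬝ᵥ φ τ y)) + (∫ x in cell, X.w.vel τ x * ψ τ x)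
        - (∫ y in X.dom 0, D.ρ₀ y * (D.u₀ y ⬝ᵥ φ 0 y)) - ∫ x in cell, D.w₁ x * ψ 0 x
  -- energy inequality
  viscous_int : IntegrableOn (fun p : ℝ × E3 => frob (P.S (X.Du p.1 p.2)) (X.Du p.1 p.2))
    (QT X.w.val P.T)
  plate_int : IntegrableOn (fun p : ℝ × E2 => plateDissipation P X p.1 p.2) (GammaT P.T)
  energy : ∀ᵐ τ ∂(volume.restrict (Ioo 0 P.T)),
    (∫ y in X.dom τ, fluidEnergy P (X.ρ τ y) (X.u τ y))
      + (∫ x in cell, plateEnergy (X.w.vel τ x) (lap (X.w.hess τ x)))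
      + P.ν * (∫ t in (0)..τ, ∫ y in X.dom t, frob (P.S (X.Du t y)) (X.Du t y))
      + (∫ t in (0)..τ, ∫ x in cell, plateDissipation P X t x)
    ≤ (∫ y in X.dom 0, fluidEnergy P (D.ρ₀ y) (D.u₀ y))
      + ∫ x in cell, plateEnergy (D.w₁ x) (lap (X.w.hess 0 x))

/-! ### Test triples and the relative energy -/

/-- A test displacement: `W` with its derivatives in the energy class, and `∂ₜ²W`, `∇²∂ₜW`,
`∇ΔW`. -/
structure TestPlate where
  fields : PlateFields
  acc : ℝ → E2 → ℝ
  velHess : ℝ → E2 → Fin 2 → Fin 2 → ℝ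
  gradLap : ℝ → E2 → E2

/-- `W` is in the energy class, `∂ₜW` is a plate test function in `K`, and
`∇ΔW ∈ L²(Γ_T)`, so that `Δ²W ∈ L²(0,T;H⁻¹(Γ))`. -/
structure TestPlate.Admissible (T : ℝ) (K : Set (ℝ → E2 → ℝ)) (W : TestPlate) : Prop where
  energyClass : W.fields.EnergyClass T
  vel_mem : W.fields.vel ∈ K
  vel_test : IsPlateTest T W.fields.vel W.acc W.fields.velGrad W.velHess
  gradLap_memLp : MemLp (fun p : ℝ × E2 => W.gradLap p.1 p.2) 2 (volume.restrict (GammaT T))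
  weakGradLap : ∀ᵐ t ∂(volume.restrict (Ioo 0 T)),
    IsWeakGrad (fun x => lap (W.fields.hess t x)) (W.gradLap t)

/-- Integrand over `Ω^w(t)` of the relative energy. -/
def relFluid (P : Params) (ρ : ℝ) (u : E3) (r : ℝ) (U : E3) : ℝ :=
  1 / 2 * ρ * ((u - U) ⬝ᵥ (u - U))
    + 1 / (P.ε ^ 2 * (P.γ - 1)) * (P.p ρ - P.p' r * (ρ - r) - P.p r)

/-- Integrand over `Γ` of the relative energy, from the plate velocities and the Laplacians. -/
def relPlate (v l V L : ℝ) : ℝ := 1 / 2 * (v - V) ^ 2 + 1 / 2 * (l - L) ^ 2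

/-- The relative energy at time `τ`. -/
def relEnergy (P : Params) (X : State) (r : ℝ → E3 → ℝ) (U : ℝ → E3 → E3) (W : TestPlate)
    (τ : ℝ) : ℝ :=
  (∫ y in X.dom τ, relFluid P (X.ρ τ y) (X.u τ y) (r τ y) (U τ y))
    + ∫ x in cell, relPlate (X.w.vel τ x) (lap (X.w.hess τ x))
        (W.fields.vel τ x) (lap (W.fields.hess τ x))

/-- The relative energy at time `0`, from the initial data. -/
def relEnergyInit (P : Params) (D : InitialData) (X : State) (r : ℝ → E3 → ℝ) (U : ℝ → E3 → E3)
    (W : TestPlate) : ℝ :=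
  (∫ y in X.dom 0, relFluid P (D.ρ₀ y) (D.u₀ y) (r 0 y) (U 0 y))
    + ∫ x in cell, relPlate (D.w₁ x) (lap (X.w.hess 0 x))
        (W.fields.vel 0 x) (lap (W.fields.hess 0 x))

/-- `(S(∇u) - S(∇U)) : (∇u - ∇U)`. -/
def relViscous (P : Params) (X : State) (U : ℝ → E3 → E3) (t : ℝ) (y : E3) : ℝ :=
  frob (P.S (X.Du t y) - P.S (jac (U t) y)) (X.Du t y - jac (U t) y)

/-- Integrand over `Γ` of the relative dissipation. -/
def relPlateDissipation (P : Params) (X : State) (U : ℝ → E3 → E3) (W : TestPlate)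
    (t : ℝ) (x : E2) : ℝ :=
  let s := X.slip t x (X.uTop t x - U t (Phi X.w.val t x)) (X.w.vel t x - W.fields.vel t x)
  let s₀ := tang e3 (X.uBot t x - U t (pt x 0))
  let g := X.w.velGrad t x - W.fields.velGrad t x
  P.α * P.ν * (s ⬝ᵥ s) * area (X.w.grad t x) + P.α₀ * P.ν * (s₀ ⬝ᵥ s₀) + P.νs * (g ⬝ᵥ g)

/-- Integrand over `Ω^w(t)` of the remainder. -/
def remainderBulk (P : Params) (X : State) (r : ℝ → E3 → ℝ) (U : ℝ → E3 → E3)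
    (t : ℝ) (y : E3) : ℝ :=
  -(X.ρ t y * ((X.u t y - U t y) ⬝ᵥ (dt U t y + advect (X.u t y) (jac (U t) y))))
    - 1 / P.ε ^ 2 * (P.p (X.ρ t y) - P.p (r t y)) * tr3 (jac (U t) y)
    - P.ν * frob (P.S (jac (U t) y)) (X.Du t y - jac (U t) y)
    - 1 / P.ε ^ 2 * (1 / (P.γ - 1)) *
        ((X.ρ t y - r t y) * (dt (fun s z => P.p' (r s z)) t y
            + U t y ⬝ᵥ gradE (fun z => P.p' (r t z)) y)
          + X.ρ t y * ((X.u t y - U t y) ⬝ᵥ gradE (fun z => P.p' (r t z)) y))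

/-- Integrand over `Γ` of the remainder: the pressure term on `Γ^w(t)` (where unit normal times
surface measure is `n^w dx`), the plate term, and the two slip terms. The bilaplacian is paired
with `f = ∂ₜw - ∂ₜW ∈ H¹(Γ)` by duality, `⟨Δ²W, f⟩ = -∫ ∇ΔW · ∇f`. -/
def remainderPlate (P : Params) (X : State) (r : ℝ → E3 → ℝ) (U : ℝ → E3 → E3) (W : TestPlate)
    (t : ℝ) (x : E2) : ℝ :=
  let y := Phi X.w.val t x
  1 / P.ε ^ 2 * (P.p (r t y) - P.p P.ρbar) * ((X.uTop t x - U t y) ⬝ᵥ X.nrm t x)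
    - ((X.w.vel t x - W.fields.vel t x) * (W.acc t x - P.νs * lap (W.velHess t x))
        - W.gradLap t x ⬝ᵥ (X.w.velGrad t x - W.fields.velGrad t x))
    - P.α * P.ν * (X.slip t x (U t y) (W.fields.vel t x)
        ⬝ᵥ X.slip t x (X.uTop t x - U t y) (X.w.vel t x - W.fields.vel t x))
        * area (X.w.grad t x)
    - P.α₀ * P.ν * (tang e3 (U t (pt x 0)) ⬝ᵥ tang e3 (X.uBot t x - U t (pt x 0)))

/-- The remainder `R(t)`. -/
def remainder (P : Params) (X : State) (r : ℝ → E3 → ℝ) (U : ℝ → E3 → E3) (W : TestPlate)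
    (t : ℝ) : ℝ :=
  (∫ y in X.dom t, remainderBulk P X r U t y) + ∫ x in cell, remainderPlate P X r U W t x

end FSI

end

namespace FSI

/-! ### Measure theory of the periodic geometry -/

/-! Expanding the squares and using p'(r) r = γ p(r) turns the relative energy into the energy of
the solution plus terms affine in ρ and ρu (`relFluid_eq`) and, on the plate, plus products of the
solution with the test displacement (`integrable_relPlate`). Each piece has a known evolution. The
energy obeys the energy inequality, the only inequality in the argument. The cross terms -ρu·U and
-∂ₜw ∂ₜW are given together by the momentum equation tested with (U, ∂ₜW). The terms ρ|U|²/2 and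
ρp'(r) are given by the continuity equation tested with |U|²/2 and p'(r).

Two groups are left over, and no equation of the solution describes them. The first is the integral
of q = p(r) - p(ρbar) over the moving domain (`pressure_work`): Reynolds' theorem (`transport`)
produces the boundary flux q ∂ₜw, the divergence theorem for qU produces q ∂ₜW, and by the kinematic
conditions the difference is q (u - U)·n. The second consists of |∂ₜW|²/2, ΔwΔW and |ΔW|²/2 on the
plate (`plate_work`). The difficulty here is the mixed term, since ∂ₜw is only in L²(0,T;H¹) and
Δ∂ₜw has to be replaced by a pairing of ∇∂ₜw with ∇ΔW (`integral_lap_mul_lap_sub`).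

The low regularity of the displacement is handled by Fourier series. Testing weak derivatives with
cosines and sines gives their coefficients, Parseval's identity gives Green's formula, and every
mode is absolutely continuous in time, so that evolution formulas hold mode by mode and are summed
by dominated convergence. On a two-dimensional torus the series of an H² function converges
absolutely. This yields the embedding into L^∞, needed for the friction terms, and, through
approximation by partial sums, a chain rule (`integral_weak_chain`) from which the divergence
theorem below an H² graph follows.

The pointwise identities `bulk_identity` and `plate_identity` say that the integrand of the
remainder is precisely the resulting combination, so that integrating them and inserting the
evolution formulas finishes the proof when r is positive everywhere. The general case replaces r,
away from the closed fluid domain, by a smooth positive function. -/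

theorem measurableSet_cell : MeasurableSet cell :=
  MeasurableSet.univ_pi fun _ => measurableSet_Ico

theorem cell_ae_eq_Icc : cell =ᵐ[volume] (Icc 0 1 : Set E2) := by
  have := Measure.univ_pi_Ico_ae_eq_Icc (μ := fun _ : Fin 2 => (volume : Measure ℝ))
    (f := fun _ => (0 : ℝ)) (g := fun _ => (1 : ℝ))
  exact this

theorem cell_subset_Icc : cell ⊆ (Icc 0 1 : Set E2) := fun _ hx =>
  ⟨fun i => (hx i (mem_univ i)).1, fun i => (hx i (mem_univ i)).2.le⟩

theorem volume_cell : volume cell = 1 := by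
  rw [cell, Real.volume_pi_Ico]; simp

instance isProbabilityMeasure_cell : IsProbabilityMeasure (volume.restrict cell) :=
  ⟨by simp [volume_cell]⟩

theorem continuous_base : Continuous base := by
  refine continuous_pi fun i => ?_
  fin_cases i <;> simp [base] <;> fun_prop

theorem continuous_pt : Continuous fun p : E2 × ℝ => pt p.1 p.2 := by
  refine continuous_pi fun i => ?_
  fin_cases i <;> simp [pt] <;> fun_prop

@[simp] theorem base_pt (x : E2) (z : ℝ) : base (pt x z) = x := by
  ext i; fin_cases i <;> simp [base, pt]

@[simp] theorem pt_two (x : E2) (z : ℝ) : pt x z 2 = z := by simp [pt]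

theorem pt_base (y : E3) : pt (base y) (y 2) = y := by
  ext i; fin_cases i <;> simp [base, pt]

/-- The coordinates `(x, z) ↦ (x, z)` as a measurable equivalence `ℝ² × ℝ ≃ ℝ³`. -/
def ptEquiv : E2 × ℝ ≃ᵐ E3 where
  toFun p := pt p.1 p.2
  invFun y := (base y, y 2)
  left_inv p := by simp
  right_inv y := pt_base y
  measurable_toFun := continuous_pt.measurable
  measurable_invFun := (continuous_base.prodMk (continuous_apply 2)).measurable

theorem measurePreserving_ptEquiv : MeasurePreserving ptEquiv volume volume := by
  have h := (volume_preserving_piFinSuccAbove (fun _ : Fin 3 => ℝ) 2).symm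
  have h2 : MeasurePreserving (Prod.swap : E2 × ℝ → ℝ × E2) volume volume :=
    Measure.measurePreserving_swap
  have h3 : ⇑ptEquiv = ⇑(MeasurableEquiv.piFinSuccAbove (fun _ : Fin 3 => ℝ) 2).symm ∘
      Prod.swap := by
    funext p i
    fin_cases i <;> rfl
  rw [h3]
  exact h.comp h2

/-- The region over the cell below the graph of `h`. -/
def subgraph (h : E2 → ℝ) : Set E3 := {y | base y ∈ cell ∧ 0 < y 2 ∧ y 2 < h (base y)}

theorem Omega_eq_subgraph (w : ℝ → E2 → ℝ) (t : ℝ) :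
    Omega w t = subgraph fun x => 1 + w t x := rfl

theorem measurableSet_subgraph {h : E2 → ℝ} (hh : Continuous h) :
    MeasurableSet (subgraph h) := by
  have h1 : MeasurableSet {y : E3 | base y ∈ cell} :=
    continuous_base.measurable measurableSet_cell
  have h2 : MeasurableSet {y : E3 | 0 < y 2} :=
    measurableSet_lt measurable_const (measurable_pi_apply 2)
  have h3 : MeasurableSet {y : E3 | y 2 < h (base y)} :=
    measurableSet_lt (measurable_pi_apply 2) (hh.comp continuous_base).measurable
  exact h1.inter (h2.inter h3)

/-- The box over the closed cell of height `M`. -/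
def box (M : ℝ) : Set E3 := Icc 0 ![1, 1, M]

theorem isCompact_box (M : ℝ) : IsCompact (box M) := isCompact_Icc

theorem pt_mem_box {x : E2} {z M : ℝ} (hx : x ∈ (Icc 0 1 : Set E2)) (hz : z ∈ Icc 0 M) :
    pt x z ∈ box M := by
  constructor <;> intro i <;> fin_cases i
  · exact hx.1 0
  · exact hx.1 1
  · exact hz.1
  · exact hx.2 0
  · exact hx.2 1
  · exact hz.2

theorem subgraph_subset_box {h : E2 → ℝ} {M : ℝ} (hM : ∀ x, h x ≤ M) :
    subgraph h ⊆ box M := by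
  intro y hy
  rw [← pt_base y]
  exact pt_mem_box (cell_subset_Icc hy.1) ⟨hy.2.1.le, hy.2.2.le.trans (hM _)⟩

theorem volume_subgraph_lt_top {h : E2 → ℝ} {M : ℝ} (hM : ∀ x, h x ≤ M) :
    volume (subgraph h) < ⊤ :=
  (measure_mono (subgraph_subset_box hM)).trans_lt (isCompact_box M).measure_lt_top

theorem integrableOn_subgraph {E : Type*} [NormedAddCommGroup E] {f : E3 → E} (hf : Continuous f)
    {h : E2 → ℝ} {M : ℝ} (hM : ∀ x, h x ≤ M) : IntegrableOn f (subgraph h) :=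
  (hf.continuousOn.integrableOn_compact (isCompact_box M)).mono_set (subgraph_subset_box hM)

/-- Fubini over the region below a graph, with heights rescaled to the unit interval. -/
theorem integral_subgraph {f : E3 → ℝ} (hf : Continuous f) {h : E2 → ℝ} (hh : Continuous h)
    {M : ℝ} (hM : ∀ x, h x ≤ M) (hpos : ∀ x, 0 < h x) :
    ∫ y in subgraph h, f y = ∫ x in cell, ∫ s in (0 : ℝ)..1, f (pt x (s * h x)) * h x := by
  have hint : Integrable ((subgraph h).indicator f) :=
    (integrable_indicator_iff (measurableSet_subgraph hh)).2 (integrableOn_subgraph hf hM)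
  rw [← integral_indicator (measurableSet_subgraph hh),
    ← measurePreserving_ptEquiv.integral_comp ptEquiv.measurableEmbedding,
    Measure.volume_eq_prod, integral_prod _ (by
      rw [← Measure.volume_eq_prod]
      exact (measurePreserving_ptEquiv.integrable_comp_emb ptEquiv.measurableEmbedding).2 hint),
    ← integral_indicator measurableSet_cell]
  congr 1
  ext x
  by_cases hx : x ∈ cell
  · rw [indicator_of_mem hx]
    have h1 : ∀ z, (subgraph h).indicator f (ptEquiv (x, z))
        = (Ioo 0 (h x)).indicator (fun z => f (pt x z)) z := by
      intro z
      simp only [indicator]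
      congr 1
      simp [subgraph, ptEquiv, hx]
    simp_rw [h1]
    rw [integral_indicator measurableSet_Ioo, ← integral_Ioc_eq_integral_Ioo,
      ← intervalIntegral.integral_of_le (hpos x).le, intervalIntegral.integral_mul_const,
      intervalIntegral.integral_comp_mul_right (fun z => f (pt x z)) (hpos x).ne']
    simp
    field_simp [(hpos x).ne']
  · rw [indicator_of_notMem hx]
    have h1 : ∀ z, (subgraph h).indicator f (ptEquiv (x, z)) = 0 := by
      intro z
      refine indicator_of_notMem ?_ _
      simp [subgraph, ptEquiv, hx]
    simp [h1]

/-! ### Functions on the lateral cylinder and on the moving cylinder -/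

theorem volume_GammaT (T : ℝ) : (volume.restrict (GammaT T) : Measure (ℝ × E2))
    = (volume.restrict (Ioo 0 T)).prod (volume.restrict cell) := by
  rw [GammaT, Measure.prod_restrict, Measure.volume_eq_prod]

instance isFiniteMeasure_GammaT (T : ℝ) :
    IsFiniteMeasure (volume.restrict (GammaT T) : Measure (ℝ × E2)) := by
  rw [volume_GammaT]; infer_instance

theorem measurableSet_GammaT (T : ℝ) : MeasurableSet (GammaT T) :=
  measurableSet_Ioo.prod measurableSet_cell

theorem slice_GammaT {E : Type*} [NormedAddCommGroup E] {T : ℝ} {f : ℝ × E2 → E}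
    (hf : IntegrableOn f (GammaT T)) :
    ∀ᵐ t ∂(volume.restrict (Ioo 0 T)), IntegrableOn (fun x => f (t, x)) cell := by
  rw [IntegrableOn, volume_GammaT] at hf
  exact hf.prod_right_ae

theorem integrableOn_slice_GammaT {E : Type*} [NormedAddCommGroup E] [NormedSpace ℝ E] {T : ℝ}
    {f : ℝ × E2 → E} (hf : IntegrableOn f (GammaT T)) :
    IntegrableOn (fun t => ∫ x in cell, f (t, x)) (Ioo 0 T) := by
  rw [IntegrableOn, volume_GammaT] at hf
  exact hf.integral_prod_left

/-- An iterated almost-everywhere statement passes to the product measure only for measurable sets.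
Replacing both functions by strongly measurable versions makes the set of equality measurable. -/
theorem ae_GammaT_of_ae_ae {β : Type*} [TopologicalSpace β] [TopologicalSpace.MetrizableSpace β]
    {T : ℝ} {f g : ℝ × E2 → β}
    (hf : AEStronglyMeasurable f (volume.restrict (GammaT T)))
    (hg : AEStronglyMeasurable g (volume.restrict (GammaT T)))
    (h : ∀ᵐ t ∂(volume.restrict (Ioo 0 T)), ∀ᵐ x ∂(volume.restrict cell), f (t, x) = g (t, x)) :
    f =ᵐ[volume.restrict (GammaT T)] g := by
  rw [volume_GammaT] at hf hg ⊢
  have h1 := hf.ae_eq_mk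
  have h2 := hg.ae_eq_mk
  have h3 : hf.mk f =ᵐ[(volume.restrict (Ioo 0 T)).prod (volume.restrict cell)] hg.mk g := by
    have hm : MeasurableSet {p | hf.mk f p = hg.mk g p} :=
      hf.stronglyMeasurable_mk.measurableSet_eq_fun hg.stronglyMeasurable_mk
    refine (Measure.ae_prod_iff_ae_ae (p := fun p => hf.mk f p = hg.mk g p) hm).2 ?_
    filter_upwards [h, Measure.ae_ae_of_ae_prod h1, Measure.ae_ae_of_ae_prod h2] with t a b c
    filter_upwards [a, b, c] with x a b c
    rw [← b, ← c, a]
  filter_upwards [h1, h2, h3] with p a b c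
  rw [a, b, c]

section Cylinder

variable {w : ℝ → E2 → ℝ} {T : ℝ}

theorem measurableSet_QT (hw : ContinuousOn (fun p : ℝ × E2 => w p.1 p.2) (Icc 0 T ×ˢ univ)) :
    MeasurableSet (QT w T) := by
  have hS : MeasurableSet (Ioo 0 T ×ˢ (univ : Set E3)) := measurableSet_Ioo.prod .univ
  have hc : ContinuousOn (fun p : ℝ × E3 => 1 + w p.1 (base p.2) - p.2 2) (Ioo 0 T ×ˢ univ) := by
    refine (continuousOn_const.add ?_).sub (by fun_prop)
    exact hw.comp (f := fun p : ℝ × E3 => (p.1, base p.2))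
      (continuous_fst.prodMk (continuous_base.comp continuous_snd)).continuousOn
      (fun p hp => ⟨Ioo_subset_Icc_self hp.1, mem_univ _⟩)
  have h1 : MeasurableSet ((Ioo 0 T ×ˢ (univ : Set E3)) ∩
      (fun p : ℝ × E3 => 1 + w p.1 (base p.2) - p.2 2) ⁻¹' Ioi 0) := by
    exact (hc.isOpen_inter_preimage (isOpen_Ioo.prod isOpen_univ) isOpen_Ioi).measurableSet
  have h2 : MeasurableSet {p : ℝ × E3 | base p.2 ∈ cell ∧ 0 < p.2 2} := by
    have ha : MeasurableSet {p : ℝ × E3 | base p.2 ∈ cell} :=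
      (continuous_base.comp continuous_snd).measurable measurableSet_cell
    have hb : MeasurableSet {p : ℝ × E3 | 0 < p.2 2} :=
      measurableSet_lt measurable_const (by fun_prop)
    exact ha.inter hb
  convert h1.inter h2 using 1
  ext p
  simp only [QT, Omega, mem_ofPred_eq, mem_inter_iff, mem_prod, mem_univ, and_true, mem_preimage,
    mem_Ioi, sub_pos]
  tauto

theorem continuous_slice (hw : ContinuousOn (fun p : ℝ × E2 => w p.1 p.2) (Icc 0 T ×ˢ univ))
    {t : ℝ} (ht : t ∈ Icc 0 T) : Continuous (w t) := by
  rw [← continuousOn_univ]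
  exact hw.comp (f := fun x : E2 => (t, x)) (by fun_prop) (fun x _ => ⟨ht, mem_univ _⟩)

theorem measurableSet_Omega
    (hw : ContinuousOn (fun p : ℝ × E2 => w p.1 p.2) (Icc 0 T ×ˢ univ)) {t : ℝ}
    (ht : t ∈ Icc 0 T) : MeasurableSet (Omega w t) :=
  measurableSet_subgraph (continuous_const.add (continuous_slice hw ht))

theorem indicator_QT {β : Type*} [Zero β] (f : ℝ × E3 → β) {t : ℝ} (ht : t ∈ Ioo 0 T) (y : E3) :
    (QT w T).indicator f (t, y) = (Omega w t).indicator (fun y => f (t, y)) y := by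
  simp only [indicator]
  congr 1
  simp only [QT, mem_ofPred_eq, ht, true_and]

theorem indicator_QT_of_notMem {β : Type*} [Zero β] (f : ℝ × E3 → β) {t : ℝ}
    (ht : t ∉ Ioo 0 T) (y : E3) : (QT w T).indicator f (t, y) = 0 :=
  indicator_of_notMem (fun h => ht h.1) _

theorem aestronglyMeasurable_slice
    (hw : ContinuousOn (fun p : ℝ × E2 => w p.1 p.2) (Icc 0 T ×ˢ univ))
    {E : Type*} [NormedAddCommGroup E] {f : ℝ × E3 → E}
    (hf : AEStronglyMeasurable f (volume.restrict (QT w T))) :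
    ∀ᵐ t ∂(volume.restrict (Ioo 0 T)),
      AEStronglyMeasurable (fun y => f (t, y)) (volume.restrict (Omega w t)) := by
  have h1 := (aestronglyMeasurable_indicator_iff (measurableSet_QT hw)).2 hf
  rw [Measure.volume_eq_prod] at h1
  filter_upwards [ae_restrict_of_ae h1.prodMk_left, ae_restrict_mem measurableSet_Ioo] with t h ht
  simp only [indicator_QT f ht] at h
  exact (aestronglyMeasurable_indicator_iff
    (measurableSet_Omega hw (Ioo_subset_Icc_self ht))).1 h

theorem integrableOn_slice_QT
    (hw : ContinuousOn (fun p : ℝ × E2 => w p.1 p.2) (Icc 0 T ×ˢ univ))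
    {E : Type*} [NormedAddCommGroup E] [NormedSpace ℝ E] {f : ℝ × E3 → E}
    (hf : IntegrableOn f (QT w T)) :
    IntegrableOn (fun t => ∫ y in Omega w t, f (t, y)) (Ioo 0 T) := by
  have h1 := (integrable_indicator_iff (measurableSet_QT hw)).2 hf
  rw [Measure.volume_eq_prod] at h1
  refine (h1.integral_prod_left.integrableOn (s := Ioo 0 T)).congr_fun ?_ measurableSet_Ioo
  intro t ht
  simp only [indicator_QT f ht]
  exact integral_indicator (measurableSet_Omega hw (Ioo_subset_Icc_self ht))

theorem lintegral_QT (hw : ContinuousOn (fun p : ℝ × E2 => w p.1 p.2) (Icc 0 T ×ˢ univ))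
    {f : ℝ × E3 → ℝ≥0∞} (hf : AEMeasurable f (volume.restrict (QT w T))) :
    ∫⁻ p in QT w T, f p = ∫⁻ t in Ioo 0 T, ∫⁻ y in Omega w t, f (t, y) := by
  have h1 := (aemeasurable_indicator_iff (measurableSet_QT hw)).2 hf
  rw [← lintegral_indicator (measurableSet_QT hw), Measure.volume_eq_prod,
    lintegral_prod _ h1, ← lintegral_indicator measurableSet_Ioo]
  congr 1
  ext t
  by_cases ht : t ∈ Ioo 0 T
  · rw [indicator_of_mem ht]
    simp only [indicator_QT f ht]
    rw [lintegral_indicator (measurableSet_Omega hw (Ioo_subset_Icc_self ht))]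
  · rw [indicator_of_notMem ht]
    simp [indicator_QT_of_notMem f ht]

/-- A continuous displacement of the compact cylinder, periodic in space, is bounded. -/
theorem exists_height_bound
    (hw : ContinuousOn (fun p : ℝ × E2 => w p.1 p.2) (Icc 0 T ×ˢ univ))
    (hper : ∀ t, Periodic2 (w t)) : ∃ M > 0, ∀ t ∈ Icc 0 T, ∀ x, |1 + w t x| ≤ M := by
  have hK : IsCompact (Icc 0 T ×ˢ (Icc 0 1 : Set E2)) := isCompact_Icc.prod isCompact_Icc
  obtain ⟨M, hM⟩ := hK.exists_bound_of_continuousOn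
    ((continuousOn_const (c := (1 : ℝ))).add (hw.mono (prod_mono_right (subset_univ _))))
  refine ⟨max M 1, by positivity, fun t ht x => ?_⟩
  -- Translation by integers brings `x` into the unit square, where compactness applies.
  have h1 := hper t x fun i => -⌊x i⌋
  rw [← h1]
  refine (hM (t, _) ⟨ht, ?_⟩).trans (le_max_left _ _)
  constructor <;> intro i
  · have := Int.floor_le (x i); simp; linarith
  · have := (Int.lt_floor_add_one (x i)).le; simp; linarith

theorem QT_subset_box {M : ℝ} (hM : ∀ t ∈ Icc 0 T, ∀ x, |1 + w t x| ≤ M) :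
    QT w T ⊆ Icc 0 T ×ˢ box M := fun p hp =>
  ⟨Ioo_subset_Icc_self hp.1,
    -- The truncation bounds the height by `M` whatever the time is; at times in [0,T] it changes
    -- nothing.
    subgraph_subset_box (h := fun x => 1 + w p.1 x ⊓ (M - 1)) (fun x => by
      have := inf_le_right (a := w p.1 x) (b := M - 1); linarith)
      ⟨hp.2.1, hp.2.2.1, by
        have h1 := le_of_abs_le (hM p.1 (Ioo_subset_Icc_self hp.1) (base p.2))
        show p.2 2 < 1 + min (w p.1 (base p.2)) (M - 1)
        rw [min_eq_left (by linarith)]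
        exact hp.2.2.2⟩⟩

theorem volume_QT_lt_top {M : ℝ} (hM : ∀ t ∈ Icc 0 T, ∀ x, |1 + w t x| ≤ M) :
    volume (QT w T) < ⊤ :=
  (measure_mono (QT_subset_box hM)).trans_lt (isCompact_Icc.prod (isCompact_box M)).measure_lt_top

theorem integrableOn_QT_mul_continuous {M : ℝ} (hM : ∀ t ∈ Icc 0 T, ∀ x, |1 + w t x| ≤ M)
    (hw : ContinuousOn (fun p : ℝ × E2 => w p.1 p.2) (Icc 0 T ×ˢ univ))
    {f g : ℝ × E3 → ℝ} (hf : IntegrableOn f (QT w T)) (hg : Continuous g) :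
    IntegrableOn (fun p => f p * g p) (QT w T) := by
  obtain ⟨C, hC⟩ := (isCompact_Icc.prod (isCompact_box M)).exists_bound_of_continuousOn
    (f := g) (s := Icc 0 T ×ˢ box M) hg.continuousOn
  refine Integrable.mul_bdd (c := C) hf hg.aestronglyMeasurable ?_
  filter_upwards [ae_restrict_mem (measurableSet_QT hw)] with p hp
  exact hC p (QT_subset_box hM hp)

theorem integrableOn_QT_continuous {M : ℝ} (hM : ∀ t ∈ Icc 0 T, ∀ x, |1 + w t x| ≤ M)
    {g : ℝ × E3 → ℝ} (hg : Continuous g) : IntegrableOn g (QT w T) :=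
  (hg.continuousOn.integrableOn_compact (isCompact_Icc.prod (isCompact_box M))).mono_set
    (QT_subset_box hM)

end Cylinder

/-! ### Fourier series on the cell -/

section Fourier

open Complex
open scoped ComplexConjugate

/-- `k · x`. -/
noncomputable def phase (k : Fin 2 → ℤ) (x : E2) : ℝ := 2 * Real.pi * (k 0 * x 0 + k 1 * x 1)

/-- The character `x ↦ exp (2πi k · x)`. -/
noncomputable def chr (k : Fin 2 → ℤ) (x : E2) : ℂ := exp (phase k x * I)

/-- Fourier coefficients of a real function on the cell. -/
noncomputable def fc (f : E2 → ℝ) (k : Fin 2 → ℤ) : ℂ := ∫ x in cell, f x * conj (chr k x)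

theorem contDiff_phase (k : Fin 2 → ℤ) : ContDiff ℝ ∞ (phase k) := by
  unfold phase; fun_prop

theorem continuous_chr (k : Fin 2 → ℤ) : Continuous (chr k) := by
  unfold chr
  have := (contDiff_phase k).continuous
  fun_prop

@[simp] theorem norm_chr (k : Fin 2 → ℤ) (x : E2) : ‖chr k x‖ = 1 :=
  norm_exp_ofReal_mul_I _

theorem chr_re (k : Fin 2 → ℤ) (x : E2) : (chr k x).re = Real.cos (phase k x) :=
  exp_ofReal_mul_I_re _

theorem chr_im (k : Fin 2 → ℤ) (x : E2) : (chr k x).im = Real.sin (phase k x) :=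
  exp_ofReal_mul_I_im _

theorem hasFDerivAt_phase (k : Fin 2 → ℤ) (x : E2) :
    HasFDerivAt (phase k) ((2 * Real.pi) • ((k 0 : ℝ) • ContinuousLinearMap.proj (R := ℝ)
      (φ := fun _ : Fin 2 => ℝ) 0
      + (k 1 : ℝ) • ContinuousLinearMap.proj (R := ℝ) (φ := fun _ : Fin 2 => ℝ) 1)) x := by
  unfold phase
  exact (((hasFDerivAt_apply (𝕜 := ℝ) (0 : Fin 2) x).const_mul (k 0 : ℝ)).add
    ((hasFDerivAt_apply (𝕜 := ℝ) (1 : Fin 2) x).const_mul (k 1 : ℝ))).const_mul _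

theorem fderiv_phase_single (k : Fin 2 → ℤ) (x : E2) (i : Fin 2) :
    fderiv ℝ (phase k) x (Pi.single i 1) = 2 * Real.pi * k i := by
  rw [(hasFDerivAt_phase k x).fderiv]
  fin_cases i <;> simp

theorem phase_add_int (k : Fin 2 → ℤ) (x : E2) (m : Fin 2 → ℤ) :
    phase k (x + fun i => (m i : ℝ)) = phase k x + (k 0 * m 0 + k 1 * m 1 : ℤ) * (2 * Real.pi) := by
  simp only [phase, Pi.add_apply]; push_cast; ring

-- The normalised Haar measure, for which the characters of the torus are orthonormal.
noncomputable local instance : MeasureSpace UnitAddCircle := ⟨AddCircle.haarAddCircle⟩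

/-- The lift of a function on `(0,1]²` to the torus. -/
noncomputable def torusLift (f : E2 → ℝ) (y : UnitAddTorus (Fin 2)) : ℂ :=
  f (UnitAddTorus.measurableEquivPiIoc 0 y).1

/-- The torus is parametrised by (0,1]² while the cell is [0,1)²; both differ from the closed square
by null sets. -/
theorem setOf_Ioc_ae_eq_cell :
    {x : E2 | ∀ i, x i ∈ Ioc ((0 : Fin 2 → ℝ) i) ((0 : Fin 2 → ℝ) i + 1)} =ᵐ[volume] cell := by
  have h := Measure.univ_pi_Ioc_ae_eq_Icc (μ := fun _ : Fin 2 => (volume : Measure ℝ))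
    (f := fun _ => (0 : ℝ)) (g := fun _ => (1 : ℝ))
  have h2 : {x : E2 | ∀ i, x i ∈ Ioc ((0 : Fin 2 → ℝ) i) ((0 : Fin 2 → ℝ) i + 1)}
      = univ.pi fun _ => Ioc (0 : ℝ) 1 := by
    ext x; simp [Set.mem_pi]
  rw [h2]
  exact h.trans cell_ae_eq_Icc.symm

theorem torusLift_coe (f : E2 → ℝ) {x : E2}
    (hx : x ∈ {x : E2 | ∀ i, x i ∈ Ioc ((0 : Fin 2 → ℝ) i) ((0 : Fin 2 → ℝ) i + 1)}) :
    torusLift f (fun i => (x i : UnitAddCircle)) = f x := by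
  have h := (UnitAddTorus.measurableEquivPiIoc (0 : Fin 2 → ℝ)).apply_symm_apply ⟨x, hx⟩
  rw [UnitAddTorus.coe_symm_measurableEquivPiIoc_apply] at h
  rw [torusLift]
  erw [h]

theorem memLp_torusLift {f : E2 → ℝ} (hf : MemLp f 2 (volume.restrict cell)) :
    MemLp (torusLift f) 2 volume := by
  have hS : MeasurableSet {x : E2 | ∀ i, x i ∈ Ioc ((0 : Fin 2 → ℝ) i) ((0 : Fin 2 → ℝ) i + 1)} :=
    MeasurableSet.univ_pi' fun i => measurableSet_Ioc
  rw [← Measure.restrict_congr_set setOf_Ioc_ae_eq_cell, ← map_comap_subtype_coe hS] at hf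
  have h1 := ((MeasurableEmbedding.subtype_coe hS).memLp_map_measure_iff).1 hf
  exact (h1.comp_measurePreserving (UnitAddTorus.measurePreserving_equivPiIoc 0)).ofReal

theorem integral_torus (G : UnitAddTorus (Fin 2) → ℂ) (g : E2 → ℂ)
    (h : ∀ x ∈ {x : E2 | ∀ i, x i ∈ Ioc ((0 : Fin 2 → ℝ) i) ((0 : Fin 2 → ℝ) i + 1)},
      G (fun i => (x i : UnitAddCircle)) = g x) :
    ∫ y, G y = ∫ x in cell, g x := by
  rw [UnitAddTorus.integral_preimage G 0, ← setIntegral_congr_set setOf_Ioc_ae_eq_cell]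
  exact setIntegral_congr_fun (MeasurableSet.univ_pi' fun i => measurableSet_Ioc) h

theorem mFourier_coe (k : Fin 2 → ℤ) (x : E2) :
    UnitAddTorus.mFourier k (fun i => (x i : UnitAddCircle)) = chr k x := by
  simp only [UnitAddTorus.mFourier, ContinuousMap.coe_mk, fourier_coe_apply, Fin.prod_univ_two,
    ← Complex.exp_add, chr, phase]
  congr 1
  push_cast
  ring

theorem mFourierCoeff_torusLift (f : E2 → ℝ) (k : Fin 2 → ℤ) :
    UnitAddTorus.mFourierCoeff (torusLift f) k = fc f k := by
  refine integral_torus _ _ fun x hx => ?_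
  rw [torusLift_coe f hx, UnitAddTorus.mFourier_neg, mFourier_coe, smul_eq_mul, mul_comm]

/-- **Parseval's identity** on the cell. -/
theorem hasSum_fc {f g : E2 → ℝ} (hf : MemLp f 2 (volume.restrict cell))
    (hg : MemLp g 2 (volume.restrict cell)) :
    HasSum (fun k => conj (fc f k) * fc g k) ((∫ x in cell, f x * g x : ℝ) : ℂ) := by
  have hF := memLp_torusLift hf
  have hG := memLp_torusLift hg
  have h := UnitAddTorus.hasSum_prod_mFourierCoeff (hF.toLp _) (hG.toLp _)
  have h1 : ∀ {f : E2 → ℝ} (hF : MemLp (torusLift f) 2 volume) k,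
      UnitAddTorus.mFourierCoeff (hF.toLp _) k = fc f k := by
    intro f hF k
    rw [← mFourierCoeff_torusLift]
    exact integral_congr_ae (ae_eq_rfl.mul hF.coeFn_toLp)
  simp only [h1] at h
  convert h using 1
  rw [integral_congr_ae (g := fun y => conj (torusLift f y) * torusLift g y) (by
    filter_upwards [hF.coeFn_toLp, hG.coeFn_toLp] with y h1 h2
    rw [h1, h2])]
  refine integral_complex_ofReal.symm.trans (Eq.symm ?_)
  refine integral_torus _ _ fun x hx => ?_
  rw [torusLift_coe f hx, torusLift_coe g hx]
  simp

theorem hasSum_fc_sq {f : E2 → ℝ} (hf : MemLp f 2 (volume.restrict cell)) :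
    HasSum (fun k => ‖fc f k‖ ^ 2) (∫ x in cell, f x ^ 2) := by
  have h := hasSum_re (hasSum_fc hf hf)
  simp only [Complex.ofReal_re] at h
  convert h using 2 with k
  · rw [← Complex.normSq_eq_conj_mul_self, Complex.ofReal_re, Complex.normSq_eq_norm_sq]
  · simp only [sq]

theorem integrable_fc_integrand {f : E2 → ℝ} (hf : IntegrableOn f cell) (k : Fin 2 → ℤ) :
    IntegrableOn (fun x => (f x : ℂ) * conj (chr k x)) cell := by
  refine Integrable.mul_bdd (c := 1) hf.ofReal ?_ ?_
  · exact (continuous_conj.comp (continuous_chr k)).aestronglyMeasurable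
  · exact Filter.Eventually.of_forall fun x => by simp

theorem fc_eq {f : E2 → ℝ} (hf : IntegrableOn f cell) (k : Fin 2 → ℤ) :
    fc f k = (∫ x in cell, f x * Real.cos (phase k x) : ℝ)
      - (∫ x in cell, f x * Real.sin (phase k x) : ℝ) * I := by
  have h := integrable_fc_integrand hf k
  apply Complex.ext
  · rw [fc]
    have := integral_re h
    simp only [RCLike.re_to_complex] at this
    rw [← this]
    simp [chr_re, chr_im]
  · rw [fc]
    have := integral_im h
    simp only [RCLike.im_to_complex] at this
    rw [← this]
    simp [chr_re, chr_im, integral_neg]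

theorem fc_add {f g : E2 → ℝ} (hf : IntegrableOn f cell) (hg : IntegrableOn g cell)
    (k : Fin 2 → ℤ) : fc (fun x => f x + g x) k = fc f k + fc g k := by
  rw [fc, fc, fc, ← integral_add (integrable_fc_integrand hf k) (integrable_fc_integrand hg k)]
  simp [add_mul]

theorem fc_sub {f g : E2 → ℝ} (hf : IntegrableOn f cell) (hg : IntegrableOn g cell)
    (k : Fin 2 → ℤ) : fc (fun x => f x - g x) k = fc f k - fc g k := by
  rw [fc, fc, fc, ← integral_sub (integrable_fc_integrand hf k) (integrable_fc_integrand hg k)]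
  simp [sub_mul]

/-- Fourier coefficients of a weak gradient. -/
theorem IsWeakGrad.fc_eq {f : E2 → ℝ} {g : E2 → E2} (h : IsWeakGrad f g)
    (hf : IntegrableOn f cell) (i : Fin 2) (hg : IntegrableOn (fun x => g x i) cell)
    (k : Fin 2 → ℤ) : fc (fun x => g x i) k = 2 * Real.pi * k i * I * fc f k := by
  have hp := contDiff_phase k
  have hd : ∀ x, HasFDerivAt (phase k) (fderiv ℝ (phase k) x) x := fun x =>
    (hp.differentiable (by simp) x).hasFDerivAt
  -- The real and imaginary parts of a character are themselves smooth periodic test functions, so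
  -- the weak gradient is evaluated on them without any approximation.
  have hc := h (fun x => Real.cos (phase k x)) (Real.contDiff_cos.comp hp) (fun x m => by
    simp only [phase_add_int, Real.cos_add_int_mul_two_pi]) i
  have hs := h (fun x => Real.sin (phase k x)) (Real.contDiff_sin.comp hp) (fun x m => by
    simp only [phase_add_int, Real.sin_add_int_mul_two_pi]) i
  simp only [(hd _).cos.fderiv, (hd _).sin.fderiv, _root_.smul_apply,
    fderiv_phase_single, smul_eq_mul] at hc hs
  rw [FSI.fc_eq hg, FSI.fc_eq hf]
  have e1 : ∫ x in cell, g x i * Real.cos (phase k x)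
      = 2 * Real.pi * k i * ∫ x in cell, f x * Real.sin (phase k x) := by
    rw [← integral_const_mul, eq_comm, ← neg_inj, ← hc, ← integral_neg]
    congr 1; ext x; ring
  have e2 : ∫ x in cell, g x i * Real.sin (phase k x)
      = -(2 * Real.pi * k i * ∫ x in cell, f x * Real.cos (phase k x)) := by
    rw [← integral_const_mul, eq_comm, neg_eq_iff_eq_neg, ← hs]
    congr 1; ext x; ring
  rw [e1, e2]
  apply Complex.ext <;> simp

end Fourier

/-! ### Weak derivatives and Fourier coefficients -/

section WeakDerivatives

open Complex
open scoped ComplexConjugate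

theorem memLp_coord {α ι : Type*} [Fintype ι] [MeasurableSpace α] {E : ι → Type*}
    [∀ i, NormedAddCommGroup (E i)] {μ : Measure α} {p : ℝ≥0∞} {g : α → ∀ i, E i}
    (hg : MemLp g p μ) (i : ι) : MemLp (fun x => g x i) p μ :=
  hg.mono ((continuous_apply i).comp_aestronglyMeasurable hg.1)
    (Filter.Eventually.of_forall fun x => norm_le_pi_norm (g x) i)

theorem memLp_lap {α : Type*} [MeasurableSpace α] {μ : Measure α} {p : ℝ≥0∞}
    {H : α → Fin 2 → Fin 2 → ℝ} (hH : MemLp H p μ) : MemLp (fun x => lap (H x)) p μ := by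
  simp only [lap, Fin.sum_univ_two]
  exact (memLp_coord (memLp_coord hH 0) 0).add (memLp_coord (memLp_coord hH 1) 1)

theorem integrableOn_of_memLp {α E : Type*} [MeasurableSpace α] [NormedAddCommGroup E]
    {μ : Measure α} [IsFiniteMeasure μ] {f : α → E} (hf : MemLp f 2 μ) : Integrable f μ :=
  hf.integrable (by norm_num)

theorem integrable_mul_of_memLp {α : Type*} [MeasurableSpace α] {μ : Measure α} {f g : α → ℝ}
    (hf : MemLp f 2 μ) (hg : MemLp g 2 μ) : Integrable (fun x => f x * g x) μ :=
  hf.integrable_mul hg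

/-- `4π²|k|²`, the eigenvalue of `-Δ` on `chr k`. -/
noncomputable def eig (k : Fin 2 → ℤ) : ℝ := (2 * Real.pi) ^ 2 * ((k 0 : ℝ) ^ 2 + (k 1 : ℝ) ^ 2)

theorem eig_nonneg (k : Fin 2 → ℤ) : 0 ≤ eig k := by unfold eig; positivity

/-- Each weak derivative in direction i multiplies the coefficient by 2πi kᵢ; two of them in each
direction add up to -4π²|k|². -/
theorem fc_lap {f : E2 → ℝ} {g : E2 → E2} {H : E2 → Fin 2 → Fin 2 → ℝ}
    (hfg : IsWeakGrad f g) (hgH : IsWeakHess g H) (hf : MemLp f 2 (volume.restrict cell))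
    (hg : MemLp g 2 (volume.restrict cell)) (hH : MemLp H 2 (volume.restrict cell))
    (k : Fin 2 → ℤ) : fc (fun x => lap (H x)) k = -(eig k) * fc f k := by
  have hi := fun i j => integrableOn_of_memLp (memLp_coord (memLp_coord hH i) j)
  have h1 : ∀ i, fc (fun x => H x i i) k = (2 * Real.pi * k i * I) ^ 2 * fc f k := by
    intro i
    rw [(hgH i).fc_eq (integrableOn_of_memLp (memLp_coord hg i)) i (hi i i),
      hfg.fc_eq (integrableOn_of_memLp hf) i (integrableOn_of_memLp (memLp_coord hg i))]
    ring
  simp only [lap, Fin.sum_univ_two]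
  rw [fc_add (hi 0 0) (hi 1 1), h1, h1, eig]
  push_cast
  linear_combination (2 * Real.pi) ^ 2 * ((k 0 : ℂ) ^ 2 + (k 1 : ℂ) ^ 2) * fc f k * I_sq

/-- Integration by parts on the torus. -/
theorem integral_mul_lap {f : E2 → ℝ} {g G : E2 → E2} {H : E2 → Fin 2 → Fin 2 → ℝ}
    (hfg : IsWeakGrad f g) (hGH : IsWeakHess G H) (hf : MemLp f 2 (volume.restrict cell))
    (hg : MemLp g 2 (volume.restrict cell)) (hG : MemLp G 2 (volume.restrict cell))
    (hH : MemLp H 2 (volume.restrict cell)) :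
    ∫ x in cell, f x * lap (H x) = -∫ x in cell, g x ⬝ᵥ G x := by
  -- By Parseval both sides are sums over modes. The factor 2πi kᵢ is purely imaginary, so moving it
  -- under the conjugation changes the sign.
  have key : ∀ i, ∫ x in cell, f x * H x i i = -∫ x in cell, g x i * G x i := by
    intro i
    have h1 := hasSum_fc hf (memLp_coord (memLp_coord hH i) i)
    have h2 := (hasSum_fc (memLp_coord hg i) (memLp_coord hG i)).neg
    have h3 : (fun k => conj (fc f k) * fc (fun x => H x i i) k)
        = fun k => -(conj (fc (fun x => g x i) k) * fc (fun x => G x i) k) := by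
      ext k
      rw [(hGH i).fc_eq (integrableOn_of_memLp (memLp_coord hG i)) i
        (integrableOn_of_memLp (memLp_coord (memLp_coord hH i) i)),
        hfg.fc_eq (integrableOn_of_memLp hf) i (integrableOn_of_memLp (memLp_coord hg i))]
      simp only [map_mul, conj_ofReal, conj_I, map_ofNat, map_intCast]
      ring
    rw [h3] at h1
    exact_mod_cast h1.unique h2
  simp only [lap, Fin.sum_univ_two, dotProduct, mul_add]
  rw [integral_add, integral_add, key, key]
  · ring
  · exact (memLp_coord hg 0).integrable_mul (memLp_coord hG 0)
  · exact (memLp_coord hg 1).integrable_mul (memLp_coord hG 1)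
  · exact hf.integrable_mul (memLp_coord (memLp_coord hH 0) 0)
  · exact hf.integrable_mul (memLp_coord (memLp_coord hH 1) 1)

/-- Comparison with the lattice sum of |k|⁻⁴, which converges because 4 exceeds the dimension 2 of
the plate. -/
theorem summable_eig : Summable fun k : Fin 2 → ℤ => ((1 + eig k) ^ 2)⁻¹ := by
  have h := EisensteinSeries.summable_one_div_norm_rpow (k := 4) (by norm_num)
  refine Summable.of_norm_bounded_eventually h ?_
  have : ∀ᶠ k : Fin 2 → ℤ in Filter.cofinite, k ≠ 0 :=
    (Set.finite_singleton (0 : Fin 2 → ℤ)).subset fun k hk => by simpa using hk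
  filter_upwards [this] with k hk
  have hpos : 0 < ‖k‖ := norm_pos_iff.2 hk
  have h1 : ‖k‖ ^ 2 ≤ 1 + eig k := by
    have h2 : ‖k‖ ^ 2 ≤ (k 0 : ℝ) ^ 2 + (k 1 : ℝ) ^ 2 := by
      have h3 : ‖k‖ ≤ Real.sqrt ((k 0 : ℝ) ^ 2 + (k 1 : ℝ) ^ 2) := by
        refine (pi_norm_le_iff_of_nonneg (Real.sqrt_nonneg _)).2 fun i => ?_
        rw [Int.norm_eq_abs]
        apply Real.abs_le_sqrt
        fin_cases i <;> simp [sq_nonneg]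
      exact (Real.le_sqrt (norm_nonneg _) (by positivity)).1 h3
    have h4 : (1 : ℝ) ≤ (2 * Real.pi) ^ 2 := by nlinarith [Real.pi_gt_three]
    unfold eig
    nlinarith [sq_nonneg (k 0 : ℝ), sq_nonneg (k 1 : ℝ)]
  rw [Real.norm_of_nonneg (by positivity), Real.rpow_neg hpos.le,
    show (4 : ℝ) = ((4 : ℕ) : ℝ) by norm_num, Real.rpow_natCast]
  refine inv_anti₀ (by positivity) ?_
  calc ‖k‖ ^ 4 = (‖k‖ ^ 2) ^ 2 := by ring
    _ ≤ _ := by gcongr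

/-- The squared norm of the embedding of `H²` into the absolutely convergent Fourier series. -/
noncomputable def eigSum : ℝ := ∑' k, ((1 + eig k) ^ 2)⁻¹

theorem eigSum_nonneg : 0 ≤ eigSum := tsum_nonneg fun k => by positivity

/-- Cauchy–Schwarz for the product of (1 + `eig k`)⁻¹ and (1 + `eig k`)|f̂(k)|, with (1 + a)² ≤ 2(1
+ a²) and Parseval for f and Δf. The bound is uniform in the finite set, hence gives summability,
and it is explicit so that it can later be integrated in time. -/
theorem sum_norm_fc_le {f : E2 → ℝ} {g : E2 → E2} {H : E2 → Fin 2 → Fin 2 → ℝ}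
    (hfg : IsWeakGrad f g) (hgH : IsWeakHess g H) (hf : MemLp f 2 (volume.restrict cell))
    (hg : MemLp g 2 (volume.restrict cell)) (hH : MemLp H 2 (volume.restrict cell))
    (s : Finset (Fin 2 → ℤ)) :
    ∑ k ∈ s, ‖fc f k‖ ≤ Real.sqrt (eigSum
      * (2 * ((∫ x in cell, f x ^ 2) + ∫ x in cell, lap (H x) ^ 2))) := by
  apply Real.le_sqrt_of_sq_le
  have h0 : ∀ k, ‖fc f k‖ = (1 + eig k)⁻¹ * ((1 + eig k) * ‖fc f k‖) := fun k => by
    have := eig_nonneg k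
    field_simp
  rw [Finset.sum_congr rfl fun k _ => h0 k]
  refine (Finset.sum_mul_sq_le_sq_mul_sq _ _ _).trans ?_
  have hs1 := hasSum_fc_sq hf
  have hs2 := hasSum_fc_sq (memLp_lap hH)
  have ht := eigSum_nonneg
  refine mul_le_mul ?_ ?_ (by positivity) ht
  · simp_rw [inv_pow]
    exact summable_eig.sum_le_tsum _ fun k _ => by positivity
  · have h2 := ((hs1.add hs2).mul_left 2)
    refine le_trans (Finset.sum_le_sum fun k _ => ?_) (sum_le_hasSum s
      (fun k _ => by positivity) h2)
    have h3 : ‖fc (fun x => lap (H x)) k‖ = eig k * ‖fc f k‖ := by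
      rw [fc_lap hfg hgH hf hg hH, norm_mul, norm_neg, Complex.norm_real,
        Real.norm_of_nonneg (eig_nonneg k)]
    rw [h3]
    nlinarith [sq_nonneg (‖fc f k‖ - eig k * ‖fc f k‖)]

theorem summable_norm_fc {f : E2 → ℝ} {g : E2 → E2} {H : E2 → Fin 2 → Fin 2 → ℝ}
    (hfg : IsWeakGrad f g) (hgH : IsWeakHess g H) (hf : MemLp f 2 (volume.restrict cell))
    (hg : MemLp g 2 (volume.restrict cell)) (hH : MemLp H 2 (volume.restrict cell)) :
    Summable fun k => ‖fc f k‖ :=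
  summable_of_sum_le (fun _ => norm_nonneg _) (sum_norm_fc_le hfg hgH hf hg hH)

theorem continuous_fourierSeries {c : (Fin 2 → ℤ) → ℂ} (hc : Summable fun k => ‖c k‖) :
    Continuous fun x => (∑' k, c k * chr k x).re :=
  continuous_re.comp (continuous_tsum (fun k => continuous_const.mul (continuous_chr k)) hc
    fun k x => by simp)

theorem abs_fourierSeries_le {c : (Fin 2 → ℤ) → ℂ} (hc : Summable fun k => ‖c k‖) (x : E2) :
    |(∑' k, c k * chr k x).re| ≤ ∑' k, ‖c k‖ := by
  refine (abs_re_le_norm _).trans ?_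
  exact tsum_of_norm_bounded hc.hasSum fun k => by simp

/-- An absolutely convergent Fourier series represents its function. -/
theorem ae_eq_fourierSeries {f : E2 → ℝ} (hf : MemLp f 2 (volume.restrict cell))
    (hc : Summable fun k => ‖fc f k‖) :
    ∀ᵐ x ∂(volume.restrict cell), f x = (∑' k, fc f k * chr k x).re := by
  set S : E2 → ℝ := fun x => (∑' k, fc f k * chr k x).re with hS
  have hSm : MemLp S 2 (volume.restrict cell) :=
    MemLp.of_bound (continuous_fourierSeries hc).aestronglyMeasurable (∑' k, ‖fc f k‖)
      (Filter.Eventually.of_forall fun x => abs_fourierSeries_le hc x)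
  have hd : MemLp (fun x => f x - S x) 2 (volume.restrict cell) := hf.sub hSm
  have hdi : IntegrableOn (fun x => f x - S x) cell := integrableOn_of_memLp hd
  -- Integrating the series of `S` termwise against `f - S` gives, up to conjugation, the Parseval
  -- sum of `f` against `f - S`. Hence the two integrals agree and ∫ (f - S)² = 0; the coefficients
  -- of `S` never have to be computed.
  have h1 : HasSum (fun k => fc f k * conj (fc (fun x => f x - S x) k))
      (∫ x in cell, (∑' k, fc f k * chr k x) * ((f x - S x : ℝ) : ℂ)) := by
    have h2 := hasSum_integral_of_dominated_convergence (μ := volume.restrict cell)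
      (F := fun k x => fc f k * chr k x * ((f x - S x : ℝ) : ℂ))
      (f := fun x => (∑' k, fc f k * chr k x) * ((f x - S x : ℝ) : ℂ))
      (fun k x => ‖fc f k‖ * |f x - S x|) (fun k => ?_) (fun k => ?_) ?_ ?_ ?_
    · refine HasSum.congr_fun h2 fun k => ?_
      simp_rw [mul_assoc]
      rw [integral_const_mul]
      congr 1
      rw [fc, ← integral_conj]
      congr 1; ext x
      simp only [map_mul, conj_ofReal, Complex.conj_conj]
      ring
    · exact ((continuous_const.mul (continuous_chr k)).aestronglyMeasurable).mul
        (continuous_ofReal.comp_aestronglyMeasurable hd.1)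
    · refine Filter.Eventually.of_forall fun x => ?_
      rw [norm_mul, norm_mul, norm_chr, mul_one, Complex.norm_real, Real.norm_eq_abs]
    · exact Filter.Eventually.of_forall fun x => hc.mul_right _
    · simp_rw [tsum_mul_right]
      exact hdi.abs.const_mul _
    · refine Filter.Eventually.of_forall fun x => HasSum.mul_right _ (Summable.hasSum ?_)
      exact Summable.of_norm (by simpa using hc)
  have h2 := hasSum_re h1
  have h3 := hasSum_re (hasSum_fc hf hd)
  have h4 : (fun k => (fc f k * conj (fc (fun x => f x - S x) k)).re)
      = fun k => (conj (fc f k) * fc (fun x => f x - S x) k).re := by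
    ext k; simp
  rw [h4] at h2
  have h5 := h2.unique h3
  have h6 : (∫ x in cell, (∑' k, fc f k * chr k x) * ((f x - S x : ℝ) : ℂ)).re
      = ∫ x in cell, S x * (f x - S x) := by
    have hb : Integrable (fun x => (∑' k, fc f k * chr k x) * ((f x - S x : ℝ) : ℂ))
        (volume.restrict cell) := by
      refine Integrable.bdd_mul (c := ∑' k, ‖fc f k‖) hdi.ofReal ?_ ?_
      · exact (continuous_tsum (fun k => continuous_const.mul (continuous_chr k)) hc
          fun k x => by simp).aestronglyMeasurable
      · exact Filter.Eventually.of_forall fun x =>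
          tsum_of_norm_bounded hc.hasSum fun k => by simp
    have := integral_re hb
    simp only [RCLike.re_to_complex] at this
    rw [← this]
    simp [hS]
  rw [h6, Complex.ofReal_re] at h5
  have h7 : ∫ x in cell, (f x - S x) ^ 2 = 0 := by
    have : ∀ x, (f x - S x) ^ 2 = f x * (f x - S x) - S x * (f x - S x) := fun x => by ring
    simp_rw [this]
    rw [integral_sub (integrable_mul_of_memLp hf hd) (integrable_mul_of_memLp hSm hd), h5, sub_self]
  have h8 := (integral_eq_zero_iff_of_nonneg (fun x => sq_nonneg (f x - S x)) hd.integrable_sq).1 h7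
  filter_upwards [h8] with x hx
  have := pow_eq_zero_iff (two_ne_zero) |>.1 hx
  linarith

/-- The embedding of `H²` of the two-dimensional torus into `L^∞`. -/
theorem ae_sq_le {f : E2 → ℝ} {g : E2 → E2} {H : E2 → Fin 2 → Fin 2 → ℝ}
    (hfg : IsWeakGrad f g) (hgH : IsWeakHess g H) (hf : MemLp f 2 (volume.restrict cell))
    (hg : MemLp g 2 (volume.restrict cell)) (hH : MemLp H 2 (volume.restrict cell)) :
    ∀ᵐ x ∂(volume.restrict cell), f x ^ 2 ≤ eigSum
      * (2 * ((∫ x in cell, f x ^ 2) + ∫ x in cell, lap (H x) ^ 2)) := by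
  have hc := summable_norm_fc hfg hgH hf hg hH
  filter_upwards [ae_eq_fourierSeries hf hc] with x hx
  have h1 : |f x| ≤ _ := hx ▸ (abs_fourierSeries_le hc x)
  have h2 := h1.trans (hc.tsum_le_of_sum_le (sum_norm_fc_le hfg hgH hf hg hH))
  rw [← sq_abs]
  refine (pow_le_pow_left₀ (abs_nonneg _) h2 2).trans_eq (Real.sq_sqrt ?_)
  have := eigSum_nonneg
  have h3 : 0 ≤ ∫ x in cell, f x ^ 2 := integral_nonneg fun x => sq_nonneg _
  have h4 : 0 ≤ ∫ x in cell, lap (H x) ^ 2 := integral_nonneg fun x => sq_nonneg _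
  positivity

end WeakDerivatives

/-! ### Square integrable functions on the lateral cylinder -/

theorem memLp_slice_GammaT {E : Type*} [NormedAddCommGroup E] {T : ℝ} {f : ℝ × E2 → E}
    (hf : MemLp f 2 (volume.restrict (GammaT T))) :
    ∀ᵐ t ∂(volume.restrict (Ioo 0 T)), MemLp (fun x => f (t, x)) 2 (volume.restrict cell) := by
  have h1 := slice_GammaT ((memLp_two_iff_integrable_sq_norm hf.1).1 hf)
  have h2 := hf.1
  rw [volume_GammaT] at h2
  filter_upwards [h1, h2.prodMk_left] with t a b
  exact (memLp_two_iff_integrable_sq_norm b).2 a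

theorem memLp_GammaT_of_bound {E : Type*} [NormedAddCommGroup E] {T : ℝ} {f : ℝ × E2 → E}
    (hf : AEStronglyMeasurable f (volume.restrict (GammaT T))) {C : ℝ≥0}
    (hC : ∀ᵐ t ∂(volume.restrict (Ioo 0 T)),
      eLpNorm (fun x => f (t, x)) 2 (volume.restrict cell) ≤ C) :
    MemLp f 2 (volume.restrict (GammaT T)) := by
  refine ⟨hf, (eLpNorm_lt_top_iff_lintegral_rpow_enorm_lt_top (by norm_num) (by norm_num)).2 ?_⟩
  have hm : AEMeasurable (fun p => ‖f p‖ₑ ^ (2 : ℝ≥0∞).toReal)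
      ((volume.restrict (Ioo 0 T)).prod (volume.restrict cell)) := by
    rw [← volume_GammaT]; exact hf.enorm.pow_const _
  rw [volume_GammaT, lintegral_prod _ hm]
  calc _ ≤ ∫⁻ t in Ioo 0 T, (C : ℝ≥0∞) ^ (2 : ℝ≥0∞).toReal := by
        refine lintegral_mono_ae ?_
        filter_upwards [hC] with t ht
        rw [eLpNorm_eq_lintegral_rpow_enorm_toReal (by norm_num) (by norm_num)] at ht
        have := ENNReal.rpow_le_rpow (z := (2 : ℝ≥0∞).toReal) ht (by norm_num)
        rwa [← ENNReal.rpow_mul, one_div, inv_mul_cancel₀ (by norm_num), ENNReal.rpow_one] at this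
    _ < ⊤ := by
        simp only [lintegral_const, Measure.restrict_apply MeasurableSet.univ, univ_inter,
          Real.volume_Ioo]
        refine ENNReal.mul_lt_top (ENNReal.rpow_lt_top_of_nonneg (by norm_num) (by simp)) (by simp)

/-! ### Absolutely continuous functions of time -/

theorem ae_hasDerivAt_primitive {a T : ℝ} (haT : a ≤ T) {α : ℝ → ℝ}
    (hα : IntervalIntegrable α volume a T) (c : ℝ) :
    ∀ᵐ t ∂(volume.restrict (Ioc a T)),
      HasDerivAt (fun t => c + ∫ s in a..t, α s) (α t) t := by
  rw [ae_restrict_iff' measurableSet_Ioc]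
  filter_upwards [hα.ae_hasDerivAt_integral] with t ht hmem
  have h := ht (by rw [uIcc_of_le haT]; exact Ioc_subset_Icc_self hmem) a left_mem_uIcc
  simpa using h.const_add c

theorem absolutelyContinuous_primitive {a T : ℝ} {α : ℝ → ℝ}
    (hα : IntervalIntegrable α volume a T) (c : ℝ) :
    AbsolutelyContinuousOnInterval (fun t => c + ∫ s in a..t, α s) a T := by
  have h1 : AbsolutelyContinuousOnInterval (fun _ : ℝ => c) a T :=
    ContDiffOn.absolutelyContinuousOnInterval contDiffOn_const
  exact h1.add (hα.absolutelyContinuousOnInterval_intervalIntegral left_mem_uIcc)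

/-- The Leibniz rule for absolutely continuous functions, whose derivatives exist only almost
everywhere. This is all the regularity in time that a single Fourier mode has. -/
theorem primitive_mul {T : ℝ} (hT : 0 ≤ T) {α β : ℝ → ℝ}
    (hα : IntervalIntegrable α volume 0 T) (hβ : IntervalIntegrable β volume 0 T) (a b : ℝ) :
    (a + ∫ s in (0)..T, α s) * (b + ∫ s in (0)..T, β s) - a * b
      = ∫ t in (0)..T, (α t * (b + ∫ s in (0)..t, β s) + (a + ∫ s in (0)..t, α s) * β t) := by
  have h := (absolutelyContinuous_primitive hα a).integral_deriv_mul_eq_sub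
    (absolutelyContinuous_primitive hβ b)
  simp only [intervalIntegral.integral_same, add_zero] at h
  rw [← h, intervalIntegral.integral_of_le hT, intervalIntegral.integral_of_le hT]
  refine integral_congr_ae ?_
  filter_upwards [ae_hasDerivAt_primitive hT hα a, ae_hasDerivAt_primitive hT hβ b] with t h1 h2
  rw [h1.deriv, h2.deriv]

/-! ### The elastic energy of the plate -/

section Plate

open Complex
open scoped ComplexConjugate

theorem integrableOn_fc {T : ℝ} {v : ℝ → E2 → ℝ}
    (hv : IntegrableOn (fun p : ℝ × E2 => v p.1 p.2) (GammaT T)) (k : Fin 2 → ℤ) :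
    IntegrableOn (fun t => fc (v t) k) (Ioo 0 T) := by
  refine integrableOn_slice_GammaT (f := fun p => (v p.1 p.2 : ℂ) * conj (chr k p.2)) ?_
  refine Integrable.mul_bdd (c := 1) hv.ofReal ?_ ?_
  · exact (continuous_conj.comp ((continuous_chr k).comp continuous_snd)).aestronglyMeasurable
  · exact Filter.Eventually.of_forall fun x => by simp

theorem intervalIntegrable_of_Ioo {E : Type*} [NormedAddCommGroup E] {T t : ℝ} {f : ℝ → E}
    (hf : IntegrableOn f (Ioo 0 T)) (ht : t ∈ Icc 0 T) : IntervalIntegrable f volume 0 t := by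
  rw [intervalIntegrable_iff_integrableOn_Ioo_of_le ht.1]
  exact hf.mono_set (Ioo_subset_Ioo_right ht.2)

/-- By Fubini a Fourier coefficient commutes with the integral in time. Consequently every mode of a
primitive is absolutely continuous in time. -/
theorem fc_primitive {T t : ℝ} (ht : t ∈ Icc 0 T) {v : ℝ → E2 → ℝ} {f₀ f : E2 → ℝ}
    (hv : IntegrableOn (fun p : ℝ × E2 => v p.1 p.2) (GammaT T)) (hf₀ : IntegrableOn f₀ cell)
    (h : ∀ᵐ x ∂(volume.restrict cell), f x = f₀ x + ∫ s in (0)..t, v s x) (k : Fin 2 → ℤ) :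
    fc f k = fc f₀ k + ∫ s in (0)..t, fc (v s) k := by
  have hv' : Integrable (fun p : ℝ × E2 => (v p.1 p.2 : ℂ) * conj (chr k p.2))
      ((volume.restrict (Ioc 0 t)).prod (volume.restrict cell)) := by
    rw [Measure.prod_restrict, ← Measure.volume_eq_prod]
    have h1 : IntegrableOn (fun p : ℝ × E2 => v p.1 p.2) (Ioc 0 t ×ˢ cell) := by
      have h2 : (Ioc 0 t ×ˢ cell : Set (ℝ × E2)) ≤ᵐ[volume] GammaT T := by
        have h3 : (Ioo 0 T ×ˢ cell : Set (ℝ × E2)) =ᵐ[volume] Ioc 0 T ×ˢ cell := by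
          rw [Measure.volume_eq_prod]
          exact Measure.set_prod_ae_eq Ioo_ae_eq_Ioc Filter.EventuallyEq.rfl
        refine Filter.EventuallyLE.trans ?_ h3.symm.le
        exact Filter.Eventually.of_forall fun p hp => ⟨⟨hp.1.1, hp.1.2.trans ht.2⟩, hp.2⟩
      exact Integrable.mono_measure hv (Measure.restrict_mono_ae h2)
    refine Integrable.mul_bdd (c := 1) h1.ofReal ?_ ?_
    · exact (continuous_conj.comp ((continuous_chr k).comp continuous_snd)).aestronglyMeasurable
    · exact Filter.Eventually.of_forall fun x => by simp
  have h1 : ∫ s in (0)..t, fc (v s) k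
      = ∫ x in cell, ((∫ s in (0)..t, v s x : ℝ) : ℂ) * conj (chr k x) := by
    rw [intervalIntegral.integral_of_le ht.1]
    simp only [fc]
    rw [integral_integral_swap hv']
    congr 1; ext x
    rw [intervalIntegral.integral_of_le ht.1, integral_mul_const, ← integral_complex_ofReal]
  have h2 : Integrable (fun x => ((∫ s in (0)..t, v s x : ℝ) : ℂ) * conj (chr k x))
      (volume.restrict cell) := by
    refine hv'.integral_prod_right.congr (Filter.Eventually.of_forall fun x => ?_)
    simp only
    rw [intervalIntegral.integral_of_le ht.1, integral_mul_const, ← integral_complex_ofReal]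
  rw [h1, fc, fc, ← integral_add (integrable_fc_integrand hf₀ k) h2]
  refine integral_congr_ae ?_
  filter_upwards [h] with x hx
  rw [hx]; push_cast; ring

theorem PlateFields.EnergyClass.hess_memLp {T : ℝ} {w : PlateFields} (hw : w.EnergyClass T) :
    MemLp (fun p : ℝ × E2 => w.hess p.1 p.2) 2 (volume.restrict (GammaT T)) := by
  obtain ⟨C, hC⟩ := hw.bound
  refine memLp_GammaT_of_bound hw.meas_hess (C := C) ?_
  filter_upwards [ae_restrict_mem measurableSet_Ioo] with t ht
  exact (hC t (Ioo_subset_Icc_self ht)).2.2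

theorem PlateFields.EnergyClass.grad_memLp {T : ℝ} {w : PlateFields} (hw : w.EnergyClass T) :
    MemLp (fun p : ℝ × E2 => w.grad p.1 p.2) 2 (volume.restrict (GammaT T)) := by
  obtain ⟨C, hC⟩ := hw.bound
  refine memLp_GammaT_of_bound hw.meas_grad (C := C) ?_
  filter_upwards [ae_restrict_mem measurableSet_Ioo] with t ht
  exact (hC t (Ioo_subset_Icc_self ht)).2.1

theorem PlateFields.EnergyClass.fc_lap {T : ℝ} {w : PlateFields} (hw : w.EnergyClass T) {t : ℝ}
    (ht : t ∈ Icc 0 T) (k : Fin 2 → ℤ) :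
    fc (fun x => lap (w.hess t x)) k = -(eig k) * fc (w.val t) k :=
  FSI.fc_lap (hw.weakGrad t ht) (hw.weakHess t ht) (hw.memLp_slice t ht).1
    (hw.memLp_slice t ht).2.1 (hw.memLp_slice t ht).2.2 k

theorem PlateFields.EnergyClass.fc_val {T : ℝ} {w : PlateFields} (hw : w.EnergyClass T) {t : ℝ}
    (ht : t ∈ Icc 0 T) (k : Fin 2 → ℤ) :
    fc (w.val t) k = fc (w.val 0) k + ∫ s in (0)..t, fc (w.vel s) k :=
  fc_primitive ht (integrableOn_of_memLp hw.vel_memLp)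
    (integrableOn_of_memLp (hw.memLp_slice 0 ⟨le_rfl, ht.1.trans ht.2⟩).1) (hw.primitive t ht) k

theorem integral_re_fc {T t : ℝ} (ht : t ∈ Icc 0 T) {v : ℝ → E2 → ℝ}
    (hv : IntegrableOn (fun p : ℝ × E2 => v p.1 p.2) (GammaT T)) (k : Fin 2 → ℤ) :
    (∫ s in (0)..t, fc (v s) k).re = ∫ s in (0)..t, (fc (v s) k).re := by
  have h := (integrableOn_fc hv k)
  have h2 := (intervalIntegrable_of_Ioo h ht).1
  rw [intervalIntegral.integral_of_le ht.1, intervalIntegral.integral_of_le ht.1]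
  exact (integral_re h2).symm

theorem integral_im_fc {T t : ℝ} (ht : t ∈ Icc 0 T) {v : ℝ → E2 → ℝ}
    (hv : IntegrableOn (fun p : ℝ × E2 => v p.1 p.2) (GammaT T)) (k : Fin 2 → ℤ) :
    (∫ s in (0)..t, fc (v s) k).im = ∫ s in (0)..t, (fc (v s) k).im := by
  have h := (integrableOn_fc hv k)
  have h2 := (intervalIntegrable_of_Ioo h ht).1
  rw [intervalIntegral.integral_of_le ht.1, intervalIntegral.integral_of_le ht.1]
  exact (integral_im h2).symm

/-- Time evolution of the product of a Fourier mode of two primitives in time. -/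
theorem fc_mul_evolution {T : ℝ} {w v W V : ℝ → E2 → ℝ}
    (hv : IntegrableOn (fun p : ℝ × E2 => v p.1 p.2) (GammaT T))
    (hV : IntegrableOn (fun p : ℝ × E2 => V p.1 p.2) (GammaT T)) {k : Fin 2 → ℤ}
    (hw : ∀ t ∈ Icc 0 T, fc (w t) k = fc (w 0) k + ∫ s in (0)..t, fc (v s) k)
    (hW : ∀ t ∈ Icc 0 T, fc (W t) k = fc (W 0) k + ∫ s in (0)..t, fc (V s) k)
    {τ : ℝ} (hτ : τ ∈ Icc 0 T) :
    (conj (fc (w τ) k) * fc (W τ) k).re - (conj (fc (w 0) k) * fc (W 0) k).re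
      = ∫ t in (0)..τ, (conj (fc (w t) k) * fc (V t) k + conj (fc (v t) k) * fc (W t) k).re := by
  have hα := intervalIntegrable_of_Ioo (integrableOn_fc hv k) hτ
  have hβ := intervalIntegrable_of_Ioo (integrableOn_fc hV k) hτ
  have re : ∀ {f : ℝ → ℂ}, IntervalIntegrable f volume 0 τ →
    IntervalIntegrable (fun t => (f t).re) volume 0 τ := fun h => ⟨h.1.re, h.2.re⟩
  have im : ∀ {f : ℝ → ℂ}, IntervalIntegrable f volume 0 τ →
    IntervalIntegrable (fun t => (f t).im) volume 0 τ := fun h => ⟨h.1.im, h.2.im⟩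
  -- Re(conj a · b) = Re a Re b + Im a Im b, so the real Leibniz rule is applied to the real and to
  -- the imaginary parts.
  have h1 := primitive_mul hτ.1 (re hα) (re hβ) (fc (w 0) k).re (fc (W 0) k).re
  have h2 := primitive_mul hτ.1 (im hα) (im hβ) (fc (w 0) k).im (fc (W 0) k).im
  have eq : ∀ t ∈ Icc 0 τ, ((fc (w t) k).re = (fc (w 0) k).re + ∫ s in (0)..t, (fc (v s) k).re)
      ∧ ((fc (w t) k).im = (fc (w 0) k).im + ∫ s in (0)..t, (fc (v s) k).im)
      ∧ ((fc (W t) k).re = (fc (W 0) k).re + ∫ s in (0)..t, (fc (V s) k).re)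
      ∧ ((fc (W t) k).im = (fc (W 0) k).im + ∫ s in (0)..t, (fc (V s) k).im) := by
    intro t ht
    have ht' : t ∈ Icc 0 T := ⟨ht.1, ht.2.trans hτ.2⟩
    rw [← integral_re_fc ht' hv, ← integral_im_fc ht' hv, ← integral_re_fc ht' hV,
      ← integral_im_fc ht' hV, hw t ht', hW t ht']
    exact ⟨rfl, rfl, rfl, rfl⟩
  have cont : ∀ {f : ℝ → ℝ} (c : ℝ), IntervalIntegrable f volume 0 τ →
      ContinuousOn (fun t => c + ∫ s in (0)..t, f s) (uIcc 0 τ) := fun c h =>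
    continuousOn_const.add (intervalIntegral.continuousOn_primitive_interval' h left_mem_uIcc)
  have i1 := ((re hα).mul_continuousOn (cont (fc (W 0) k).re (re hβ))).add
    ((re hβ).continuousOn_mul (cont (fc (w 0) k).re (re hα)))
  have i2 := ((im hα).mul_continuousOn (cont (fc (W 0) k).im (im hβ))).add
    ((im hβ).continuousOn_mul (cont (fc (w 0) k).im (im hα)))
  have h3 : ∫ t in (0)..τ, (conj (fc (w t) k) * fc (V t) k
          + conj (fc (v t) k) * fc (W t) k).re =
      (∫ t in (0)..τ, ((fc (v t) k).re * ((fc (W 0) k).re + ∫ s in (0)..t, (fc (V s) k).re)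
        + ((fc (w 0) k).re + ∫ s in (0)..t, (fc (v s) k).re) * (fc (V t) k).re))
      + ∫ t in (0)..τ, ((fc (v t) k).im * ((fc (W 0) k).im + ∫ s in (0)..t, (fc (V s) k).im)
        + ((fc (w 0) k).im + ∫ s in (0)..t, (fc (v s) k).im) * (fc (V t) k).im) := by
    rw [← intervalIntegral.integral_add i1 i2]
    refine intervalIntegral.integral_congr fun t ht => ?_
    rw [uIcc_of_le hτ.1] at ht
    obtain ⟨e1, e2, e3, e4⟩ := eq t ht
    simp only [Complex.add_re, Complex.mul_re, Complex.conj_re, Complex.conj_im, ← e1, ← e2,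
      ← e3, ← e4]
    ring
  obtain ⟨e1, e2, e3, e4⟩ := eq τ ⟨hτ.1, le_rfl⟩
  rw [h3, ← h1, ← h2, ← e1, ← e2, ← e3, ← e4]
  simp only [Complex.mul_re, Complex.conj_re, Complex.conj_im]
  ring

theorem integrableOn_integral_sq {T : ℝ} {f : ℝ → E2 → ℝ}
    (hf : MemLp (fun p : ℝ × E2 => f p.1 p.2) 2 (volume.restrict (GammaT T))) :
    IntegrableOn (fun t => ∫ x in cell, f t x ^ 2) (Ioo 0 T) :=
  integrableOn_slice_GammaT (f := fun p => f p.1 p.2 ^ 2) hf.integrable_sq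

/-- The majorant for exchanging the sum over modes with the integral in time: by Parseval its sum is
a sum of squared L² norms. -/
theorem norm_conj_mul_le (a b : ℂ) : |(conj a * b).re| ≤ ‖a‖ ^ 2 + ‖b‖ ^ 2 := by
  refine (abs_re_le_norm _).trans ?_
  rw [norm_mul, Complex.norm_conj]
  nlinarith [sq_nonneg (‖a‖ - ‖b‖), sq_nonneg ‖a‖, sq_nonneg ‖b‖]

/-- Evolution of `∫ Δw ΔW`, where `∂ₜw` is only in `L²(0,T;H¹)` but `∇ΔW` is square integrable. -/
theorem integral_lap_mul_lap_sub {T : ℝ} {w W : PlateFields} (hw : w.EnergyClass T)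
    (hW : W.EnergyClass T) {acc : ℝ → E2 → ℝ} {velHess : ℝ → E2 → Fin 2 → Fin 2 → ℝ}
    {gradLap : ℝ → E2 → E2} (hV : IsPlateTest T W.vel acc W.velGrad velHess)
    (hL : MemLp (fun p : ℝ × E2 => gradLap p.1 p.2) 2 (volume.restrict (GammaT T)))
    (hLg : ∀ᵐ t ∂(volume.restrict (Ioo 0 T)),
      IsWeakGrad (fun x => lap (W.hess t x)) (gradLap t)) {τ : ℝ} (hτ : τ ∈ Icc 0 T) :
    (∫ x in cell, lap (w.hess τ x) * lap (W.hess τ x))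
      - (∫ x in cell, lap (w.hess 0 x) * lap (W.hess 0 x))
      = ∫ t in (0)..τ, ∫ x in cell,
          (lap (w.hess t x) * lap (velHess t x) - w.velGrad t x ⬝ᵥ gradLap t x) := by
  have h0 : (0 : ℝ) ∈ Icc 0 T := ⟨le_rfl, hτ.1.trans hτ.2⟩
  have hl := memLp_lap hw.hess_memLp
  have hVH := memLp_lap hV.memLp_hess
  have hvg := fun i => memLp_coord hw.velGrad_memLp i
  have hgL := fun i => memLp_coord hL i
  -- `F k` is the contribution of the mode `k` to the integrand on the right, and `B k` below is its
  -- majorant.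
  set F : (Fin 2 → ℤ) → ℝ → ℝ := fun k t =>
    (conj (fc (fun x => lap (w.hess t x)) k) * fc (fun x => lap (velHess t x)) k).re
      - ((conj (fc (fun x => w.velGrad t x 0) k) * fc (fun x => gradLap t x 0) k).re
        + (conj (fc (fun x => w.velGrad t x 1) k) * fc (fun x => gradLap t x 1) k).re) with hF
  set B : (Fin 2 → ℤ) → ℝ → ℝ := fun k t =>
    ‖fc (fun x => lap (w.hess t x)) k‖ ^ 2 + ‖fc (fun x => lap (velHess t x)) k‖ ^ 2
      + ((‖fc (fun x => w.velGrad t x 0) k‖ ^ 2 + ‖fc (fun x => gradLap t x 0) k‖ ^ 2)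
        + (‖fc (fun x => w.velGrad t x 1) k‖ ^ 2 + ‖fc (fun x => gradLap t x 1) k‖ ^ 2)) with hB
  have sl := memLp_slice_GammaT hw.hess_memLp
  have slV := memLp_slice_GammaT hV.memLp_hess
  have slv := memLp_slice_GammaT hw.velGrad_memLp
  have slL := memLp_slice_GammaT hL
  have slVg := memLp_slice_GammaT hV.memLp_grad
  have slV0 := memLp_slice_GammaT hV.memLp
  have slv0 := memLp_slice_GammaT hw.vel_memLp
  have hBsum : ∀ᵐ t ∂(volume.restrict (Ioo 0 T)), HasSum (fun k => B k t)
      ((∫ x in cell, lap (w.hess t x) ^ 2) + (∫ x in cell, lap (velHess t x) ^ 2)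
      + (((∫ x in cell, w.velGrad t x 0 ^ 2) + ∫ x in cell, gradLap t x 0 ^ 2)
      + ((∫ x in cell, w.velGrad t x 1 ^ 2) + ∫ x in cell, gradLap t x 1 ^ 2))) := by
    filter_upwards [sl, slV, slv, slL] with t h1 h2 h3 h4
    exact ((hasSum_fc_sq (memLp_lap h1)).add (hasSum_fc_sq (memLp_lap h2))).add
      (((hasSum_fc_sq (memLp_coord h3 0)).add (hasSum_fc_sq (memLp_coord h4 0))).add
      ((hasSum_fc_sq (memLp_coord h3 1)).add (hasSum_fc_sq (memLp_coord h4 1))))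
  have hFsum : ∀ᵐ t ∂(volume.restrict (Ioo 0 T)), HasSum (fun k => F k t)
      (∫ x in cell, (lap (w.hess t x) * lap (velHess t x) - w.velGrad t x ⬝ᵥ gradLap t x)) := by
    filter_upwards [sl, slV, slv, slL] with t h1 h2 h3 h4
    have e1 := hasSum_re (hasSum_fc (memLp_lap h1) (memLp_lap h2))
    have e2 := hasSum_re (hasSum_fc (memLp_coord h3 0) (memLp_coord h4 0))
    have e3 := hasSum_re (hasSum_fc (memLp_coord h3 1) (memLp_coord h4 1))
    simp only [dotProduct, Fin.sum_univ_two]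
    have i2 := integrable_mul_of_memLp (memLp_coord h3 0) (memLp_coord h4 0)
    have i3 := integrable_mul_of_memLp (memLp_coord h3 1) (memLp_coord h4 1)
    have i4 : Integrable (fun x => w.velGrad t x 0 * gradLap t x 0
      + w.velGrad t x 1 * gradLap t x 1) (volume.restrict cell) := i2.add i3
    rw [integral_sub (integrable_mul_of_memLp (memLp_lap h1) (memLp_lap h2)) i4,
      integral_add i2 i3]
    exact e1.sub (e2.add e3)
  -- The formal term Δ∂ₜw ΔW and the meaningful term -∇∂ₜw·∇ΔW have the same symbol, namely `eig k ^
  -- 2`. In this way the derivative of the modes of ΔwΔW is identified without second derivatives of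
  -- ∂ₜw.
  have hFeq : ∀ᵐ t ∂(volume.restrict (Ioo 0 T)), ∀ k, F k t = eig k ^ 2 *
      (conj (fc (w.val t) k) * fc (W.vel t) k + conj (fc (w.vel t) k) * fc (W.val t) k).re := by
    filter_upwards [ae_restrict_mem measurableSet_Ioo, hw.vel_weakGrad, hV.weakGrad, hV.weakHess,
      hLg, slV, slv, slL, slVg, slV0, slv0] with t ht a1 a2 a3 a4 h2 h3 h4 h5 h6 h7 k
    have ht' := Ioo_subset_Icc_self ht
    have b1 := hw.fc_lap ht' k
    have b2 := FSI.fc_lap a2 a3 h6 h5 h2 k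
    have b3 := fun i => a1.fc_eq (integrableOn_of_memLp h7) i
      (integrableOn_of_memLp (memLp_coord h3 i)) k
    have b4 := fun i => a4.fc_eq (integrableOn_of_memLp (memLp_lap (hW.memLp_slice t ht').2.2)) i
      (integrableOn_of_memLp (memLp_coord h4 i)) k
    rw [hF]
    simp only [b1, b2, b3, b4, hW.fc_lap ht' k]
    rw [← Complex.add_re, ← Complex.sub_re, ← Complex.re_ofReal_mul]
    congr 1
    simp only [map_mul, map_neg, conj_ofReal, conj_I, map_ofNat, map_intCast, eig]
    push_cast
    linear_combination -(conj (fc (w.vel t) k) * fc (W.val t) k) * (2 * Real.pi) ^ 4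
      * ((k 0 : ℂ) ^ 2 + (k 1 : ℂ) ^ 2) ^ 2 * I_sq
  have hmeas : ∀ {f : ℝ → E2 → ℝ}, MemLp (fun p : ℝ × E2 => f p.1 p.2) 2
      (volume.restrict (GammaT T)) → ∀ k, AEStronglyMeasurable (fun t => fc (f t) k)
        (volume.restrict (Ioo 0 T)) := fun hf k =>
    (integrableOn_fc (integrableOn_of_memLp hf) k).aestronglyMeasurable
  have hprod : ∀ {f g : ℝ → ℂ}, AEStronglyMeasurable f (volume.restrict (Ioo 0 T)) →
      AEStronglyMeasurable g (volume.restrict (Ioo 0 T)) →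
      AEStronglyMeasurable (fun t => (conj (f t) * g t).re) (volume.restrict (Ioo 0 T)) :=
    fun hf hg => continuous_re.comp_aestronglyMeasurable
      ((continuous_conj.comp_aestronglyMeasurable hf).mul hg)
  have hBint : IntegrableOn (fun t => ∑' k, B k t) (Ioo 0 T) := by
    have hi := ((integrableOn_integral_sq (f := fun t x => lap (w.hess t x)) hl).add
      (integrableOn_integral_sq (f := fun t x => lap (velHess t x)) hVH)).add
      (((integrableOn_integral_sq (f := fun t x => w.velGrad t x 0) (hvg 0)).add
        (integrableOn_integral_sq (f := fun t x => gradLap t x 0) (hgL 0))).add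
      ((integrableOn_integral_sq (f := fun t x => w.velGrad t x 1) (hvg 1)).add
        (integrableOn_integral_sq (f := fun t x => gradLap t x 1) (hgL 1))))
    refine Integrable.congr hi ?_
    filter_upwards [hBsum] with t ht
    rw [ht.tsum_eq]
    rfl
  have hμ : volume.restrict (Ioo 0 τ) ≤ volume.restrict (Ioo 0 T) :=
    Measure.restrict_mono (Ioo_subset_Ioo_right hτ.2) le_rfl
  have hac := Measure.absolutelyContinuous_of_le hμ
  have main := hasSum_integral_of_dominated_convergence (μ := volume.restrict (Ioo 0 τ))
    (F := F) (f := fun t => ∫ x in cell,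
      (lap (w.hess t x) * lap (velHess t x) - w.velGrad t x ⬝ᵥ gradLap t x)) B
    (fun k => (((hprod (hmeas (f := fun t x => lap (w.hess t x)) hl k) (hmeas
      (f := fun t x => lap (velHess t x)) hVH k)).sub
        ((hprod (hmeas (f := fun t x => w.velGrad t x 0) (hvg 0) k) (hmeas
          (f := fun t x => gradLap t x 0) (hgL 0) k)).add
        (hprod (hmeas (f := fun t x => w.velGrad t x 1) (hvg 1) k) (hmeas
          (f := fun t x => gradLap t x 1) (hgL 1) k))))).mono_measure hμ)
    (fun k => Filter.Eventually.of_forall fun t => by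
      rw [Real.norm_eq_abs]
      refine (abs_sub _ _).trans (add_le_add (norm_conj_mul_le _ _) ((abs_add_le _ _).trans
        (add_le_add (norm_conj_mul_le _ _) (norm_conj_mul_le _ _)))))
    (hac.ae_le (hBsum.mono fun t ht => ht.summable)) (Integrable.mono_measure hBint hμ)
      (hac.ae_le hFsum)
  have lhs : ∀ t ∈ Icc 0 T, HasSum (fun k => eig k ^ 2 *
      (conj (fc (w.val t) k) * fc (W.val t) k).re)
      (∫ x in cell, lap (w.hess t x) * lap (W.hess t x)) := by
    intro t ht
    have e1 := hasSum_re (hasSum_fc (memLp_lap (hw.memLp_slice t ht).2.2)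
      (memLp_lap (hW.memLp_slice t ht).2.2))
    rw [Complex.ofReal_re] at e1
    refine e1.congr_fun fun k => ?_
    rw [hw.fc_lap ht, hW.fc_lap ht, ← Complex.re_ofReal_mul]
    congr 1
    simp only [map_mul, map_neg, conj_ofReal]
    push_cast
    ring
  rw [intervalIntegral.integral_of_le hτ.1, integral_Ioc_eq_integral_Ioo]
  refine ((lhs τ hτ).sub (lhs 0 h0)).unique (main.congr_fun fun k => ?_)
  rw [← mul_sub, fc_mul_evolution (integrableOn_of_memLp hw.vel_memLp)
      (integrableOn_of_memLp hW.vel_memLp) (fun t ht => hw.fc_val ht k)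
        (fun t ht => hW.fc_val ht k) hτ, intervalIntegral.integral_of_le hτ.1,
    integral_Ioc_eq_integral_Ioo, ← integral_const_mul]
  refine integral_congr_ae ?_
  filter_upwards [hac.ae_le hFeq] with t ht
  exact (ht k).symm

end Plate

/-! ### The chain rule for weak gradients on the torus -/

section ChainRule

open Complex Filter Topology
open scoped ComplexConjugate

/-- A derivative of a periodic function has mean zero. -/
theorem integral_fderiv_eq_zero {f : E2 → ℝ} (hf : ContDiff ℝ 1 f) (hper : Periodic2 f)
    (i : Fin 2) : ∫ x in cell, fderiv ℝ f x (Pi.single i 1) = 0 := by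
  rw [setIntegral_congr_set cell_ae_eq_Icc]
  have hc : Continuous fun x => fderiv ℝ f x (Pi.single i 1) :=
    (hf.continuous_fderiv (by simp)).clm_apply continuous_const
  have hsum : ∀ x, ∑ j : Fin 2, (if j = i then fderiv ℝ f x else 0) (Pi.single j 1)
      = fderiv ℝ f x (Pi.single i 1) := by
    intro x
    rw [Finset.sum_eq_single i]
    · simp
    · intro j _ hj; simp [hj]
    · simp
  -- The divergence theorem on the unit square for the field whose only component is `f` in
  -- direction `i`; opposite faces cancel by periodicity.
  have h := integral_divergence_of_hasFDerivAt_off_countable' (0 : Fin 2 → ℝ) 1 zero_le_one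
    (fun j => if j = i then f else 0) (fun j x => if j = i then fderiv ℝ f x else 0) ∅
    countable_empty
    (fun j => by
      split_ifs
      · exact hf.continuous.continuousOn
      · exact continuousOn_const)
    (fun x _ j => by
      split_ifs
      · exact (hf.differentiable (by simp) x).hasFDerivAt
      · exact hasFDerivAt_const (0 : ℝ) x)
    (by simp_rw [hsum]; exact hc.continuousOn.integrableOn_compact isCompact_Icc)
  simp_rw [hsum] at h
  rw [h]
  refine Finset.sum_eq_zero fun j _ => ?_
  split_ifs with hj
  · rw [sub_eq_zero]
    congr 1; ext x
    rw [← hper (j.insertNth ((0 : Fin 2 → ℝ) j) x) (Pi.single j 1)]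
    congr 1
    ext l
    rcases Fin.eq_self_or_eq_succAbove j l with rfl | ⟨m, rfl⟩ <;> simp
  · simp

theorem integrableOn_cell {f : E2 → ℝ} (hf : Continuous f) : IntegrableOn f cell :=
  (hf.continuousOn.integrableOn_compact isCompact_Icc).mono_set cell_subset_Icc

/-- Real parts of trigonometric polynomials. -/
noncomputable def trig (c : (Fin 2 → ℤ) → ℂ) (s : Finset (Fin 2 → ℤ)) (x : E2) : ℝ :=
  ∑ k ∈ s, ((c k).re * Real.cos (phase k x) - (c k).im * Real.sin (phase k x))

theorem mul_chr_re (c : ℂ) (k : Fin 2 → ℤ) (x : E2) :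
    (c * chr k x).re = c.re * Real.cos (phase k x) - c.im * Real.sin (phase k x) := by
  rw [Complex.mul_re, chr_re, chr_im]

theorem contDiff_trig (c : (Fin 2 → ℤ) → ℂ) (s : Finset (Fin 2 → ℤ)) :
    ContDiff ℝ ∞ (trig c s) := by
  unfold trig
  refine ContDiff.sum fun k _ => ?_
  have := contDiff_phase k
  fun_prop

theorem periodic2_trig (c : (Fin 2 → ℤ) → ℂ) (s : Finset (Fin 2 → ℤ)) : Periodic2 (trig c s) := by
  intro x m
  simp only [trig, phase_add_int, Real.cos_add_int_mul_two_pi, Real.sin_add_int_mul_two_pi]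

theorem fderiv_trig (c : (Fin 2 → ℤ) → ℂ) (s : Finset (Fin 2 → ℤ)) (x : E2) (i : Fin 2) :
    fderiv ℝ (trig c s) x (Pi.single i 1) = trig (fun k => 2 * Real.pi * k i * I * c k) s x := by
  have hd : ∀ k, HasFDerivAt (phase k) (fderiv ℝ (phase k) x) x := fun k =>
    ((contDiff_phase k).differentiable (by simp) x).hasFDerivAt
  have h := HasFDerivAt.fun_sum (u := s) fun k (_ : k ∈ s) =>
    ((hd k).cos.const_mul (c k).re).sub ((hd k).sin.const_mul (c k).im)
  have h' : fderiv ℝ (trig c s) x = _ := h.fderiv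
  rw [h']
  simp only [_root_.sum_apply, _root_.sub_apply, _root_.smul_apply,
    fderiv_phase_single, smul_eq_mul, trig]
  refine Finset.sum_congr rfl fun k _ => ?_
  simp
  ring

/-- Integrals against partial sums become finite sums of coefficients, so that the partial sums of
an L² function can be treated without proving that they converge in L². -/
theorem integral_mul_trig {h : E2 → ℝ} (hh : IntegrableOn h cell) (c : (Fin 2 → ℤ) → ℂ)
    (s : Finset (Fin 2 → ℤ)) :
    ∫ x in cell, h x * trig c s x = ∑ k ∈ s, (conj (fc h k) * c k).re := by
  have hi : ∀ (φ : E2 → ℝ), Continuous φ → (∀ x, |φ x| ≤ 1) →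
      Integrable (fun x => h x * φ x) (volume.restrict cell) := fun φ hφ hb =>
    Integrable.mul_bdd (c := 1) hh hφ.aestronglyMeasurable (Eventually.of_forall hb)
  have hc : ∀ k, Integrable (fun x => h x * Real.cos (phase k x)) (volume.restrict cell) :=
    fun k => hi _ (Real.continuous_cos.comp (contDiff_phase k).continuous)
      fun x => Real.abs_cos_le_one _
  have hs : ∀ k, Integrable (fun x => h x * Real.sin (phase k x)) (volume.restrict cell) :=
    fun k => hi _ (Real.continuous_sin.comp (contDiff_phase k).continuous)
      fun x => Real.abs_sin_le_one _
  simp only [trig, Finset.mul_sum]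
  have e : ∀ k x, h x * ((c k).re * Real.cos (phase k x) - (c k).im * Real.sin (phase k x))
      = (c k).re * (h x * Real.cos (phase k x)) - (c k).im * (h x * Real.sin (phase k x)) :=
    fun k x => by ring
  simp_rw [e]
  rw [integral_finsetSum (f := fun k x => (c k).re * (h x * Real.cos (phase k x))
    - (c k).im * (h x * Real.sin (phase k x))) _ fun k _ =>
      ((hc k).const_mul _).sub ((hs k).const_mul _)]
  refine Finset.sum_congr rfl fun k _ => ?_
  rw [integral_sub ((hc k).const_mul _) ((hs k).const_mul _), integral_const_mul,
    integral_const_mul, fc_eq hh]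
  simp only [map_sub, map_mul, conj_ofReal, conj_I, mul_re, mul_im, sub_re, sub_im, ofReal_re,
    ofReal_im, neg_re, neg_im, I_re, I_im]
  ring

theorem tendsto_trig {c : (Fin 2 → ℤ) → ℂ} (hc : Summable fun k => ‖c k‖) (x : E2) :
    Tendsto (fun s => trig c s x) atTop (𝓝 (∑' k, c k * chr k x).re) := by
  have h1 : Summable fun k => c k * chr k x := Summable.of_norm (by simpa using hc)
  have h2 := hasSum_re h1.hasSum
  simp only [mul_chr_re] at h2
  exact h2

theorem abs_trig_le {c : (Fin 2 → ℤ) → ℂ} (hc : Summable fun k => ‖c k‖)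
    (s : Finset (Fin 2 → ℤ)) (x : E2) : |trig c s x| ≤ ∑' k, ‖c k‖ := by
  refine (Finset.abs_sum_le_sum_abs _ _).trans ?_
  refine (Finset.sum_le_sum fun k _ => ?_).trans (hc.sum_le_tsum s fun k _ => norm_nonneg _)
  rw [← mul_chr_re]
  exact (abs_re_le_norm _).trans (by simp)

/-- All partial sums take values in the fixed interval of radius Σ‖c k‖, where `G` is bounded over
the closed cell, so pointwise convergence passes to the integral. -/
theorem tendsto_integral_comp_trig {c : (Fin 2 → ℤ) → ℂ} (hc : Summable fun k => ‖c k‖)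
    {G : E2 → ℝ → ℝ} (hG : Continuous fun p : E2 × ℝ => G p.1 p.2) :
    Tendsto (fun s => ∫ x in cell, G x (trig c s x)) atTop
      (𝓝 (∫ x in cell, G x (∑' k, c k * chr k x).re)) := by
  obtain ⟨C, hC⟩ := ((isCompact_Icc (a := (0 : E2)) (b := 1)).prod
    (isCompact_Icc (a := -∑' k, ‖c k‖) (b := ∑' k, ‖c k‖))).exists_bound_of_continuousOn
      hG.continuousOn
  refine tendsto_integral_filter_of_dominated_convergence (fun _ => C) ?_ ?_
    (integrable_const C) ?_
  · exact Eventually.of_forall fun s => (hG.comp (continuous_id.prodMk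
      (contDiff_trig c s).continuous)).aestronglyMeasurable
  · refine Eventually.of_forall fun s => ?_
    filter_upwards [ae_restrict_mem measurableSet_cell] with x hx
    exact hC (x, trig c s x) ⟨cell_subset_Icc hx, abs_le.1 (abs_trig_le hc s x)⟩
  · exact Eventually.of_forall fun x => (hG.comp
    (continuous_const.prodMk continuous_id)).continuousAt.tendsto.comp (tendsto_trig hc x)

/-- With the limit inserted in `G`, convergence is Parseval's identity. The error is bounded, by
Cauchy–Schwarz on the coefficients, by the L² distance of `G` along the partial sum from its limit
times the L² norm of `g`, and the first factor tends to zero. -/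
theorem tendsto_integral_mul_trig {c : (Fin 2 → ℤ) → ℂ} (hc : Summable fun k => ‖c k‖)
    {G : E2 → ℝ → ℝ} (hG : Continuous fun p : E2 × ℝ => G p.1 p.2) {g : E2 → ℝ}
    (hg : MemLp g 2 (volume.restrict cell)) :
    Tendsto (fun s => ∫ x in cell, G x (trig c s x) * trig (fc g) s x) atTop
      (𝓝 (∫ x in cell, G x (∑' k, c k * chr k x).re * g x)) := by
  set S : E2 → ℝ := fun x => (∑' k, c k * chr k x).re with hS
  have hmem : ∀ {f : E2 → ℝ}, Continuous f → MemLp f 2 (volume.restrict cell) := by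
    intro f hf
    obtain ⟨C, hC⟩ := (isCompact_Icc (a := (0 : E2)) (b := 1)).exists_bound_of_continuousOn
      hf.continuousOn
    refine MemLp.of_bound hf.aestronglyMeasurable C ?_
    filter_upwards [ae_restrict_mem measurableSet_cell] with x hx
    exact hC x (cell_subset_Icc hx)
  have h1 : ∀ s, Continuous fun x => G x (trig c s x) := fun s =>
    hG.comp (continuous_id.prodMk (contDiff_trig c s).continuous)
  have h2 : Continuous fun x => G x (S x) :=
    hG.comp (continuous_id.prodMk (continuous_fourierSeries hc))
  have hlim : Tendsto (fun s => ∑ k ∈ s, (conj (fc (fun x => G x (S x)) k) * fc g k).re) atTop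
      (𝓝 (∫ x in cell, G x (S x) * g x)) := by
    have := hasSum_re (hasSum_fc (hmem h2) hg)
    rwa [Complex.ofReal_re] at this
  have hD : Tendsto (fun s => Real.sqrt (∫ x in cell, (G x (trig c s x) - G x (S x)) ^ 2)
      * Real.sqrt (∫ x in cell, g x ^ 2)) atTop (𝓝 0) := by
    have h3 : Continuous fun p : E2 × ℝ => (G p.1 p.2 - G p.1 (S p.1)) ^ 2 :=
      (hG.sub (h2.comp continuous_fst)).pow 2
    have h4 := tendsto_integral_comp_trig hc (G := fun x z => (G x z - G x (S x)) ^ 2) h3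
    have h5 := ((Real.continuous_sqrt.tendsto _).comp h4).mul_const
      (Real.sqrt (∫ x in cell, g x ^ 2))
    simpa [hS] using h5
  have hdiff : Tendsto (fun s => (∫ x in cell, G x (trig c s x) * trig (fc g) s x)
      - ∑ k ∈ s, (conj (fc (fun x => G x (S x)) k) * fc g k).re) atTop (𝓝 0) := by
    refine squeeze_zero_norm (fun s => ?_) hD
    rw [integral_mul_trig (integrableOn_of_memLp (hmem (h1 s))), ← Finset.sum_sub_distrib]
    have e : ∀ k, (conj (fc (fun x => G x (trig c s x)) k) * fc g k).re
        - (conj (fc (fun x => G x (S x)) k) * fc g k).re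
        = (conj (fc (fun x => G x (trig c s x) - G x (S x)) k) * fc g k).re := fun k => by
      rw [fc_sub (integrableOn_of_memLp (hmem (h1 s))) (integrableOn_of_memLp (hmem h2)),
        map_sub, sub_mul, Complex.sub_re]
    simp_rw [e]
    rw [Real.norm_eq_abs]
    refine (Finset.abs_sum_le_sum_abs _ _).trans ?_
    refine (Finset.sum_le_sum fun k _ => ((abs_re_le_norm _).trans_eq
      (by rw [norm_mul, Complex.norm_conj] :
        _ = ‖fc (fun x => G x (trig c s x) - G x (S x)) k‖ * ‖fc g k‖))).trans ?_
    rw [← Real.sqrt_mul (integral_nonneg fun x => sq_nonneg _)]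
    refine Real.le_sqrt_of_sq_le ((Finset.sum_mul_sq_le_sq_mul_sq _ _ _).trans ?_)
    refine mul_le_mul ?_ ?_ (by positivity) (integral_nonneg fun x => sq_nonneg _)
    · exact sum_le_hasSum s (fun k _ => sq_nonneg _)
        (hasSum_fc_sq (hmem (f := fun x => G x (trig c s x) - G x (S x)) ((h1 s).sub h2)))
    · exact sum_le_hasSum s (fun k _ => sq_nonneg _) (hasSum_fc_sq hg)
  simpa using hdiff.add hlim

/-- The chain rule `∫ ∂ᵢ (H(x, w(x))) = 0` for `w` in `H²` of the torus. -/
theorem integral_weak_chain {w : E2 → ℝ} {g : E2 → E2} {K : E2 → Fin 2 → Fin 2 → ℝ}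
    (hwg : IsWeakGrad w g) (hgK : IsWeakHess g K) (hw : MemLp w 2 (volume.restrict cell))
    (hg : MemLp g 2 (volume.restrict cell)) (hK : MemLp K 2 (volume.restrict cell))
    {H : E2 × ℝ → ℝ} (hH : ContDiff ℝ 1 H)
    (hper : ∀ x z (m : Fin 2 → ℤ), H (x + (fun i => (m i : ℝ)), z) = H (x, z)) (i : Fin 2) :
    (∫ x in cell, fderiv ℝ H (x, w x) (Pi.single i 1, 0))
      + (∫ x in cell, fderiv ℝ H (x, w x) (0, 1) * g x i) = 0 := by
  have hc := summable_norm_fc hwg hgK hw hg hK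
  have hae := ae_eq_fourierSeries hw hc
  have hgc : fc (fun x => g x i) = fun k => 2 * Real.pi * k i * I * fc w k := by
    ext k
    exact hwg.fc_eq (integrableOn_of_memLp hw) i (integrableOn_of_memLp (memLp_coord hg i)) k
  have hD : Continuous (fderiv ℝ H) := hH.continuous_fderiv (by simp)
  have c1 : Continuous fun p : E2 × ℝ => fderiv ℝ H (p.1, p.2) (Pi.single i 1, 0) :=
    hD.clm_apply continuous_const
  have c2 : Continuous fun p : E2 × ℝ => fderiv ℝ H (p.1, p.2) (0, 1) :=
    hD.clm_apply continuous_const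
  have t1 := tendsto_integral_comp_trig hc
    (G := fun x z => fderiv ℝ H (x, z) (Pi.single i 1, 0)) c1
  have t2 := tendsto_integral_mul_trig hc (G := fun x z => fderiv ℝ H (x, z) (0, 1)) c2
    (memLp_coord hg i)
  -- For a trigonometric polynomial the chain rule is classical and a derivative of a periodic
  -- function has mean zero. By `hgc`, the derivative of a partial sum of `w` is the partial sum of
  -- `g`.
  have hzero : ∀ s, (∫ x in cell, fderiv ℝ H (x, trig (fc w) s x) (Pi.single i 1, 0))
      + (∫ x in cell, fderiv ℝ H (x, trig (fc w) s x) (0, 1)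
        * trig (fc fun x => g x i) s x) = 0 := by
    intro s
    have hw1 := contDiff_trig (fc w) s
    have hcomp : ContDiff ℝ 1 fun x => H (x, trig (fc w) s x) :=
      hH.comp (contDiff_id.prodMk (hw1.of_le (by simp)))
    have hp : Periodic2 fun x => H (x, trig (fc w) s x) := fun x m => by
      simp only [periodic2_trig (fc w) s x m, hper]
    have h0 := integral_fderiv_eq_zero hcomp hp i
    have hfd : ∀ x, fderiv ℝ (fun x => H (x, trig (fc w) s x)) x (Pi.single i 1)
        = fderiv ℝ H (x, trig (fc w) s x) (Pi.single i 1, 0)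
          + fderiv ℝ H (x, trig (fc w) s x) (0, 1) * trig (fc fun x => g x i) s x := by
      intro x
      have e1 := (hH.differentiable (by simp) (x, trig (fc w) s x)).hasFDerivAt.comp x
        ((hasFDerivAt_id x).prodMk (hw1.differentiable (by simp) x).hasFDerivAt)
      have e2 : fderiv ℝ (fun x => H (x, trig (fc w) s x)) x = _ := e1.fderiv
      rw [e2, hgc, ← fderiv_trig]
      simp only [ContinuousLinearMap.comp_apply, ContinuousLinearMap.prod_apply,
        ContinuousLinearMap.id_apply]
      have e3 : ((Pi.single i 1, fderiv ℝ (trig (fc w) s) x (Pi.single i 1)) : E2 × ℝ)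
          = (Pi.single i 1, 0) + fderiv ℝ (trig (fc w) s) x (Pi.single i 1) • (0, 1) := by
        ext <;> simp
      rw [e3, map_add, map_smul, smul_eq_mul, mul_comm]
    simp_rw [hfd] at h0
    refine Eq.trans (integral_add ?_ ?_).symm h0
    · exact integrableOn_cell (c1.comp (continuous_id.prodMk hw1.continuous))
    · exact integrableOn_cell ((c2.comp (continuous_id.prodMk hw1.continuous)).mul
        (contDiff_trig _ s).continuous)
  have t3 := t1.add t2
  simp_rw [hzero] at t3
  have h := tendsto_nhds_unique t3 tendsto_const_nhds
  refine Eq.trans ?_ h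
  congr 1
  · refine integral_congr_ae ?_
    filter_upwards [hae] with x hx
    rw [← hx]
  · refine integral_congr_ae ?_
    filter_upwards [hae] with x hx
    rw [← hx]

end ChainRule

/-! ### The divergence theorem below the graph of an `H²` function -/

section Divergence

theorem integral_add_three {α : Type*} [MeasurableSpace α] {μ : Measure α} {f g h : α → ℝ}
    (hf : Integrable f μ) (hg : Integrable g μ) (hh : Integrable h μ) :
    ∫ x, (f x + g x + h x) ∂μ = (∫ x, f x ∂μ) + (∫ x, g x ∂μ) + ∫ x, h x ∂μ := by
  have hfg : Integrable (fun x => f x + g x) μ := hf.add hg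
  rw [integral_add hfg hh, integral_add hf hg]

/-- `(x, z) ↦ pt x z` as a continuous linear map. -/
def ptL : E2 × ℝ →L[ℝ] E3 where
  toFun p := pt p.1 p.2
  map_add' p q := by ext i; fin_cases i <;> simp [pt]
  map_smul' c p := by ext i; fin_cases i <;> simp [pt]
  cont := continuous_pt

@[simp] theorem ptL_apply (p : E2 × ℝ) : ptL p = pt p.1 p.2 := rfl

theorem pt_single (i : Fin 2) : pt (Pi.single i 1) 0 = Pi.single i.castSucc 1 := by
  ext j; fin_cases i <;> fin_cases j <;> simp [pt]

theorem pt_zero (c : ℝ) : pt 0 c = c • Pi.single 2 1 := by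
  ext j; fin_cases j <;> simp [pt]

theorem pt_add_int (x : E2) (m : Fin 2 → ℤ) (z : ℝ) :
    pt (x + fun i => (m i : ℝ)) z = pt x z + ![(m 0 : ℝ), (m 1 : ℝ), 0] := by
  ext j; fin_cases j <;> simp [pt]

theorem hasDerivAt_vertical {a : E3 → ℝ} (ha : ContDiff ℝ 1 a) (x : E2) (h s : ℝ) :
    HasDerivAt (fun s => a (pt x (s * h))) (gradE a (pt x (s * h)) 2 * h) s := by
  have h1 : HasDerivAt (fun s : ℝ => pt x (s * h)) (pt 0 h) s := by
    have e : (fun s : ℝ => pt x (s * h)) = ptL ∘ fun s => (x, s * h) := rfl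
    rw [e]
    have h2 : HasDerivAt (fun s : ℝ => (x, s * h)) (0, h) s :=
      (hasDerivAt_const s x).prodMk (by simpa using (hasDerivAt_id s).mul_const h)
    exact ptL.hasFDerivAt.comp_hasDerivAt s h2
  have h3 := ((ha.differentiable (by simp) (pt x (s * h))).hasFDerivAt).comp_hasDerivAt s h1
  rw [pt_zero, map_smul, smul_eq_mul, mul_comm] at h3
  exact h3

theorem continuous_gradE {a : E3 → ℝ} (ha : ContDiff ℝ 1 a) (j : Fin 3) :
    Continuous fun y => gradE a y j :=
  (ha.continuous_fderiv (by simp)).clm_apply continuous_const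

theorem integral_vertical {a : E3 → ℝ} (ha : ContDiff ℝ 1 a) (x : E2) (h : ℝ) :
    ∫ s in (0 : ℝ)..1, gradE a (pt x (s * h)) 2 * h = a (pt x h) - a (pt x 0) := by
  have hc : Continuous fun s : ℝ => gradE a (pt x (s * h)) 2 * h :=
    ((continuous_gradE ha 2).comp (continuous_pt.comp (by fun_prop :
      Continuous fun s : ℝ => (x, s * h)))).mul continuous_const
  rw [intervalIntegral.integral_eq_sub_of_hasDerivAt
    (fun s _ => hasDerivAt_vertical ha x h s) (hc.intervalIntegrable _ _)]
  simp

/-- The integrand is the derivative of s ↦ s a(x, s h). This collapses a contribution from the whole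
fibre to its upper endpoint, that is, to the graph. -/
theorem integral_vertical_mul {a : E3 → ℝ} (ha : ContDiff ℝ 1 a) (x : E2) (h : ℝ) :
    ∫ s in (0 : ℝ)..1, (gradE a (pt x (s * h)) 2 * (s * h) + a (pt x (s * h))) = a (pt x h) := by
  have hp : Continuous fun s : ℝ => pt x (s * h) :=
    continuous_pt.comp (by fun_prop : Continuous fun s : ℝ => (x, s * h))
  have hc : Continuous fun s : ℝ => gradE a (pt x (s * h)) 2 * (s * h) + a (pt x (s * h)) :=
    (((continuous_gradE ha 2).comp hp).mul (by fun_prop)).add (ha.continuous.comp hp)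
  rw [intervalIntegral.integral_eq_sub_of_hasDerivAt (f := fun s => s * a (pt x (s * h)))
    (fun s _ => ?_) (hc.intervalIntegrable _ _)]
  · simp
  · have := (hasDerivAt_id s).mul (hasDerivAt_vertical ha x h s)
    refine this.congr_deriv ?_
    simp only [id]; ring

/-- The factor `g` is only integrable because it will be a component of ∇w. -/
theorem integral_cell_swap {k : E2 × ℝ → ℝ} (hk : Continuous k) {g : E2 → ℝ}
    (hg : IntegrableOn g cell) :
    ∫ x in cell, ∫ s in (0 : ℝ)..1, k (x, s) * g x
      = ∫ s in (0 : ℝ)..1, ∫ x in cell, k (x, s) * g x := by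
  simp only [intervalIntegral.integral_of_le zero_le_one]
  refine integral_integral_swap (f := fun x s => k (x, s) * g x) ?_
  obtain ⟨C, hC⟩ := ((isCompact_Icc (a := (0 : E2)) (b := 1)).prod
    (isCompact_Icc (a := (0 : ℝ)) (b := 1))).exists_bound_of_continuousOn hk.continuousOn
  have hg' : Integrable g (volume.restrict cell) := hg
  refine Integrable.bdd_mul (c := C) (hg'.comp_fst _) hk.aestronglyMeasurable ?_
  rw [Measure.prod_restrict]
  filter_upwards [ae_restrict_mem (measurableSet_cell.prod measurableSet_Ioc)] with p hp
  exact hC p ⟨cell_subset_Icc hp.1, Ioc_subset_Icc_self hp.2⟩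

variable {w : E2 → ℝ} {g : E2 → E2} {K : E2 → Fin 2 → Fin 2 → ℝ}

/-- At fixed relative height s, the weak chain rule is applied to H(x,z) = a(x, s(1+z))(1+z), where
the last factor is the Jacobian of the rescaling: the total derivative of H(x, w(x)) has mean zero.
-/
theorem integral_horizontal_scaled (hwg : IsWeakGrad w g) (hgK : IsWeakHess g K)
    (hw : MemLp w 2 (volume.restrict cell)) (hg : MemLp g 2 (volume.restrict cell))
    (hK : MemLp K 2 (volume.restrict cell)) {a : E3 → ℝ} (ha : ContDiff ℝ 1 a)
    (hper : Periodic3 a) (i : Fin 2) (s : ℝ) :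
    ∫ x in cell, gradE a (pt x (s * (1 + w x))) i.castSucc * (1 + w x)
      = -∫ x in cell, (gradE a (pt x (s * (1 + w x))) 2 * (s * (1 + w x))
          + a (pt x (s * (1 + w x)))) * g x i := by
  set H : E2 × ℝ → ℝ := fun p => a (pt p.1 (s * (1 + p.2))) * (1 + p.2) with hH
  have hA : ContDiff ℝ 1 fun p : E2 × ℝ => pt p.1 (s * (1 + p.2)) :=
    ptL.contDiff.comp (by fun_prop : ContDiff ℝ 1 fun p : E2 × ℝ => (p.1, s * (1 + p.2)))
  have hHc : ContDiff ℝ 1 H := (ha.comp hA).mul (by fun_prop)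
  have hder : ∀ p v, fderiv ℝ H p v = fderiv ℝ a (pt p.1 (s * (1 + p.2))) (pt v.1 (s * v.2))
      * (1 + p.2) + a (pt p.1 (s * (1 + p.2))) * v.2 := by
    intro p v
    have h1 : HasFDerivAt (fun p : E2 × ℝ => (p.1, s * (1 + p.2)))
        ((ContinuousLinearMap.fst ℝ E2 ℝ).prod (s • ContinuousLinearMap.snd ℝ E2 ℝ)) p :=
      hasFDerivAt_fst.prodMk ((hasFDerivAt_snd.const_add 1).const_mul s)
    have h2 := (ha.differentiable (by simp) (pt p.1 (s * (1 + p.2)))).hasFDerivAt.comp p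
      (ptL.hasFDerivAt.comp p h1)
    have h3 : HasFDerivAt H _ p := h2.mul (hasFDerivAt_snd.const_add 1)
    rw [h3.fderiv]
    simp
    ring
  have h := integral_weak_chain hwg hgK hw hg hK hHc (fun x z m => by
    simp only [hH, pt_add_int, hper (pt x (s * (1 + z))) m]) i
  simp only [hder, mul_zero, mul_one, add_zero, pt_single, pt_zero, map_smul, smul_eq_mul] at h
  rw [← sub_eq_zero, sub_neg_eq_add, ← h]
  congr 1
  congr 1
  ext x
  simp only [gradE]
  ring

/-- The identity at relative height s is integrated over s ∈ [0,1]; by `integral_vertical_mul` the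
factor of ∂ᵢw then reduces to the value of `a` on the graph. -/
theorem integral_horizontal (hwc : Continuous w) {M : ℝ} (hM : ∀ x, 1 + w x ≤ M)
    (hpos : ∀ x, 0 < 1 + w x) (hwg : IsWeakGrad w g) (hgK : IsWeakHess g K)
    (hw : MemLp w 2 (volume.restrict cell)) (hg : MemLp g 2 (volume.restrict cell))
    (hK : MemLp K 2 (volume.restrict cell)) {a : E3 → ℝ} (ha : ContDiff ℝ 1 a)
    (hper : Periodic3 a) (i : Fin 2) :
    ∫ y in subgraph (fun x => 1 + w x), gradE a y i.castSucc
      = -∫ x in cell, a (pt x (1 + w x)) * g x i := by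
  have hp : Continuous fun p : E2 × ℝ => pt p.1 (p.2 * (1 + w p.1)) :=
    continuous_pt.comp (by fun_prop : Continuous fun p : E2 × ℝ => (p.1, p.2 * (1 + w p.1)))
  rw [integral_subgraph (continuous_gradE ha _) (by fun_prop) hM hpos]
  have e1 := integral_cell_swap
    (k := fun p => gradE a (pt p.1 (p.2 * (1 + w p.1))) i.castSucc * (1 + w p.1))
    (((continuous_gradE ha _).comp hp).mul (by fun_prop)) (g := fun _ => 1)
    (integrable_const (1 : ℝ))
  simp only [mul_one] at e1
  rw [e1]
  simp_rw [integral_horizontal_scaled hwg hgK hw hg hK ha hper i]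
  rw [intervalIntegral.integral_neg]
  have e2 := integral_cell_swap
    (k := fun p => gradE a (pt p.1 (p.2 * (1 + w p.1))) 2 * (p.2 * (1 + w p.1))
      + a (pt p.1 (p.2 * (1 + w p.1))))
    ((((continuous_gradE ha _).comp hp).mul (by fun_prop)).add (ha.continuous.comp hp))
    (integrableOn_of_memLp (memLp_coord hg i))
  rw [← e2]
  simp_rw [intervalIntegral.integral_mul_const, integral_vertical_mul ha]

theorem integral_gradE_two (hwc : Continuous w) {M : ℝ} (hM : ∀ x, 1 + w x ≤ M)
    (hpos : ∀ x, 0 < 1 + w x) {a : E3 → ℝ} (ha : ContDiff ℝ 1 a) :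
    ∫ y in subgraph (fun x => 1 + w x), gradE a y 2
      = ∫ x in cell, (a (pt x (1 + w x)) - a (pt x 0)) := by
  rw [integral_subgraph (continuous_gradE ha _) (by fun_prop) hM hpos]
  simp_rw [integral_vertical ha]

/-- The divergence theorem in the region below the graph of `1 + w`, for fields that are
tangential to the bottom. -/
theorem integral_divergence (hwc : Continuous w) {M : ℝ} (hM : ∀ x, 1 + w x ≤ M)
    (hpos : ∀ x, 0 < 1 + w x) (hwg : IsWeakGrad w g) (hgK : IsWeakHess g K)
    (hw : MemLp w 2 (volume.restrict cell)) (hg : MemLp g 2 (volume.restrict cell))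
    (hK : MemLp K 2 (volume.restrict cell)) {F : E3 → E3} (hF : ContDiff ℝ 1 F)
    (hper : Periodic3 F) (hbot : ∀ x, F (pt x 0) 2 = 0) :
    ∫ y in subgraph (fun x => 1 + w x), tr3 (jac F y)
      = ∫ x in cell, F (pt x (1 + w x)) ⬝ᵥ normal (g x) := by
  have hFi : ∀ i, ContDiff ℝ 1 fun y => F y i := fun i => contDiff_pi.1 hF i
  have hpi : ∀ i, Periodic3 fun y => F y i := fun i y k => congrFun (hper y k) i
  have hint : ∀ i j, IntegrableOn (fun y => gradE (fun z => F z i) y j)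
      (subgraph fun x => 1 + w x) := fun i j =>
    integrableOn_subgraph (continuous_gradE (hFi i) j) hM
  have hT : Continuous fun x => pt x (1 + w x) :=
    continuous_pt.comp (by fun_prop : Continuous fun x => (x, 1 + w x))
  have hB : ∀ i, IntegrableOn (fun x => F (pt x (1 + w x)) i.castSucc * g x i) cell := fun i => by
    have hm : MemLp (fun x => F (pt x (1 + w x)) i.castSucc) 2 (volume.restrict cell) := by
      have hc := (hFi i.castSucc).continuous.comp hT
      obtain ⟨C, hC⟩ := (isCompact_Icc (a := (0 : E2)) (b := 1)).exists_bound_of_continuousOn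
        hc.continuousOn
      refine MemLp.of_bound hc.aestronglyMeasurable C ?_
      filter_upwards [ae_restrict_mem measurableSet_cell] with x hx
      exact hC x (cell_subset_Icc hx)
    exact integrable_mul_of_memLp hm (memLp_coord hg i)
  have h0 := integral_horizontal hwc hM hpos hwg hgK hw hg hK (hFi 0) (hpi 0) 0
  have h1 := integral_horizontal hwc hM hpos hwg hgK hw hg hK (hFi 1) (hpi 1) 1
  have h2 := integral_gradE_two hwc hM hpos (hFi 2)
  simp only [Fin.castSucc_zero, Fin.castSucc_one] at h0 h1
  have hB0 := hB 0
  have hB1 := hB 1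
  simp only [Fin.castSucc_zero, Fin.castSucc_one] at hB0 hB1
  simp only [tr3, jac, Fin.sum_univ_three]
  rw [integral_add_three (hint 0 0) (hint 1 1) (hint 2 2), h0, h1, h2]
  simp only [hbot, sub_zero]
  rw [← integral_neg, ← integral_neg]
  refine (integral_add_three hB0.neg hB1.neg
    (integrableOn_cell ((hFi 2).continuous.comp hT))).symm.trans ?_
  congr 1; ext x
  simp [normal, dotProduct, Fin.sum_univ_three]

end Divergence

/-! ### The transport theorem below a moving graph -/

section Transport

open Filter Topology

/-- The oscillation sums of `h` are dominated by those of `f` and `g`. It serves for compositions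
that are Lipschitz in two absolutely continuous arguments. -/
theorem absolutelyContinuous_of_dist_le {f g h : ℝ → ℝ} {a b C : ℝ}
    (hf : AbsolutelyContinuousOnInterval f a b) (hg : AbsolutelyContinuousOnInterval g a b)
    (hh : ∀ x ∈ uIcc a b, ∀ y ∈ uIcc a b,
      dist (h x) (h y) ≤ C * (dist (f x) (f y) + dist (g x) (g y))) :
    AbsolutelyContinuousOnInterval h a b := by
  have h1 := (Tendsto.add hf hg).const_mul C
  rw [add_zero, mul_zero] at h1
  refine squeeze_zero' (Eventually.of_forall fun E => Finset.sum_nonneg fun i _ => dist_nonneg) ?_ h1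
  -- The comparison needs only that the endpoints lie in the interval; smallness of the total length
  -- enters through `h1`.
  refine mem_inf_of_right ?_
  rw [mem_principal]
  intro E hE
  simp only [mem_ofPred_eq, ← Finset.sum_add_distrib, Finset.mul_sum]
  refine Finset.sum_le_sum fun i hi => hh _ (hE.1 i hi).1 _ (hE.1 i hi).2

/-- The chain rule for a `C¹` function of time and of an absolutely continuous function. -/
theorem integral_chain_rule {τ : ℝ} (hτ : 0 ≤ τ) {α : ℝ → ℝ}
    (hα : IntervalIntegrable α volume 0 τ) {c : ℝ} {h : ℝ → ℝ}
    (hh : ∀ t ∈ Icc 0 τ, h t = c + ∫ s in (0)..t, α s) {G : ℝ × ℝ → ℝ} (hG : ContDiff ℝ 1 G) :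
    G (τ, h τ) - G (0, h 0)
      = ∫ t in (0)..τ, (fderiv ℝ G (t, h t) (1, 0) + fderiv ℝ G (t, h t) (0, 1) * α t) := by
  set k : ℝ → ℝ := fun t => c + ∫ s in (0)..t, α s with hk
  have kac : AbsolutelyContinuousOnInterval k 0 τ := absolutelyContinuous_primitive hα c
  have idac : AbsolutelyContinuousOnInterval (fun t : ℝ => t) 0 τ :=
    ContDiffOn.absolutelyContinuousOnInterval contDiffOn_id
  obtain ⟨R, hR⟩ := kac.exists_bound
  set S : Set (ℝ × ℝ) := Icc 0 τ ×ˢ Icc (-R) R with hS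
  have hSc : IsCompact S := isCompact_Icc.prod isCompact_Icc
  obtain ⟨C, hC⟩ := hSc.exists_bound_of_continuousOn (f := fderiv ℝ G)
    (hG.continuous_fderiv (by simp)).continuousOn
  have hmem : ∀ t ∈ uIcc 0 τ, (t, k t) ∈ S := fun t ht => by
    refine ⟨by rwa [uIcc_of_le hτ] at ht, ?_⟩
    exact abs_le.1 (hR t ht)
  have hC0 : 0 ≤ C := (norm_nonneg _).trans (hC _ (hmem 0 left_mem_uIcc))
  -- `G` is Lipschitz on the compact convex box `S` that contains the curve, so the composition is
  -- absolutely continuous and hence the integral of its almost everywhere derivative.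
  have Gac : AbsolutelyContinuousOnInterval (fun t => G (t, k t)) 0 τ := by
    refine absolutelyContinuous_of_dist_le (C := C) idac kac fun x hx y hy => ?_
    have h1 := ((convex_Icc (0 : ℝ) τ).prod (convex_Icc (-R) R)).norm_image_sub_le_of_norm_fderiv_le
      (fun p _ => hG.differentiable (by simp) p) hC (hmem y hy) (hmem x hx)
    rw [dist_eq_norm]
    refine h1.trans (mul_le_mul_of_nonneg_left ?_ hC0)
    rw [← dist_eq_norm, Prod.dist_eq]
    exact max_le (le_add_of_nonneg_right dist_nonneg) (le_add_of_nonneg_left dist_nonneg)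
  have h0 := Gac.integral_deriv_eq_sub
  have e : ∀ t ∈ Icc 0 τ, h t = k t := hh
  rw [e τ ⟨hτ, le_rfl⟩, e 0 ⟨le_rfl, hτ⟩, ← h0, intervalIntegral.integral_of_le hτ,
    intervalIntegral.integral_of_le hτ]
  refine integral_congr_ae ?_
  filter_upwards [ae_hasDerivAt_primitive hτ hα c, ae_restrict_mem measurableSet_Ioc] with t h1 ht
  have h2 := (hG.differentiable (by simp) (t, k t)).hasFDerivAt.comp_hasDerivAt t
    ((hasDerivAt_id t).prodMk h1)
  rw [e t (Ioc_subset_Icc_self ht)]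
  refine Eq.trans h2.deriv ?_
  have e3 : ((1, α t) : ℝ × ℝ) = (1, 0) + α t • (0, 1) := by ext <;> simp
  rw [e3, map_add, map_smul, smul_eq_mul, mul_comm (α t)]

/-- The form of the transport integrands: the coefficients are continuous, hence bounded on compact
sets, and the plate velocity `v` is only integrable. -/
theorem integrable_add_mul {α β : Type*} [TopologicalSpace α] [TopologicalSpace β]
    [MeasurableSpace α] [MeasurableSpace β] [OpensMeasurableSpace α] [OpensMeasurableSpace β]
    [SecondCountableTopology α] [SecondCountableTopology β] {μ : Measure α} {ν : Measure β}
    [SFinite μ] [SFinite ν] {S K : Set α} {R L : Set β} [IsFiniteMeasure (μ.restrict S)]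
    [IsFiniteMeasure (ν.restrict R)] (hS : MeasurableSet S) (hR : MeasurableSet R)
    (hK : IsCompact K) (hL : IsCompact L) (hSK : S ⊆ K) (hRL : R ⊆ L) {k₁ k₂ v : α × β → ℝ}
    (h₁ : Continuous k₁) (h₂ : Continuous k₂)
    (hv : Integrable v ((μ.restrict S).prod (ν.restrict R))) :
    Integrable (fun p => k₁ p + k₂ p * v p) ((μ.restrict S).prod (ν.restrict R)) := by
  obtain ⟨C, hC⟩ := (hK.prod hL).exists_bound_of_continuousOn h₁.continuousOn
  obtain ⟨D, hD⟩ := (hK.prod hL).exists_bound_of_continuousOn h₂.continuousOn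
  have hmem : ∀ᵐ p ∂((μ.restrict S).prod (ν.restrict R)), p ∈ K ×ˢ L := by
    rw [Measure.prod_restrict]
    filter_upwards [ae_restrict_mem (hS.prod hR)] with p hp
    exact ⟨hSK hp.1, hRL hp.2⟩
  refine Integrable.add ?_ ?_
  · exact Integrable.of_bound h₁.aestronglyMeasurable C (hmem.mono fun p hp => hC p hp)
  · exact Integrable.bdd_mul (c := D) hv h₂.aestronglyMeasurable (hmem.mono fun p hp => hD p hp)

/-- An almost everywhere in space primitive in time is a primitive for almost every point. -/
theorem ae_primitive {T : ℝ} (hT : 0 ≤ T) {w v : ℝ → E2 → ℝ}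
    (hw : Continuous fun p : ℝ × E2 => w p.1 p.2)
    (hv : IntegrableOn (fun p : ℝ × E2 => v p.1 p.2) (GammaT T))
    (h : ∀ t ∈ Icc 0 T, ∀ᵐ x ∂(volume.restrict cell), w t x = w 0 x + ∫ s in (0)..t, v s x) :
    ∀ᵐ x ∂(volume.restrict cell), IntervalIntegrable (fun t => v t x) volume 0 T ∧
      ∀ t ∈ Icc 0 T, w t x = w 0 x + ∫ s in (0)..t, v s x := by
  have : Nonempty (Icc (0 : ℝ) T) := ⟨⟨0, le_rfl, hT⟩⟩
  -- The exceptional null set may depend on the time. Countably many dense times share one null set,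
  -- and continuity in time of both sides gives all the others.
  have h1 : ∀ᵐ x ∂(volume.restrict cell), ∀ n,
      w (TopologicalSpace.denseSeq (Icc (0 : ℝ) T) n) x
        = w 0 x + ∫ s in (0)..(TopologicalSpace.denseSeq (Icc (0 : ℝ) T) n : ℝ), v s x :=
    ae_all_iff.2 fun n => h _ (Subtype.coe_prop _)
  rw [IntegrableOn, volume_GammaT] at hv
  filter_upwards [h1, hv.prod_left_ae] with x hx hvx
  have hvi : IntervalIntegrable (fun t => v t x) volume 0 T :=
    intervalIntegrable_of_Ioo hvx ⟨hT, le_rfl⟩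
  refine ⟨hvi, fun t ht => ?_⟩
  have c1 : Continuous fun t : Icc (0 : ℝ) T => w t x :=
    hw.comp (continuous_subtype_val.prodMk continuous_const)
  have c2 : Continuous fun t : Icc (0 : ℝ) T => w 0 x + ∫ s in (0)..(t : ℝ), v s x := by
    have := intervalIntegral.continuousOn_primitive_interval' hvi left_mem_uIcc
    rw [uIcc_of_le hT] at this
    exact continuous_const.add this.domRestrict
  have := (TopologicalSpace.denseRange_denseSeq (Icc (0 : ℝ) T)).equalizer c1 c2
    (funext hx)
  exact congrFun this ⟨t, ht⟩

theorem continuous_dt {f : ℝ → E3 → ℝ} (hf : ContDiff ℝ 1 fun p : ℝ × E3 => f p.1 p.2) :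
    Continuous fun p : ℝ × E3 => dt f p.1 p.2 := by
  have h : ∀ p : ℝ × E3, dt f p.1 p.2 = fderiv ℝ (fun p : ℝ × E3 => f p.1 p.2) p (1, 0) := by
    intro p
    have h1 := (hf.differentiable (by simp) p).hasFDerivAt.comp_hasDerivAt p.1
      ((hasDerivAt_id p.1).prodMk (hasDerivAt_const p.1 p.2))
    exact h1.deriv
  simp_rw [h]
  exact (hf.continuous_fderiv (by simp)).clm_apply continuous_const

theorem contDiff_section {E : Type*} [NormedAddCommGroup E] [NormedSpace ℝ E] {n : WithTop ℕ∞}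
    {f : ℝ → E3 → E} (hf : ContDiff ℝ n fun p : ℝ × E3 => f p.1 p.2) (t : ℝ) :
    ContDiff ℝ n (f t) :=
  hf.comp (contDiff_const.prodMk contDiff_id)

theorem continuous_gradE_section {f : ℝ → E3 → ℝ}
    (hf : ContDiff ℝ 1 fun p : ℝ × E3 => f p.1 p.2) (j : Fin 3) :
    Continuous fun p : ℝ × E3 => gradE (f p.1) p.2 j := by
  have h : ∀ p : ℝ × E3, gradE (f p.1) p.2 j
      = fderiv ℝ (fun p : ℝ × E3 => f p.1 p.2) p (0, Pi.single j 1) := by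
    intro p
    have h0 : HasFDerivAt (fun y : E3 => (p.1, y))
        ((0 : E3 →L[ℝ] ℝ).prod (ContinuousLinearMap.id ℝ E3)) p.2 :=
      (hasFDerivAt_const p.1 p.2).prodMk (hasFDerivAt_id p.2)
    have h1 := HasFDerivAt.comp (g := fun p : ℝ × E3 => f p.1 p.2) p.2
      (hf.differentiable (by simp) p).hasFDerivAt h0
    have h2 : fderiv ℝ (f p.1) p.2 = _ := h1.fderiv
    simp [gradE, h2]
  simp_rw [h]
  exact (hf.continuous_fderiv (by simp)).clm_apply continuous_const

/-- Evolution of the integral of `f` along one vertical fibre. -/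
theorem integral_fibre_sub {τ : ℝ} (hτ : 0 ≤ τ) {f : ℝ → E3 → ℝ}
    (hf : ContDiff ℝ 1 fun p : ℝ × E3 => f p.1 p.2) (x : E2) {v h : ℝ → ℝ}
    (hh : Continuous h) (hv : IntervalIntegrable v volume 0 τ)
    (hprim : ∀ t ∈ Icc 0 τ, h t = h 0 + ∫ s in (0)..t, v s) :
    (∫ s in (0 : ℝ)..1, f τ (pt x (s * h τ)) * h τ)
      - (∫ s in (0 : ℝ)..1, f 0 (pt x (s * h 0)) * h 0)
      = ∫ t in (0)..τ, ((∫ s in (0 : ℝ)..1, dt f t (pt x (s * h t)) * h t)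
          + f t (pt x (h t)) * v t) := by
  have hp : Continuous fun p : ℝ × ℝ => pt x (p.1 * h p.2) :=
    continuous_pt.comp (by fun_prop : Continuous fun p : ℝ × ℝ => (x, p.1 * h p.2))
  have hp2 : Continuous fun p : ℝ × ℝ => (p.2, pt x (p.1 * h p.2)) := continuous_snd.prodMk hp
  have cdt := (continuous_dt hf).comp hp2
  have cgr := (continuous_gradE_section hf 2).comp hp2
  have cf := hf.continuous.comp hp2
  simp only [Function.comp_def] at cdt cgr cf
  -- At fixed relative height `s` this is the chain rule for f(t, x, s z) z along z = h(t).
  -- Integrating the coefficient of `v` over `s` leaves the value of `f` at the top.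
  have key : ∀ s, f τ (pt x (s * h τ)) * h τ - f 0 (pt x (s * h 0)) * h 0
      = ∫ t in (0)..τ, (dt f t (pt x (s * h t)) * h t
        + (gradE (f t) (pt x (s * h t)) 2 * (s * h t) + f t (pt x (s * h t))) * v t) := by
    intro s
    set G : ℝ × ℝ → ℝ := fun p => f p.1 (pt x (s * p.2)) * p.2 with hG
    have hGc : ContDiff ℝ 1 G := by
      have h1 : ContDiff ℝ 1 fun p : ℝ × ℝ => (p.1, pt x (s * p.2)) :=
        contDiff_fst.prodMk (ptL.contDiff.comp
          (by fun_prop : ContDiff ℝ 1 fun p : ℝ × ℝ => (x, s * p.2)))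
      exact (hf.comp h1).mul contDiff_snd
    have h0 := integral_chain_rule hτ hv (c := h 0) hprim hGc
    rw [show f τ (pt x (s * h τ)) * h τ - f 0 (pt x (s * h 0)) * h 0 = G (τ, h τ) - G (0, h 0)
      from rfl, h0]
    congr 1; ext t
    have d1 : fderiv ℝ G (t, h t) (1, 0) = dt f t (pt x (s * h t)) * h t := by
      have a1 := (hGc.differentiable (by simp) (t, h t)).hasFDerivAt.comp_hasDerivAt t
        ((hasDerivAt_id t).prodMk (hasDerivAt_const t (h t)))
      have a2 : HasDerivAt (fun r => f r (pt x (s * h t))) (dt f t (pt x (s * h t))) t := by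
        have : DifferentiableAt ℝ (fun r => f r (pt x (s * h t))) t :=
          DifferentiableAt.comp (g := fun p : ℝ × E3 => f p.1 p.2)
            (f := fun r => (r, pt x (s * h t))) t
            (hf.differentiable (by simp) (t, pt x (s * h t)))
            (differentiableAt_id.prodMk (differentiableAt_const _))
        exact this.hasDerivAt
      exact a1.unique (a2.mul_const (h t))
    have d2 : fderiv ℝ G (t, h t) (0, 1)
        = gradE (f t) (pt x (s * h t)) 2 * (s * h t) + f t (pt x (s * h t)) := by
      have a1 := (hGc.differentiable (by simp) (t, h t)).hasFDerivAt.comp_hasDerivAt (h t)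
        ((hasDerivAt_const (h t) t).prodMk (hasDerivAt_id (h t)))
      have a2 := hasDerivAt_vertical (contDiff_section hf t) x s (h t)
      simp_rw [mul_comm _ s] at a2
      have a3 := a2.mul (hasDerivAt_id (h t))
      refine (a1.unique a3).trans ?_
      simp only [id]; ring
    rw [d1, d2]
  have i1 : ∀ t, IntervalIntegrable (fun s : ℝ => f t (pt x (s * h t)) * h t) volume 0 1 := fun t =>
    ((cf.comp (continuous_id.prodMk (continuous_const (y := t)))).mul
      continuous_const).intervalIntegrable _ _
  rw [← intervalIntegral.integral_sub (i1 τ) (i1 0)]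
  simp_rw [key]
  have hvi : Integrable (fun p : ℝ × ℝ => v p.2)
      ((volume.restrict (Ioc (0 : ℝ) 1)).prod (volume.restrict (Ioc 0 τ))) :=
    Integrable.comp_snd hv.1 _
  have hswap := integral_integral_swap (f := fun s t => dt f t (pt x (s * h t)) * h t
        + (gradE (f t) (pt x (s * h t)) 2 * (s * h t) + f t (pt x (s * h t))) * v t)
    (integrable_add_mul measurableSet_Ioc measurableSet_Ioc
      (isCompact_Icc (a := (0 : ℝ)) (b := 1)) (isCompact_Icc (a := (0 : ℝ)) (b := τ))
      Ioc_subset_Icc_self Ioc_subset_Icc_self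
      (k₁ := fun p => dt f p.2 (pt x (p.1 * h p.2)) * h p.2)
      (k₂ := fun p => gradE (f p.2) (pt x (p.1 * h p.2)) 2 * (p.1 * h p.2)
        + f p.2 (pt x (p.1 * h p.2)))
      (cdt.mul (by fun_prop)) ((cgr.mul (by fun_prop)).add cf) hvi)
  simp only [intervalIntegral.integral_of_le zero_le_one, intervalIntegral.integral_of_le hτ]
  rw [hswap]
  congr 1; ext t
  have cs : Continuous fun s : ℝ => (s, t) := by fun_prop
  have j1 : IntervalIntegrable (fun s : ℝ => dt f t (pt x (s * h t)) * h t) volume 0 1 :=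
    ((cdt.comp cs).mul continuous_const).intervalIntegrable _ _
  have j2 : IntervalIntegrable (fun s : ℝ => (gradE (f t) (pt x (s * h t)) 2 * (s * h t)
      + f t (pt x (s * h t))) * v t) volume 0 1 :=
    ((((cgr.comp cs).mul (by fun_prop)).add
      (cf.comp cs)).mul continuous_const).intervalIntegrable _ _
  rw [integral_add j1.1 j2.1]
  congr 1
  rw [integral_mul_const, ← intervalIntegral.integral_of_le zero_le_one,
    integral_vertical_mul (contDiff_section hf t)]

/-- **Reynolds' transport theorem** below a moving graph. -/
theorem transport {T : ℝ} {w v : ℝ → E2 → ℝ} (hw : Continuous fun p : ℝ × E2 => w p.1 p.2)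
    {M : ℝ} (hM : ∀ t x, 1 + w t x ≤ M) (hpos : ∀ t x, 0 < 1 + w t x)
    (hv : IntegrableOn (fun p : ℝ × E2 => v p.1 p.2) (GammaT T))
    (hprim : ∀ t ∈ Icc 0 T, ∀ᵐ x ∂(volume.restrict cell), w t x = w 0 x + ∫ s in (0)..t, v s x)
    {f : ℝ → E3 → ℝ} (hf : ContDiff ℝ 1 fun p : ℝ × E3 => f p.1 p.2) {τ : ℝ} (hτ : τ ∈ Icc 0 T) :
    (∫ y in Omega w τ, f τ y) - (∫ y in Omega w 0, f 0 y)
      = (∫ t in (0)..τ, ∫ y in Omega w t, dt f t y)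
        + ∫ t in (0)..τ, ∫ x in cell, f t (Phi w t x) * v t x := by
  have hwt : ∀ t, Continuous (w t) := fun t => hw.comp (by fun_prop : Continuous fun x => (t, x))
  have hwt1 : ∀ t, Continuous fun x => 1 + w t x := fun t => continuous_const.add (hwt t)
  have hp : Continuous fun q : ℝ × (E2 × ℝ) => (q.2.2, pt q.2.1 (q.1 * (1 + w q.2.2 q.2.1))) := by
    have h1 : Continuous fun q : ℝ × (E2 × ℝ) => w q.2.2 q.2.1 :=
      hw.comp (by fun_prop : Continuous fun q : ℝ × (E2 × ℝ) => (q.2.2, q.2.1))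
    exact (by fun_prop : Continuous fun q : ℝ × (E2 × ℝ) => q.2.2).prodMk
      (continuous_pt.comp (by fun_prop :
        Continuous fun q : ℝ × (E2 × ℝ) => (q.2.1, q.1 * (1 + w q.2.2 q.2.1))))
  have hft : ∀ t, Continuous (f t) := fun t => (contDiff_section hf t).continuous
  have hdt : ∀ t, Continuous (dt f t) := fun t =>
    (continuous_dt hf).comp (by fun_prop : Continuous fun y => (t, y))
  have cfib : ∀ t, Continuous fun x => ∫ s in (0 : ℝ)..1,
      f t (pt x (s * (1 + w t x))) * (1 + w t x) := fun t => by
    refine intervalIntegral.continuous_parametric_intervalIntegral_of_continuous' (f := fun x s =>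
      f t (pt x (s * (1 + w t x))) * (1 + w t x)) ?_ _ _
    refine Continuous.mul ?_ ((hwt1 t).comp continuous_fst)
    have := hwt t
    exact (hft t).comp (continuous_pt.comp (by fun_prop :
      Continuous fun p : E2 × ℝ => (p.1, p.2 * (1 + w t p.1))))
  rw [Omega_eq_subgraph, Omega_eq_subgraph, integral_subgraph (hft τ) (hwt1 τ) (hM τ) (hpos τ),
    integral_subgraph (hft 0) (hwt1 0) (hM 0) (hpos 0),
    ← integral_sub (integrableOn_cell (cfib τ)) (integrableOn_cell (cfib 0))]
  have hae := ae_primitive (hτ.1.trans hτ.2) hw hv hprim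
  have e1 : ∀ᵐ x ∂(volume.restrict cell),
      (∫ s in (0 : ℝ)..1, f τ (pt x (s * (1 + w τ x))) * (1 + w τ x))
        - (∫ s in (0 : ℝ)..1, f 0 (pt x (s * (1 + w 0 x))) * (1 + w 0 x))
      = ∫ t in (0)..τ, ((∫ s in (0 : ℝ)..1, dt f t (pt x (s * (1 + w t x))) * (1 + w t x))
          + f t (Phi w t x) * v t x) := by
    filter_upwards [hae] with x hx
    have hcx : Continuous fun t => 1 + w t x :=
      continuous_const.add (hw.comp (by fun_prop : Continuous fun t : ℝ => (t, x)))
    refine integral_fibre_sub hτ.1 hf x hcx (v := fun t => v t x)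
      (hx.1.mono_set (by
        rw [uIcc_of_le hτ.1, uIcc_of_le (hτ.1.trans hτ.2)]; exact Icc_subset_Icc_right hτ.2))
      fun t ht => ?_
    rw [hx.2 t ⟨ht.1, ht.2.trans hτ.2⟩, add_assoc]
  rw [integral_congr_ae e1]
  have k1 : Continuous fun p : E2 × ℝ =>
      ∫ s in (0 : ℝ)..1, dt f p.2 (pt p.1 (s * (1 + w p.2 p.1))) * (1 + w p.2 p.1) := by
    refine intervalIntegral.continuous_parametric_intervalIntegral_of_continuous'
      (f := fun (p : E2 × ℝ) s =>
      dt f p.2 (pt p.1 (s * (1 + w p.2 p.1))) * (1 + w p.2 p.1)) ?_ _ _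
    have h2 := ((continuous_dt hf).comp hp).comp
      (by fun_prop : Continuous fun q : (E2 × ℝ) × ℝ => (q.2, q.1))
    refine Continuous.mul h2 (continuous_const.add ?_)
    exact hw.comp (by fun_prop : Continuous fun q : (E2 × ℝ) × ℝ => (q.1.2, q.1.1))
  have k2 : Continuous fun p : E2 × ℝ => f p.2 (Phi w p.2 p.1) := by
    have h2 := (hf.continuous.comp hp).comp (by fun_prop : Continuous fun p : E2 × ℝ => ((1 : ℝ),
      p))
    simpa [Function.comp_def, Phi] using h2
  have hvi : Integrable (fun p : E2 × ℝ => v p.2 p.1)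
      ((volume.restrict cell).prod (volume.restrict (Ioc 0 τ))) := by
    rw [IntegrableOn, volume_GammaT] at hv
    have h2 := hv.swap
    rw [restrict_Ioo_eq_restrict_Ioc, Measure.prod_restrict] at h2
    rw [Measure.prod_restrict]
    exact IntegrableOn.mono_set h2 (prod_mono le_rfl (Ioc_subset_Ioc_right hτ.2))
  have hi := integrable_add_mul (μ := volume) (ν := volume) measurableSet_cell measurableSet_Ioc
    (isCompact_Icc (a := (0 : E2)) (b := 1))
    (isCompact_Icc (a := (0 : ℝ)) (b := τ)) cell_subset_Icc Ioc_subset_Icc_self k1 k2 hvi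
  simp only [intervalIntegral.integral_of_le hτ.1]
  rw [integral_integral_swap hi]
  have i1 := (integrable_add_mul (μ := volume) (ν := volume) measurableSet_cell measurableSet_Ioc
    (isCompact_Icc (a := (0 : E2)) (b := 1))
    (isCompact_Icc (a := (0 : ℝ)) (b := τ)) cell_subset_Icc Ioc_subset_Icc_self k1
    (continuous_const (y := (0 : ℝ))) hvi)
  simp only [zero_mul, add_zero] at i1
  have i2 := (integrable_add_mul (μ := volume) (ν := volume) measurableSet_cell measurableSet_Ioc
    (isCompact_Icc (a := (0 : E2)) (b := 1))
    (isCompact_Icc (a := (0 : ℝ)) (b := τ)) cell_subset_Icc Ioc_subset_Icc_self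
    (continuous_const (y := (0 : ℝ))) k2 hvi)
  simp only [zero_add] at i2
  have e2 : ∀ᵐ t ∂(volume.restrict (Ioc 0 τ)), ∫ x in cell,
      ((∫ s in (0 : ℝ)..1, dt f t (pt x (s * (1 + w t x))) * (1 + w t x))
          + f t (Phi w t x) * v t x)
      = (∫ y in Omega w t, dt f t y) + ∫ x in cell, f t (Phi w t x) * v t x := by
    filter_upwards [i1.prod_left_ae, i2.prod_left_ae] with t h1 h2
    rw [integral_add h1 h2, Omega_eq_subgraph,
      integral_subgraph (hdt t) (hwt1 t) (hM t) (hpos t)]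
  rw [integral_congr_ae e2, integral_add]
  · refine i1.integral_prod_right.congr (Eventually.of_forall fun t => ?_)
    simp only [Omega_eq_subgraph]
    rw [integral_subgraph (hdt t) (hwt1 t) (hM t) (hpos t)]
  · exact i2.integral_prod_right

end Transport

/-! ### The kinetic energy of the test displacement -/

section Velocity

open Complex
open scoped ComplexConjugate

theorem integrable_prod_of_GammaT {E : Type*} [NormedAddCommGroup E] {T t : ℝ} {f : ℝ × E2 → E}
    (hf : IntegrableOn f (GammaT T)) (ht : t ≤ T) :
    Integrable f ((volume.restrict (Ioc 0 t)).prod (volume.restrict cell)) := by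
  rw [IntegrableOn, volume_GammaT, restrict_Ioo_eq_restrict_Ioc, Measure.prod_restrict] at hf
  rw [Measure.prod_restrict]
  exact IntegrableOn.mono_set hf (prod_mono (Ioc_subset_Ioc_right ht) le_rfl)

/-- The integral of (f - c)² is nonnegative for every constant c, and the mean value is the optimal
choice. -/
theorem sq_integral_le {α : Type*} [MeasurableSpace α] {μ : Measure α} [IsFiniteMeasure μ]
    {f : α → ℝ} (hf : Integrable f μ) (hf2 : Integrable (fun x => f x ^ 2) μ) :
    (∫ x, f x ∂μ) ^ 2 ≤ μ.real univ * ∫ x, f x ^ 2 ∂μ := by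
  set a := ∫ x, f x ∂μ with ha
  set m := μ.real univ with hm
  have hm0 : 0 ≤ m := measureReal_nonneg
  have h2 : ∀ c : ℝ, 0 ≤ (∫ x, f x ^ 2 ∂μ) - 2 * c * a + m * c ^ 2 := by
    intro c
    have h0 : 0 ≤ ∫ x, (f x - c) ^ 2 ∂μ := integral_nonneg fun x => sq_nonneg _
    have i1 : Integrable (fun x => 2 * c * f x) μ := hf.const_mul _
    have i2 : Integrable (fun x => f x ^ 2 - 2 * c * f x) μ := hf2.sub i1
    have h1 : ∫ x, (f x - c) ^ 2 ∂μ = ∫ x, ((f x ^ 2 - 2 * c * f x) + c ^ 2) ∂μ := by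
      congr 1; ext x; ring
    rw [h1, integral_add i2 (integrable_const _), integral_sub hf2 i1, integral_const_mul,
      integral_const, smul_eq_mul] at h0
    exact h0
  rcases hm0.eq_or_lt with h | h
  · have : μ = 0 := by
      rw [← Measure.measure_univ_eq_zero]
      exact (measureReal_eq_zero_iff).1 h.symm
    simp [ha, this]
  · have := h2 (a / m)
    field_simp at this
    nlinarith

/-- A primitive in time of a square integrable function has square integrable sections. -/
theorem memLp_primitive {T t : ℝ} (ht : t ∈ Icc 0 T) {v : ℝ → E2 → ℝ}
    (hv : MemLp (fun p : ℝ × E2 => v p.1 p.2) 2 (volume.restrict (GammaT T))) :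
    MemLp (fun x => ∫ s in (0)..t, v s x) 2 (volume.restrict cell) := by
  have h1 := integrable_prod_of_GammaT (integrableOn_of_memLp hv) ht.2
  have h2 := integrable_prod_of_GammaT (f := fun p : ℝ × E2 => v p.1 p.2 ^ 2) hv.integrable_sq ht.2
  simp only [intervalIntegral.integral_of_le ht.1]
  refine (memLp_two_iff_integrable_sq h1.integral_prod_right.1).2 ?_
  refine Integrable.mono' (h2.integral_prod_right.const_mul t)
    (h1.integral_prod_right.1.pow 2) ?_
  filter_upwards [h1.prod_left_ae, h2.prod_left_ae] with x a1 a2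
  rw [Real.norm_eq_abs, abs_of_nonneg (sq_nonneg _)]
  have := sq_integral_le a1 a2
  simpa [ht.1] using this

theorem ae_Ioo_exists {T : ℝ} (hT : 0 < T) {p : ℝ → Prop}
    (h : ∀ᵐ t ∂(volume.restrict (Ioo 0 T)), p t) : ∃ t ∈ Ioo 0 T, p t := by
  have : (volume.restrict (Ioo 0 T)) ≠ 0 := by
    rw [Ne, Measure.restrict_eq_zero, Real.volume_Ioo]
    simpa using hT
  have : NeZero (volume.restrict (Ioo 0 T)) := ⟨this⟩
  exact (h.and (ae_restrict_mem measurableSet_Ioo)).exists.imp fun t h => ⟨h.2, h.1⟩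

/-- Almost every slice is square integrable by Fubini. Going back from one good time to time 0, and
from there to any time, costs only a primitive of the time derivative, which is square integrable as
well. -/
theorem IsPlateTest.memLp_slice {T : ℝ} (hT : 0 < T) {ψ ψt : ℝ → E2 → ℝ} {ψg : ℝ → E2 → E2}
    {ψh : ℝ → E2 → Fin 2 → Fin 2 → ℝ} (h : IsPlateTest T ψ ψt ψg ψh) {t : ℝ} (ht : t ∈ Icc 0 T) :
    MemLp (ψ t) 2 (volume.restrict cell) := by
  have h0 : MemLp (ψ 0) 2 (volume.restrict cell) := by
    obtain ⟨s, hs, hψ⟩ := ae_Ioo_exists hT (memLp_slice_GammaT h.memLp)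
    refine MemLp.ae_eq ?_ (hψ.sub (memLp_primitive (Ioo_subset_Icc_self hs) h.memLp_dt))
    filter_upwards [h.primitive s (Ioo_subset_Icc_self hs)] with x hx
    simp [hx]
  refine MemLp.ae_eq ?_ (h0.add (memLp_primitive ht h.memLp_dt))
  filter_upwards [h.primitive t ht] with x hx
  simp [hx]

/-- The modes of `ψ` are primitives of those of `ψt`; the Leibniz rule for each mode is summed by
Parseval and dominated convergence. -/
theorem IsPlateTest.integral_sq_sub {T : ℝ} (hT : 0 < T) {ψ ψt : ℝ → E2 → ℝ} {ψg : ℝ → E2 → E2}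
    {ψh : ℝ → E2 → Fin 2 → Fin 2 → ℝ} (h : IsPlateTest T ψ ψt ψg ψh) {τ : ℝ} (hτ : τ ∈ Icc 0 T) :
    (∫ x in cell, ψ τ x ^ 2) - (∫ x in cell, ψ 0 x ^ 2)
      = ∫ t in (0)..τ, ∫ x in cell, 2 * (ψ t x * ψt t x) := by
  have h0 : (0 : ℝ) ∈ Icc 0 T := ⟨le_rfl, hτ.1.trans hτ.2⟩
  have hψ := integrableOn_of_memLp h.memLp
  have hψt := integrableOn_of_memLp h.memLp_dt
  have hprim : ∀ k, ∀ t ∈ Icc 0 T, fc (ψ t) k = fc (ψ 0) k + ∫ s in (0)..t, fc (ψt s) k :=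
    fun k t ht => fc_primitive ht hψt (integrableOn_of_memLp (h.memLp_slice hT h0))
      (h.primitive t ht) k
  set F : (Fin 2 → ℤ) → ℝ → ℝ := fun k t => 2 * (conj (fc (ψ t) k) * fc (ψt t) k).re with hF
  set B : (Fin 2 → ℤ) → ℝ → ℝ := fun k t =>
    2 * (‖fc (ψ t) k‖ ^ 2 + ‖fc (ψt t) k‖ ^ 2) with hB
  have slt := memLp_slice_GammaT h.memLp_dt
  have sl := memLp_slice_GammaT h.memLp
  have hBsum : ∀ᵐ t ∂(volume.restrict (Ioo 0 T)), HasSum (fun k => B k t)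
      (2 * ((∫ x in cell, ψ t x ^ 2) + ∫ x in cell, ψt t x ^ 2)) := by
    filter_upwards [sl, slt] with t h1 h2
    exact ((hasSum_fc_sq h1).add (hasSum_fc_sq h2)).mul_left 2
  have hFsum : ∀ᵐ t ∂(volume.restrict (Ioo 0 T)), HasSum (fun k => F k t)
      (∫ x in cell, 2 * (ψ t x * ψt t x)) := by
    filter_upwards [sl, slt] with t h1 h2
    rw [integral_const_mul]
    exact (hasSum_re (hasSum_fc h1 h2)).mul_left 2
  have hBint : IntegrableOn (fun t => ∑' k, B k t) (Ioo 0 T) := by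
    have hi := ((integrableOn_integral_sq h.memLp).add
      (integrableOn_integral_sq h.memLp_dt)).const_mul 2
    refine Integrable.congr hi ?_
    filter_upwards [hBsum] with t ht
    rw [ht.tsum_eq]
    rfl
  have hμ : volume.restrict (Ioo 0 τ) ≤ volume.restrict (Ioo 0 T) :=
    Measure.restrict_mono (Ioo_subset_Ioo_right hτ.2) le_rfl
  have hac := Measure.absolutelyContinuous_of_le hμ
  have hm : ∀ k, AEStronglyMeasurable (F k) (volume.restrict (Ioo 0 T)) := fun k =>
    (continuous_re.comp_aestronglyMeasurable
      ((continuous_conj.comp_aestronglyMeasurable (integrableOn_fc hψ k).1).mul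
        (integrableOn_fc hψt k).1)).const_mul 2
  have main := hasSum_integral_of_dominated_convergence (μ := volume.restrict (Ioo 0 τ))
    (F := F) (f := fun t => ∫ x in cell, 2 * (ψ t x * ψt t x)) B
    (fun k => (hm k).mono_measure hμ)
    (fun k => Filter.Eventually.of_forall fun t => by
      rw [hF, Real.norm_eq_abs, abs_mul, abs_two]
      exact mul_le_mul_of_nonneg_left (norm_conj_mul_le _ _) two_pos.le)
    (hac.ae_le (hBsum.mono fun t ht => ht.summable)) (Integrable.mono_measure hBint hμ)
    (hac.ae_le hFsum)
  have lhs : ∀ t ∈ Icc 0 T, HasSum (fun k => (conj (fc (ψ t) k) * fc (ψ t) k).re)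
      (∫ x in cell, ψ t x ^ 2) := by
    intro t ht
    have e1 := hasSum_re (hasSum_fc (h.memLp_slice hT ht) (h.memLp_slice hT ht))
    simpa only [Complex.ofReal_re, ← pow_two] using e1
  rw [intervalIntegral.integral_of_le hτ.1, integral_Ioc_eq_integral_Ioo]
  refine ((lhs τ hτ).sub (lhs 0 h0)).unique (main.congr_fun fun k => ?_)
  rw [fc_mul_evolution hψt hψt (hprim k) (hprim k) hτ, intervalIntegral.integral_of_le hτ.1,
    integral_Ioc_eq_integral_Ioo]
  congr 1; ext t
  simp only [hF, Complex.add_re, Complex.mul_re, Complex.conj_re, Complex.conj_im]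
  ring

end Velocity

/-! ### Integrability on the plate -/

theorem dot_nonneg {n : ℕ} (a : Fin n → ℝ) : 0 ≤ a ⬝ᵥ a :=
  Finset.sum_nonneg fun _ _ => mul_self_nonneg _

theorem area_le (g : E2) : area g ≤ 1 + g ⬝ᵥ g :=
  Real.sqrt_le_iff.2 ⟨by linarith [dot_nonneg g], by nlinarith [dot_nonneg g]⟩

theorem area_nonneg (g : E2) : 0 ≤ area g := Real.sqrt_nonneg _

theorem continuous_area : Continuous area := by
  unfold area dotProduct; fun_prop

theorem continuous_normal : Continuous normal := by
  refine continuous_pi fun i => ?_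
  fin_cases i <;> simp [normal] <;> fun_prop

theorem normal_dot_self (g : E2) : normal g ⬝ᵥ normal g = 1 + g ⬝ᵥ g := by
  simp [normal, dotProduct, Fin.sum_univ_three]; ring

theorem tang_sub (N v v' : E3) : tang N (v - v') = tang N v - tang N v' := by
  simp only [tang, sub_dotProduct, sub_div, sub_smul]
  abel

/-- Pythagoras. If `N ⬝ᵥ N = 0`, the quotient is zero by convention and `tang N` is the identity. -/
theorem tang_dot_self_le (N v : E3) : tang N v ⬝ᵥ tang N v ≤ v ⬝ᵥ v := by
  rcases eq_or_ne (N ⬝ᵥ N) 0 with h | h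
  · simp [tang, h]
  · have hp : 0 < N ⬝ᵥ N := lt_of_le_of_ne (dot_nonneg N) h.symm
    have : tang N v ⬝ᵥ tang N v = v ⬝ᵥ v - (v ⬝ᵥ N) ^ 2 / (N ⬝ᵥ N) := by
      simp only [tang, sub_dotProduct, dotProduct_sub, smul_dotProduct, dotProduct_smul,
        smul_eq_mul, dotProduct_comm N v]
      field_simp
      ring
    rw [this]
    have : 0 ≤ (v ⬝ᵥ N) ^ 2 / (N ⬝ᵥ N) := by positivity
    linarith

theorem continuous_dot {n : ℕ} : Continuous fun p : (Fin n → ℝ) × (Fin n → ℝ) => p.1 ⬝ᵥ p.2 := by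
  unfold dotProduct; fun_prop

/-- The tangential projection is continuous off `N = 0`. -/
theorem continuous_tang_normal : Continuous fun p : E2 × E3 => tang (normal p.1) p.2 := by
  have h : ∀ g : E2, normal g ⬝ᵥ normal g ≠ 0 := fun g => by
    rw [normal_dot_self]; nlinarith [dot_nonneg g]
  have c1 : Continuous fun p : E2 × E3 => normal p.1 := continuous_normal.comp continuous_fst
  exact continuous_snd.sub (((continuous_dot.comp (continuous_snd.prodMk c1)).div
    (continuous_dot.comp (c1.prodMk c1)) fun p => h p.1).smul c1)

/-- The flat bottom is a graph of slope zero, so the projection there is a special case of the one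
on the moving boundary. -/
theorem normal_zero : normal 0 = e3 := by
  ext i; fin_cases i <;> simp [normal, e3]

theorem continuous_tang_e3 : Continuous (tang e3) := by
  rw [← normal_zero]
  exact continuous_tang_normal.comp (continuous_const.prodMk continuous_id)

theorem State.slip_sub (X : State) (t : ℝ) (x : E2) (v v' : E3) (s s' : ℝ) :
    X.slip t x (v - v') (s - s') = X.slip t x v s - X.slip t x v' s' := by
  rw [State.slip, State.slip, State.slip, ← tang_sub, sub_smul]
  congr 1
  abel

theorem State.aestronglyMeasurable_slip {X : State} {μ : Measure (ℝ × E2)} {v : ℝ × E2 → E3}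
    {s : ℝ × E2 → ℝ} (hg : AEStronglyMeasurable (fun p => X.w.grad p.1 p.2) μ)
    (hv : AEStronglyMeasurable v μ) (hs : AEStronglyMeasurable s μ) :
    AEStronglyMeasurable (fun p => X.slip p.1 p.2 (v p) (s p)) μ :=
  continuous_tang_normal.comp_aestronglyMeasurable (hg.prodMk (hv.sub (hs.smul_const e3)))

theorem State.slip_dot_self_le (X : State) (t : ℝ) (x : E2) (v : E3) (s : ℝ) :
    X.slip t x v s ⬝ᵥ X.slip t x v s ≤ 2 * (v ⬝ᵥ v) + 2 * s ^ 2 := by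
  refine (tang_dot_self_le _ _).trans ?_
  simp only [dotProduct, Fin.sum_univ_three, e3, Pi.sub_apply, Pi.smul_apply, smul_eq_mul]
  simp
  nlinarith [sq_nonneg (v 2 + s), sq_nonneg (v 0), sq_nonneg (v 1)]

theorem abs_dot_le {n : ℕ} (a b : Fin n → ℝ) : |a ⬝ᵥ b| ≤ a ⬝ᵥ a + b ⬝ᵥ b := by
  rw [abs_le]
  have h1 := dot_nonneg (a + b)
  have h2 := dot_nonneg (a - b)
  have h3 := dot_nonneg a
  have h4 := dot_nonneg b
  simp only [add_dotProduct, dotProduct_add, sub_dotProduct, dotProduct_sub,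
    dotProduct_comm b a] at h1 h2
  constructor <;> linarith

/-- A function in `L²(0,T;H²)` times one in `L^∞(0,T;L²)` is square integrable. -/
theorem integrable_sq_mul_sq {T : ℝ} {ψ ψt : ℝ → E2 → ℝ} {ψg : ℝ → E2 → E2}
    {ψh : ℝ → E2 → Fin 2 → Fin 2 → ℝ} (h : IsPlateTest T ψ ψt ψg ψh) {w : PlateFields}
    (hw : w.EnergyClass T) :
    IntegrableOn (fun p : ℝ × E2 => ψ p.1 p.2 ^ 2 * (w.grad p.1 p.2 ⬝ᵥ w.grad p.1 p.2))
      (GammaT T) := by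
  obtain ⟨C, hC⟩ := hw.bound
  have hm : AEStronglyMeasurable (fun p : ℝ × E2 => ψ p.1 p.2 ^ 2 *
      (w.grad p.1 p.2 ⬝ᵥ w.grad p.1 p.2)) (volume.restrict (GammaT T)) :=
    (h.memLp.1.pow 2).mul (continuous_dot.comp_aestronglyMeasurable
      (hw.meas_grad.prodMk hw.meas_grad))
  have hgsq : ∀ t ∈ Icc 0 T, Integrable (fun x => w.grad t x ⬝ᵥ w.grad t x) (volume.restrict cell)
      ∧ ∫ x in cell, w.grad t x ⬝ᵥ w.grad t x ≤ 2 * (C : ℝ) ^ 2 := by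
    intro t ht
    have hg := (hw.memLp_slice t ht).2.1
    have hn := (memLp_two_iff_integrable_sq_norm hg.1).1 hg
    have hi : Integrable (fun x => w.grad t x ⬝ᵥ w.grad t x) (volume.restrict cell) := by
      simp only [dotProduct, Fin.sum_univ_two]
      exact (integrable_mul_of_memLp (memLp_coord hg 0) (memLp_coord hg 0)).add
        (integrable_mul_of_memLp (memLp_coord hg 1) (memLp_coord hg 1))
    refine ⟨hi, ?_⟩
    -- The norm on `E2` is the maximum norm, whence the factor 2.
    have h1 : ∫ x in cell, w.grad t x ⬝ᵥ w.grad t x ≤ ∫ x in cell, 2 * ‖w.grad t x‖ ^ 2 := by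
      refine integral_mono hi (hn.const_mul 2) fun x => ?_
      simp only [dotProduct, Fin.sum_univ_two]
      have a0 := norm_le_pi_norm (w.grad t x) 0
      have a1 := norm_le_pi_norm (w.grad t x) 1
      rw [Real.norm_eq_abs] at a0 a1
      nlinarith [abs_mul_abs_self (w.grad t x 0), abs_mul_abs_self (w.grad t x 1),
        abs_nonneg (w.grad t x 0), abs_nonneg (w.grad t x 1)]
    have h2 : ∫ x in cell, ‖w.grad t x‖ ^ 2 ≤ (C : ℝ) ^ 2 := by
      have h3 := (hC t ht).2.1
      rw [hg.eLpNorm_eq_integral_rpow_norm (by norm_num) (by norm_num)] at h3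
      have h4 : (∫ x in cell, ‖w.grad t x‖ ^ 2) ^ (2⁻¹ : ℝ) ≤ C := by
        have := ENNReal.ofReal_le_iff_le_toReal (by simp) |>.1 h3
        simpa using this
      rw [← one_div, ← Real.sqrt_eq_rpow] at h4
      exact (Real.sqrt_le_iff.1 h4).2
    rw [integral_const_mul] at h1
    linarith
  -- The embedding of H² into L^∞ bounds ψ² at each time by a quantity that is integrable in time,
  -- while the integral of |∇w|² is bounded in time.
  have hb : ∀ᵐ t ∂(volume.restrict (Ioo 0 T)), ∀ᵐ x ∂(volume.restrict cell), ψ t x ^ 2 ≤ eigSum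
      * (2 * ((∫ x in cell, ψ t x ^ 2) + ∫ x in cell, lap (ψh t x) ^ 2)) := by
    filter_upwards [h.weakGrad, h.weakHess, memLp_slice_GammaT h.memLp,
      memLp_slice_GammaT h.memLp_grad, memLp_slice_GammaT h.memLp_hess] with t a1 a2 a3 a4 a5
    exact ae_sq_le a1 a2 a3 a4 a5
  have hbi : Integrable (fun t => eigSum * (2 * ((∫ x in cell, ψ t x ^ 2)
      + ∫ x in cell, lap (ψh t x) ^ 2)) * (2 * (C : ℝ) ^ 2)) (volume.restrict (Ioo 0 T)) :=
    ((((integrableOn_integral_sq h.memLp).add (integrableOn_integral_sq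
      (f := fun t x => lap (ψh t x)) (memLp_lap h.memLp_hess))).const_mul 2).const_mul
      eigSum).mul_const _
  rw [IntegrableOn]
  rw [volume_GammaT] at hm ⊢
  have hnorm : ∀ᵐ t ∂(volume.restrict (Ioo 0 T)), ∀ᵐ x ∂(volume.restrict cell),
      ‖ψ t x ^ 2 * (w.grad t x ⬝ᵥ w.grad t x)‖ ≤ eigSum
      * (2 * ((∫ x in cell, ψ t x ^ 2) + ∫ x in cell, lap (ψh t x) ^ 2))
      * (w.grad t x ⬝ᵥ w.grad t x) := by
    filter_upwards [hb] with t ht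
    filter_upwards [ht] with x hx
    rw [Real.norm_eq_abs, abs_of_nonneg (mul_nonneg (sq_nonneg _) (dot_nonneg _))]
    exact mul_le_mul_of_nonneg_right hx (dot_nonneg _)
  have hsl : ∀ᵐ t ∂(volume.restrict (Ioo 0 T)), Integrable
      (fun x => ψ t x ^ 2 * (w.grad t x ⬝ᵥ w.grad t x)) (volume.restrict cell) := by
    filter_upwards [hnorm, hm.prodMk_left, ae_restrict_mem measurableSet_Ioo] with t h1 h2 ht
    exact Integrable.mono' ((hgsq t (Ioo_subset_Icc_self ht)).1.const_mul _) h2 h1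
  refine (integrable_prod_iff hm).2 ⟨hsl, ?_⟩
  refine Integrable.mono' hbi hm.norm.integral_prod_right' ?_
  filter_upwards [hnorm, hsl, ae_restrict_mem measurableSet_Ioo] with t h1 h2 ht
  have hg := hgsq t (Ioo_subset_Icc_self ht)
  rw [Real.norm_eq_abs, abs_of_nonneg (integral_nonneg fun x => norm_nonneg _)]
  refine (integral_mono_ae h2.norm (hg.1.const_mul _) h1).trans ?_
  rw [integral_const_mul]
  refine mul_le_mul_of_nonneg_left hg.2 (mul_nonneg eigSum_nonneg ?_)
  have a1 : 0 ≤ ∫ x in cell, ψ t x ^ 2 := integral_nonneg fun x => sq_nonneg _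
  have a2 : 0 ≤ ∫ x in cell, lap (ψh t x) ^ 2 := integral_nonneg fun x => sq_nonneg _
  positivity

theorem integrable_dot_of_memLp {α : Type*} [MeasurableSpace α] {μ : Measure α} {f g : α → E2}
    (hf : MemLp f 2 μ) (hg : MemLp g 2 μ) : Integrable (fun x => f x ⬝ᵥ g x) μ := by
  simp only [dotProduct, Fin.sum_univ_two]
  exact (integrable_mul_of_memLp (memLp_coord hf 0) (memLp_coord hg 0)).add
    (integrable_mul_of_memLp (memLp_coord hf 1) (memLp_coord hg 1))

/-- The cross term is dominated by the two squares. The coefficient `c` stays in the hypothesis on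
`a`: friction coefficients may vanish, and finite dissipation controls the slip of the solution only
together with its coefficient. -/
theorem integrable_weighted_dot {α : Type*} [MeasurableSpace α] {μ : Measure α} {c : ℝ} (hc : 0 ≤ c)
    {a b : α → E3} {A : α → ℝ} (hA : ∀ x, 0 ≤ A x) (ha : AEStronglyMeasurable a μ)
    (hb : AEStronglyMeasurable b μ) (hAm : AEStronglyMeasurable A μ)
    (haa : Integrable (fun x => c * (a x ⬝ᵥ a x) * A x) μ)
    (hbb : Integrable (fun x => (b x ⬝ᵥ b x) * A x) μ) :
    Integrable (fun x => c * (a x ⬝ᵥ b x) * A x) μ := by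
  refine Integrable.mono' (haa.add (hbb.const_mul c))
    (((continuous_dot.comp_aestronglyMeasurable (ha.prodMk hb)).const_mul c).mul hAm)
    (Filter.Eventually.of_forall fun x => ?_)
  simp only [Pi.add_apply]
  rw [Real.norm_eq_abs, abs_mul, abs_mul, abs_of_nonneg hc, abs_of_nonneg (hA x)]
  have h1 := mul_le_mul_of_nonneg_right (mul_le_mul_of_nonneg_left (abs_dot_le (a x) (b x)) hc)
    (hA x)
  linarith

theorem integrable_weighted_sub_dot {α : Type*} [MeasurableSpace α] {μ : Measure α} {c : ℝ}
    (hc : 0 ≤ c) {a b : α → E3} {A : α → ℝ} (hA : ∀ x, 0 ≤ A x) (ha : AEStronglyMeasurable a μ)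
    (hb : AEStronglyMeasurable b μ) (hAm : AEStronglyMeasurable A μ)
    (haa : Integrable (fun x => c * (a x ⬝ᵥ a x) * A x) μ)
    (hbb : Integrable (fun x => (b x ⬝ᵥ b x) * A x) μ) :
    Integrable (fun x => c * ((a x - b x) ⬝ᵥ (a x - b x)) * A x) μ := by
  refine ((haa.sub ((integrable_weighted_dot hc hA ha hb hAm haa hbb).const_mul 2)).add
    (hbb.const_mul c)).congr (Filter.Eventually.of_forall fun x => ?_)
  simp only [Pi.add_apply, Pi.sub_apply, sub_dotProduct, dotProduct_sub, dotProduct_comm (b x)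
    (a x)]
  ring

/-! ### The plate terms of the relative energy inequality -/

section PlateTerms

variable {P : Params} {D : InitialData} {K : Set (ℝ → E2 → ℝ)} {X : State}
  {U : ℝ → E3 → E3} {W : TestPlate}

theorem IsWeakSolution.exists_height_bound (hX : IsWeakSolution P D K X) :
    ∃ M > 0, ∀ t ∈ Icc 0 P.T, ∀ x, |1 + X.w.val t x| ≤ M :=
  FSI.exists_height_bound hX.w_cont hX.w_class.periodic

theorem IsWeakSolution.aestronglyMeasurable_top (hX : IsWeakSolution P D K X) {β : Type*}
    [TopologicalSpace β] {F : ℝ → E3 → β} (hF : Continuous fun p : ℝ × E3 => F p.1 p.2) :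
    AEStronglyMeasurable (fun p : ℝ × E2 => F p.1 (Phi X.w.val p.1 p.2))
      (volume.restrict (GammaT P.T)) := by
  have h1 : Continuous fun q : (ℝ × E2) × ℝ => F q.1.1 (pt q.1.2 (1 + q.2)) :=
    hF.comp (f := fun q : (ℝ × E2) × ℝ => (q.1.1, pt q.1.2 (1 + q.2)))
      ((by fun_prop : Continuous fun q : (ℝ × E2) × ℝ => q.1.1).prodMk
      (continuous_pt.comp (by fun_prop : Continuous fun q : (ℝ × E2) × ℝ => (q.1.2, 1 + q.2))))
  exact h1.comp_aestronglyMeasurable (aestronglyMeasurable_id.prodMk hX.w_class.meas_val)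

theorem IsWeakSolution.exists_bound_top (hX : IsWeakSolution P D K X) {β : Type*}
    [NormedAddCommGroup β] {F : ℝ → E3 → β} (hF : Continuous fun p : ℝ × E3 => F p.1 p.2) :
    ∃ C, ∀ p ∈ GammaT P.T, ‖F p.1 (Phi X.w.val p.1 p.2)‖ ≤ C := by
  obtain ⟨M, -, hM⟩ := hX.exists_height_bound
  obtain ⟨C, hC⟩ := ((isCompact_Icc (a := 0) (b := P.T)).prod
    (isCompact_box M)).exists_bound_of_continuousOn hF.continuousOn
  refine ⟨C, fun p hp => hC (p.1, Phi X.w.val p.1 p.2) ⟨Ioo_subset_Icc_self hp.1, ?_⟩⟩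
  have h1 := Ioo_subset_Icc_self hp.1
  exact pt_mem_box (cell_subset_Icc hp.2) ⟨by linarith [hX.w_gt _ h1 p.2],
    (le_abs_self _).trans (hM _ h1 _)⟩

theorem IsWeakSolution.integrable_top_mul (hX : IsWeakSolution P D K X) {F : ℝ → E3 → ℝ}
    (hF : Continuous fun p : ℝ × E3 => F p.1 p.2) {f : ℝ × E2 → ℝ}
    (hf : IntegrableOn f (GammaT P.T)) :
    IntegrableOn (fun p : ℝ × E2 => F p.1 (Phi X.w.val p.1 p.2) * f p) (GammaT P.T) := by
  obtain ⟨C, hC⟩ := hX.exists_bound_top hF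
  refine Integrable.bdd_mul (c := C) hf (hX.aestronglyMeasurable_top hF) ?_
  filter_upwards [ae_restrict_mem (measurableSet_GammaT P.T)] with p hp using hC p hp

theorem integrableOn_GammaT_bottom {T : ℝ} {F : ℝ → E3 → ℝ}
    (hF : Continuous fun p : ℝ × E3 => F p.1 p.2) :
    IntegrableOn (fun p : ℝ × E2 => F p.1 (pt p.2 0)) (GammaT T) := by
  have h1 : Continuous fun p : ℝ × E2 => F p.1 (pt p.2 0) :=
    hF.comp (f := fun p : ℝ × E2 => (p.1, pt p.2 0)) (continuous_fst.prodMk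
      (continuous_pt.comp (by fun_prop : Continuous fun p : ℝ × E2 => (p.2, (0 : ℝ)))))
  exact (h1.continuousOn.integrableOn_compact (isCompact_Icc.prod isCompact_Icc)).mono_set
    (prod_mono Ioo_subset_Icc_self cell_subset_Icc)

theorem slip_term_nonneg (P : Params) (X : State) (t : ℝ) (x : E2) :
    0 ≤ P.α * P.ν * (X.slip t x (X.uTop t x) (X.w.vel t x)
      ⬝ᵥ X.slip t x (X.uTop t x) (X.w.vel t x)) * area (X.w.grad t x) :=
  mul_nonneg (mul_nonneg (mul_nonneg P.α_nonneg P.ν_pos.le) (dot_nonneg _)) (area_nonneg _)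

theorem bottom_term_nonneg (P : Params) (X : State) (t : ℝ) (x : E2) :
    0 ≤ P.α₀ * P.ν * (tang e3 (X.uBot t x) ⬝ᵥ tang e3 (X.uBot t x)) :=
  mul_nonneg (mul_nonneg P.α₀_nonneg P.ν_pos.le) (dot_nonneg _)

theorem damping_term_nonneg (P : Params) (X : State) (t : ℝ) (x : E2) :
    0 ≤ P.νs * (X.w.velGrad t x ⬝ᵥ X.w.velGrad t x) :=
  mul_nonneg P.νs_nonneg (dot_nonneg _)

theorem plateDissipation_nonneg (P : Params) (X : State) (t : ℝ) (x : E2) :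
    0 ≤ plateDissipation P X t x :=
  add_nonneg (add_nonneg (slip_term_nonneg P X t x) (bottom_term_nonneg P X t x))
    (damping_term_nonneg P X t x)

theorem IsWeakSolution.aesm_area (hX : IsWeakSolution P D K X) :
    AEStronglyMeasurable (fun p : ℝ × E2 => area (X.w.grad p.1 p.2))
      (volume.restrict (GammaT P.T)) :=
  continuous_area.comp_aestronglyMeasurable hX.w_class.meas_grad

theorem IsWeakSolution.aesm_slip (hX : IsWeakSolution P D K X) :
    AEStronglyMeasurable (fun p : ℝ × E2 => X.slip p.1 p.2 (X.uTop p.1 p.2) (X.w.vel p.1 p.2))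
      (volume.restrict (GammaT P.T)) :=
  State.aestronglyMeasurable_slip hX.w_class.meas_grad hX.uTop_int.1 hX.w_class.vel_memLp.1

theorem IsWeakSolution.aesm_bottom (hX : IsWeakSolution P D K X) :
    AEStronglyMeasurable (fun p : ℝ × E2 => tang e3 (X.uBot p.1 p.2))
      (volume.restrict (GammaT P.T)) :=
  continuous_tang_e3.comp_aestronglyMeasurable hX.uBot_int.1

theorem IsWeakSolution.integrable_slip (hX : IsWeakSolution P D K X) :
    IntegrableOn (fun p : ℝ × E2 => P.α * P.ν * (X.slip p.1 p.2 (X.uTop p.1 p.2) (X.w.vel p.1 p.2)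
      ⬝ᵥ X.slip p.1 p.2 (X.uTop p.1 p.2) (X.w.vel p.1 p.2)) * area (X.w.grad p.1 p.2))
      (GammaT P.T) := by
  refine Integrable.mono' hX.plate_int (((continuous_dot.comp_aestronglyMeasurable
    (hX.aesm_slip.prodMk hX.aesm_slip)).const_mul _).mul hX.aesm_area)
    (Filter.Eventually.of_forall fun p => ?_)
  rw [Real.norm_eq_abs, abs_of_nonneg (slip_term_nonneg P X p.1 p.2)]
  exact (le_add_of_nonneg_right (bottom_term_nonneg P X p.1 p.2)).trans
    (le_add_of_nonneg_right (damping_term_nonneg P X p.1 p.2))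

theorem IsWeakSolution.integrable_bottom (hX : IsWeakSolution P D K X) :
    IntegrableOn (fun p : ℝ × E2 => P.α₀ * P.ν * (tang e3 (X.uBot p.1 p.2)
      ⬝ᵥ tang e3 (X.uBot p.1 p.2))) (GammaT P.T) := by
  refine Integrable.mono' hX.plate_int ((continuous_dot.comp_aestronglyMeasurable
    (hX.aesm_bottom.prodMk hX.aesm_bottom)).const_mul _)
    (Filter.Eventually.of_forall fun p => ?_)
  rw [Real.norm_eq_abs, abs_of_nonneg (bottom_term_nonneg P X p.1 p.2)]
  exact (le_add_of_nonneg_left (slip_term_nonneg P X p.1 p.2)).trans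
    (le_add_of_nonneg_right (damping_term_nonneg P X p.1 p.2))

/-- The area factor is unbounded, but at most 1 + |∇w|². For the bounded field `U` integrability of
|∇w|² suffices; the square of the plate velocity times |∇w|² is the case of `integrable_sq_mul_sq`.
-/
theorem IsWeakSolution.integrable_test_slip (hX : IsWeakSolution P D K X)
    (hU : Continuous fun p : ℝ × E3 => U p.1 p.2) (hW : W.Admissible P.T K) :
    IntegrableOn (fun p : ℝ × E2 => (X.slip p.1 p.2 (U p.1 (Phi X.w.val p.1 p.2))
        (W.fields.vel p.1 p.2) ⬝ᵥ X.slip p.1 p.2 (U p.1 (Phi X.w.val p.1 p.2))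
        (W.fields.vel p.1 p.2)) * area (X.w.grad p.1 p.2)) (GammaT P.T) := by
  have hg := integrable_dot_of_memLp hX.w_class.grad_memLp hX.w_class.grad_memLp
  have hg1 : IntegrableOn (fun p : ℝ × E2 => 1 + X.w.grad p.1 p.2 ⬝ᵥ X.w.grad p.1 p.2)
    (GammaT P.T) := (integrable_const (1 : ℝ)).add hg
  have hUU : Continuous fun p : ℝ × E3 => U p.1 p.2 ⬝ᵥ U p.1 p.2 :=
    continuous_dot.comp (hU.prodMk hU)
  have h1 := hX.integrable_top_mul (F := fun t y => U t y ⬝ᵥ U t y) hUU hg1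
  have h2 := hW.vel_test.memLp.integrable_sq
  have h3 := integrable_sq_mul_sq hW.vel_test hX.w_class
  have hs := State.aestronglyMeasurable_slip hX.w_class.meas_grad (hX.aestronglyMeasurable_top hU)
    hW.vel_test.memLp.1
  refine Integrable.mono' (((h1.const_mul 2).add (h2.const_mul 2)).add (h3.const_mul 2))
    ((continuous_dot.comp_aestronglyMeasurable (hs.prodMk hs)).mul hX.aesm_area)
    (Filter.Eventually.of_forall fun p => ?_)
  rw [Real.norm_eq_abs, abs_of_nonneg (mul_nonneg (dot_nonneg _) (area_nonneg _))]
  refine (mul_le_mul (X.slip_dot_self_le _ _ _ _) (area_le _) (area_nonneg _) ?_).trans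
    (le_of_eq ?_)
  · exact add_nonneg (mul_nonneg two_pos.le (dot_nonneg _)) (by positivity)
  · simp only [Pi.add_apply]; ring

theorem IsWeakSolution.integrable_relPlateDissipation (hX : IsWeakSolution P D K X)
    (hU : Continuous fun p : ℝ × E3 => U p.1 p.2) (hW : W.Admissible P.T K) :
    IntegrableOn (fun p : ℝ × E2 => relPlateDissipation P X U W p.1 p.2) (GammaT P.T) := by
  have hs := State.aestronglyMeasurable_slip hX.w_class.meas_grad (hX.aestronglyMeasurable_top hU)
    hW.vel_test.memLp.1
  have h1 := integrable_weighted_sub_dot (mul_nonneg P.α_nonneg P.ν_pos.le)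
    (fun p : ℝ × E2 => area_nonneg (X.w.grad p.1 p.2)) hX.aesm_slip hs hX.aesm_area
    hX.integrable_slip (hX.integrable_test_slip hU hW)
  have hUb : Continuous fun p : ℝ × E3 => tang e3 (U p.1 p.2) := continuous_tang_e3.comp hU
  have hub : AEStronglyMeasurable (fun p : ℝ × E2 => tang e3 (U p.1 (pt p.2 0)))
      (volume.restrict (GammaT P.T)) :=
    (hUb.comp (continuous_fst.prodMk (continuous_pt.comp
      (by fun_prop : Continuous fun p : ℝ × E2 => (p.2, (0 : ℝ)))))).aestronglyMeasurable
  have hbb := integrableOn_GammaT_bottom (T := P.T)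
    (F := fun t y => tang e3 (U t y) ⬝ᵥ tang e3 (U t y)) (continuous_dot.comp (hUb.prodMk hUb))
  have h2 := integrable_weighted_sub_dot (A := fun _ => 1) (mul_nonneg P.α₀_nonneg P.ν_pos.le)
    (fun _ => zero_le_one) hX.aesm_bottom hub aestronglyMeasurable_const
    (by simpa only [mul_one, IntegrableOn] using hX.integrable_bottom)
    (by simpa only [mul_one, IntegrableOn] using hbb)
  have hvg := hX.w_class.velGrad_memLp.sub hW.energyClass.velGrad_memLp
  have h3 := (integrable_dot_of_memLp hvg hvg).const_mul P.νs
  refine ((h1.add h2).add h3).congr (Filter.Eventually.of_forall fun p => ?_)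
  simp only [Pi.add_apply, relPlateDissipation, State.slip_sub, tang_sub, mul_one]
  rfl

theorem IsWeakSolution.integrable_momentumPlate (hX : IsWeakSolution P D K X)
    (hU : Continuous fun p : ℝ × E3 => U p.1 p.2) (hW : W.Admissible P.T K) :
    IntegrableOn (fun p : ℝ × E2 => momentumPlate P X U W.fields.vel W.acc W.fields.velGrad
      W.velHess p.1 p.2) (GammaT P.T) := by
  have hs := State.aestronglyMeasurable_slip hX.w_class.meas_grad (hX.aestronglyMeasurable_top hU)
    hW.vel_test.memLp.1
  have h1 := integrable_weighted_dot (mul_nonneg P.α_nonneg P.ν_pos.le)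
    (fun p : ℝ × E2 => area_nonneg (X.w.grad p.1 p.2)) hX.aesm_slip hs hX.aesm_area
    hX.integrable_slip (hX.integrable_test_slip hU hW)
  have hUb : Continuous fun p : ℝ × E3 => tang e3 (U p.1 p.2) := continuous_tang_e3.comp hU
  have hub : AEStronglyMeasurable (fun p : ℝ × E2 => tang e3 (U p.1 (pt p.2 0)))
      (volume.restrict (GammaT P.T)) :=
    (hUb.comp (continuous_fst.prodMk (continuous_pt.comp
      (by fun_prop : Continuous fun p : ℝ × E2 => (p.2, (0 : ℝ)))))).aestronglyMeasurable
  have hbb := integrableOn_GammaT_bottom (T := P.T)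
    (F := fun t y => tang e3 (U t y) ⬝ᵥ tang e3 (U t y)) (continuous_dot.comp (hUb.prodMk hUb))
  have h2 := integrable_weighted_dot (A := fun _ => 1) (mul_nonneg P.α₀_nonneg P.ν_pos.le)
    (fun _ => zero_le_one) hX.aesm_bottom hub aestronglyMeasurable_const
    (by simpa only [mul_one, IntegrableOn] using hX.integrable_bottom)
    (by simpa only [mul_one, IntegrableOn] using hbb)
  have h3 := (integrable_dot_of_memLp hX.w_class.velGrad_memLp
    hW.vel_test.memLp_grad).const_mul P.νs
  have h4 := integrable_mul_of_memLp hX.w_class.vel_memLp hW.vel_test.memLp_dt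
  have h5 := integrable_mul_of_memLp (memLp_lap hX.w_class.hess_memLp)
    (memLp_lap hW.vel_test.memLp_hess)
  refine ((((h4.sub h5).sub h3).sub h1).sub h2).congr (Filter.Eventually.of_forall fun p => ?_)
  simp only [Pi.sub_apply, momentumPlate, mul_one]

/-- Bilinear algebra only, grouped so that each summand has a known integral: the dissipations, the
weak momentum equation, the four groups evaluated in `plate_work`, and the pressure work on the
moving boundary. -/
theorem plate_identity (P : Params) (X : State) (r : ℝ → E3 → ℝ) (U : ℝ → E3 → E3)
    (W : TestPlate) (t : ℝ) (x : E2) :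
    remainderPlate P X r U W t x = relPlateDissipation P X U W t x
      - plateDissipation P X t x
      - momentumPlate P X U W.fields.vel W.acc W.fields.velGrad W.velHess t x
      + W.fields.vel t x * W.acc t x
      - (lap (X.w.hess t x) * lap (W.velHess t x) - X.w.velGrad t x ⬝ᵥ W.gradLap t x)
      - W.fields.velGrad t x ⬝ᵥ W.gradLap t x
      + P.νs * ((X.w.velGrad t x - W.fields.velGrad t x) ⬝ᵥ W.fields.velGrad t x
        + (X.w.vel t x - W.fields.vel t x) * lap (W.velHess t x))
      + 1 / P.ε ^ 2 * ((P.p (r t (Phi X.w.val t x)) - P.p P.ρbar) *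
        ((X.uTop t x - U t (Phi X.w.val t x)) ⬝ᵥ X.nrm t x)) := by
  simp only [remainderPlate, relPlateDissipation, plateDissipation, momentumPlate, State.slip_sub,
    tang_sub, sub_dotProduct, dotProduct_sub, dotProduct_comm (W.gradLap t x),
    dotProduct_comm (W.fields.velGrad t x) (X.w.velGrad t x),
    dotProduct_comm (X.slip t x (U t (Phi X.w.val t x)) (W.fields.vel t x))
      (X.slip t x (X.uTop t x) (X.w.vel t x)),
    dotProduct_comm (tang e3 (U t (pt x 0))) (tang e3 (X.uBot t x))]
  ring

end PlateTerms

/-! ### Densities and momenta of finite energy -/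

section FiniteEnergy

theorem Params.ε_sq_pos (P : Params) : 0 < P.ε ^ 2 := pow_pos P.ε_pos 2

theorem Params.γ_sub_pos (P : Params) : 0 < P.γ - 1 := sub_pos.2 P.γ_gt

theorem Params.γ_pos (P : Params) : 0 < P.γ := zero_lt_one.trans P.γ_gt

theorem Params.p_nonneg (P : Params) {s : ℝ} (hs : 0 ≤ s) : 0 ≤ P.p s := Real.rpow_nonneg hs _

theorem Params.continuous_p (P : Params) : Continuous P.p :=
  Real.continuous_rpow_const P.γ_pos.le

theorem Params.le_one_add_p (P : Params) {s : ℝ} (hs : 0 ≤ s) : s ≤ 1 + P.p s := by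
  rcases le_total s 1 with h | h
  · linarith [P.p_nonneg hs]
  · have := Real.rpow_le_rpow_of_exponent_le h P.γ_gt.le
    rw [Real.rpow_one] at this
    exact this.trans (le_add_of_nonneg_left zero_le_one)

/-- Essentially bounded measurable functions. -/
structure BddMeas {α : Type*} [MeasurableSpace α] (μ : Measure α) (g : α → ℝ) : Prop where
  meas : AEStronglyMeasurable g μ
  bdd : ∃ C, ∀ᵐ x ∂μ, ‖g x‖ ≤ C

theorem Integrable.mul_bddMeas {α : Type*} [MeasurableSpace α] {μ : Measure α} {f g : α → ℝ}
    (hf : Integrable f μ) (hg : BddMeas μ g) : Integrable (fun x => f x * g x) μ := by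
  obtain ⟨C, hC⟩ := hg.bdd
  exact Integrable.mul_bdd (c := C) hf hg.meas hC

theorem BddMeas.integrable {α : Type*} [MeasurableSpace α] {μ : Measure α} [IsFiniteMeasure μ]
    {g : α → ℝ} (hg : BddMeas μ g) : Integrable g μ := by
  obtain ⟨C, hC⟩ := hg.bdd
  exact Integrable.of_bound hg.meas C hC

/-- A density and a velocity with finite internal and kinetic energy. -/
structure FiniteEnergy (P : Params) {α : Type*} [MeasurableSpace α] (μ : Measure α) (ρ : α → ℝ)
    (u : α → E3) : Prop where
  finite : μ univ < ⊤
  nonneg : ∀ x, 0 ≤ ρ x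
  meas_ρ : AEStronglyMeasurable ρ μ
  meas_u : AEStronglyMeasurable u μ
  pressure : Integrable (fun x => P.p (ρ x)) μ
  kinetic : Integrable (fun x => ρ x * (u x ⬝ᵥ u x)) μ

namespace FiniteEnergy

variable {P : Params} {α : Type*} [MeasurableSpace α] {μ : Measure α} {ρ : α → ℝ} {u : α → E3}

theorem isFiniteMeasure (h : FiniteEnergy P μ ρ u) : IsFiniteMeasure μ := ⟨h.finite⟩

theorem meas_coord (h : FiniteEnergy P μ ρ u) (i : Fin 3) :
    AEStronglyMeasurable (fun x => u x i) μ :=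
  (continuous_apply i).comp_aestronglyMeasurable h.meas_u

theorem density (h : FiniteEnergy P μ ρ u) : Integrable ρ μ := by
  have := h.isFiniteMeasure
  refine Integrable.mono' ((integrable_const (1 : ℝ)).add h.pressure) h.meas_ρ
    (Filter.Eventually.of_forall fun x => ?_)
  rw [Real.norm_eq_abs, abs_of_nonneg (h.nonneg x)]
  exact P.le_one_add_p (h.nonneg x)

theorem momentum (h : FiniteEnergy P μ ρ u) (i : Fin 3) : Integrable (fun x => ρ x * u x i) μ := by
  refine Integrable.mono' (h.density.add h.kinetic) (h.meas_ρ.mul (h.meas_coord i))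
    (Filter.Eventually.of_forall fun x => ?_)
  have h1 : u x i * u x i ≤ u x ⬝ᵥ u x :=
    Finset.single_le_sum (f := fun i => u x i * u x i) (fun j _ => mul_self_nonneg _)
      (Finset.mem_univ i)
  have h2 : |u x i| ≤ 1 + u x ⬝ᵥ u x := by
    rw [abs_le]; constructor <;> nlinarith [mul_self_nonneg (u x i - 1), mul_self_nonneg (u x i +
      1)]
  rw [Real.norm_eq_abs, abs_mul, abs_of_nonneg (h.nonneg x)]
  have := mul_le_mul_of_nonneg_left h2 (h.nonneg x)
  simp only [Pi.add_apply]
  linarith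

theorem convection (h : FiniteEnergy P μ ρ u) (i j : Fin 3) :
    Integrable (fun x => ρ x * (u x i * u x j)) μ := by
  refine Integrable.mono' (h.kinetic.add h.kinetic)
    (h.meas_ρ.mul ((h.meas_coord i).mul (h.meas_coord j)))
    (Filter.Eventually.of_forall fun x => ?_)
  have h1 : ∀ i, u x i * u x i ≤ u x ⬝ᵥ u x := fun i =>
    Finset.single_le_sum (f := fun i => u x i * u x i) (fun j _ => mul_self_nonneg _)
      (Finset.mem_univ i)
  have h2 : |u x i * u x j| ≤ u x ⬝ᵥ u x + u x ⬝ᵥ u x := by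
    have a := h1 i
    have b := h1 j
    rw [abs_le]; constructor <;>
      nlinarith [mul_self_nonneg (u x i - u x j), mul_self_nonneg (u x i + u x j)]
  rw [Real.norm_eq_abs, abs_mul, abs_of_nonneg (h.nonneg x)]
  have := mul_le_mul_of_nonneg_left h2 (h.nonneg x)
  simp only [Pi.add_apply]
  linarith

theorem momentum_dot (h : FiniteEnergy P μ ρ u) {V : α → E3} (hV : ∀ i, BddMeas μ fun x => V x i) :
    Integrable (fun x => ρ x * (u x ⬝ᵥ V x)) μ := by
  refine (integrable_finsetSum Finset.univ fun i _ =>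
    Integrable.mul_bddMeas (h.momentum i) (hV i)).congr (Filter.Eventually.of_forall fun x => ?_)
  simp only [dotProduct, Finset.mul_sum, mul_assoc]

theorem convection_dot (h : FiniteEnergy P μ ρ u) {A : α → Fin 3 → Fin 3 → ℝ}
    (hA : ∀ i j, BddMeas μ fun x => A x i j) :
    Integrable (fun x => ρ x * (u x ⬝ᵥ advect (u x) (A x))) μ := by
  refine (integrable_finsetSum Finset.univ fun i _ => integrable_finsetSum Finset.univ fun j _ =>
    Integrable.mul_bddMeas (h.convection i j) (hA i j)).congr
    (Filter.Eventually.of_forall fun x => ?_)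
  simp only [dotProduct, advect, Finset.mul_sum, mul_assoc]

theorem fluidEnergy (h : FiniteEnergy P μ ρ u) :
    Integrable (fun x => fluidEnergy P (ρ x) (u x)) μ := by
  have := h.isFiniteMeasure
  refine ((h.kinetic.const_mul (1 / 2)).add (((h.pressure.div_const (P.γ - 1)).add
    (integrable_const (P.p P.ρbar))).const_mul (1 / P.ε ^ 2))).congr
    (Filter.Eventually.of_forall fun x => ?_)
  simp only [Pi.add_apply, FSI.fluidEnergy]
  ring

end FiniteEnergy

/-- The relative energy as the energy plus terms that are affine in the density and the
momentum. -/
theorem relFluid_eq (P : Params) (ρ : ℝ) (u : E3) {r : ℝ} (hr : 0 < r) (U : E3) :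
    relFluid P ρ u r U = fluidEnergy P ρ u - ρ * (u ⬝ᵥ U) + ρ * (1 / 2 * (U ⬝ᵥ U))
      - 1 / (P.ε ^ 2 * (P.γ - 1)) * (ρ * P.p' r) + 1 / P.ε ^ 2 * (P.p r - P.p P.ρbar) := by
  -- Homogeneity of the pressure: p'(r) r - p(r) = (γ - 1) p(r), which cancels the denominator γ - 1
  -- in the term free of ρ.
  have h1 : P.p' r * r = P.γ * P.p r := by
    rw [Params.p', Params.p, mul_assoc, ← Real.rpow_add_one hr.ne', sub_add_cancel]
  have h2 := P.γ_sub_pos.ne'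
  have h3 := P.ε_sq_pos.ne'
  have h4 := P.ε_pos.ne'
  simp only [relFluid, fluidEnergy, sub_dotProduct, dotProduct_sub, dotProduct_comm U u, mul_sub,
    h1]
  field_simp
  ring

theorem FiniteEnergy.relFluid {P : Params} {α : Type*} [MeasurableSpace α] {μ : Measure α}
    {ρ : α → ℝ} {u : α → E3} (h : FiniteEnergy P μ ρ u) {r : α → ℝ} {U : α → E3}
    (hr : ∀ᵐ x ∂μ, 0 < r x) (hU : ∀ i, BddMeas μ fun x => U x i)
    (hUU : BddMeas μ fun x => 1 / 2 * (U x ⬝ᵥ U x)) (hp' : BddMeas μ fun x => P.p' (r x))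
    (hp : BddMeas μ fun x => P.p (r x) - P.p P.ρbar) :
    Integrable (fun x => relFluid P (ρ x) (u x) (r x) (U x)) μ ∧
    ∫ x, relFluid P (ρ x) (u x) (r x) (U x) ∂μ = (∫ x, FSI.fluidEnergy P (ρ x) (u x) ∂μ)
      - (∫ x, ρ x * (u x ⬝ᵥ U x) ∂μ) + (∫ x, ρ x * (1 / 2 * (U x ⬝ᵥ U x)) ∂μ)
      - 1 / (P.ε ^ 2 * (P.γ - 1)) * (∫ x, ρ x * P.p' (r x) ∂μ)
      + 1 / P.ε ^ 2 * ∫ x, (P.p (r x) - P.p P.ρbar) ∂μ := by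
  have := h.isFiniteMeasure
  have i0 := h.fluidEnergy
  have i1 := h.momentum_dot hU
  have i2 := Integrable.mul_bddMeas h.density hUU
  have i3 := (Integrable.mul_bddMeas h.density hp').const_mul (1 / (P.ε ^ 2 * (P.γ - 1)))
  have i4 := hp.integrable.const_mul (1 / P.ε ^ 2)
  have e : (fun x => FSI.relFluid P (ρ x) (u x) (r x) (U x)) =ᵐ[μ] fun x =>
      (FSI.fluidEnergy P (ρ x) (u x) - ρ x * (u x ⬝ᵥ U x) + ρ x * (1 / 2 * (U x ⬝ᵥ U x))
      - 1 / (P.ε ^ 2 * (P.γ - 1)) * (ρ x * P.p' (r x)))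
      + 1 / P.ε ^ 2 * (P.p (r x) - P.p P.ρbar) := by
    filter_upwards [hr] with x hx using relFluid_eq P _ _ hx _
  have j1 : Integrable (fun x => FSI.fluidEnergy P (ρ x) (u x) - ρ x * (u x ⬝ᵥ U x)) μ := i0.sub i1
  have j2 : Integrable (fun x => FSI.fluidEnergy P (ρ x) (u x) - ρ x * (u x ⬝ᵥ U x)
      + ρ x * (1 / 2 * (U x ⬝ᵥ U x))) μ := j1.add i2
  have j3 : Integrable (fun x => FSI.fluidEnergy P (ρ x) (u x) - ρ x * (u x ⬝ᵥ U x)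
      + ρ x * (1 / 2 * (U x ⬝ᵥ U x)) - 1 / (P.ε ^ 2 * (P.γ - 1)) * (ρ x * P.p' (r x))) μ :=
    j2.sub i3
  refine ⟨(j3.add i4).congr e.symm, ?_⟩
  rw [integral_congr_ae e, integral_add j3 i4, integral_sub j2 i3, integral_add j1 i2,
    integral_sub i0 i1, integral_const_mul, integral_const_mul]

end FiniteEnergy

/-! ### Integrability in the moving domain -/

section Fluid

theorem frob_S_nonneg (P : Params) (A : Fin 3 → Fin 3 → ℝ) : 0 ≤ frob (P.S A) A := by
  -- Shear part, trace-free diagonal part and trace; the coefficient of the squared trace is λ +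
  -- 2μ/3.
  have h : frob (P.S A) A = P.μ * ((A 0 1 + A 1 0) ^ 2 + (A 0 2 + A 2 0) ^ 2 + (A 1 2 + A 2 1) ^ 2)
      + 2 * P.μ / 3 * ((A 0 0 - A 1 1) ^ 2 + (A 0 0 - A 2 2) ^ 2 + (A 1 1 - A 2 2) ^ 2)
      + (P.lam + 2 * P.μ / 3) * (A 0 0 + A 1 1 + A 2 2) ^ 2 := by
    simp [frob, Params.S, tr3, Fin.sum_univ_three]
    ring
  rw [h]
  have := P.μ_pos
  have := P.lam_ge
  positivity

theorem integrableOn_QT_of_bound {w : ℝ → E2 → ℝ} {T : ℝ}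
    (hw : ContinuousOn (fun p : ℝ × E2 => w p.1 p.2) (Icc 0 T ×ˢ univ)) {f : ℝ × E3 → ℝ}
    (hf : AEStronglyMeasurable f (volume.restrict (QT w T))) (hf0 : ∀ p, 0 ≤ f p) {C : ℝ≥0}
    (hC : ∀ᵐ t ∂(volume.restrict (Ioo 0 T)), ∫⁻ y in Omega w t, ENNReal.ofReal (f (t, y)) ≤ C) :
    IntegrableOn f (QT w T) := by
  refine ⟨hf, (hasFiniteIntegral_iff_ofReal (Filter.Eventually.of_forall hf0)).2 ?_⟩
  rw [lintegral_QT hw hf.aemeasurable.ennreal_ofReal]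
  refine (lintegral_mono_ae hC).trans_lt ?_
  simp only [lintegral_const, Measure.restrict_apply MeasurableSet.univ, univ_inter,
    Real.volume_Ioo]
  exact ENNReal.mul_lt_top (by simp) (by simp)

variable {P : Params} {D : InitialData} {K : Set (ℝ → E2 → ℝ)} {X : State}

theorem volume_Omega_lt_top {w : ℝ → E2 → ℝ} {T M : ℝ} (hM : ∀ t ∈ Icc 0 T, ∀ x, |1 + w t x| ≤ M)
    {t : ℝ} (ht : t ∈ Icc 0 T) : volume (Omega w t) < ⊤ :=
  volume_subgraph_lt_top fun x => (le_abs_self _).trans (hM t ht x)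

theorem integrable_p_of_memLp {P : Params} {μ : Measure E3} {ρ : E3 → ℝ} (h0 : ∀ y, 0 ≤ ρ y)
    (h : MemLp ρ (ENNReal.ofReal P.γ) μ) : Integrable (fun y => P.p (ρ y)) μ := by
  have h1 := h.integrable_norm_rpow (by simpa using P.γ_pos) (by simp)
  refine h1.congr (Filter.Eventually.of_forall fun y => ?_)
  simp only [Params.p, Real.norm_eq_abs, abs_of_nonneg (h0 y), ENNReal.toReal_ofReal P.γ_pos.le]

theorem IsWeakSolution.aesm_kinetic (hX : IsWeakSolution P D K X) :
    AEStronglyMeasurable (fun p : ℝ × E3 => X.ρ p.1 p.2 * (X.u p.1 p.2 ⬝ᵥ X.u p.1 p.2))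
      (volume.restrict (QT X.w.val P.T)) :=
  hX.ρ_meas.mul (continuous_dot.comp_aestronglyMeasurable (hX.u_meas.prodMk hX.u_meas))

theorem IsWeakSolution.finiteEnergy_init (hX : IsWeakSolution P D K X) :
    FiniteEnergy P (volume.restrict (X.dom 0)) D.ρ₀ D.u₀ := by
  obtain ⟨M, -, hM⟩ := hX.exists_height_bound
  exact ⟨by simpa using volume_Omega_lt_top hM ⟨le_rfl, P.T_pos.le⟩, hX.ρ₀_nonneg, hX.ρ₀_memLp.1,
    hX.u₀_meas, integrable_p_of_memLp hX.ρ₀_nonneg hX.ρ₀_memLp, hX.kinetic₀⟩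

theorem IsWeakSolution.finiteEnergy_slice (hX : IsWeakSolution P D K X) :
    ∀ᵐ t ∂(volume.restrict (Ioo 0 P.T)),
      FiniteEnergy P (volume.restrict (X.dom t)) (X.ρ t) (X.u t) := by
  obtain ⟨M, -, hM⟩ := hX.exists_height_bound
  obtain ⟨C, hC⟩ := hX.kinetic
  filter_upwards [hC, aestronglyMeasurable_slice hX.w_cont hX.aesm_kinetic,
    aestronglyMeasurable_slice hX.w_cont hX.u_meas, ae_restrict_mem measurableSet_Ioo]
    with t h1 h2 h3 ht
  have ht' := Ioo_subset_Icc_self ht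
  refine ⟨by simpa using volume_Omega_lt_top hM ht', hX.ρ_nonneg t, (hX.ρ_memLp t ht').1, h3,
    integrable_p_of_memLp (hX.ρ_nonneg t) (hX.ρ_memLp t ht'), h2, ?_⟩
  refine (hasFiniteIntegral_iff_ofReal (Filter.Eventually.of_forall fun y =>
    mul_nonneg (hX.ρ_nonneg t y) (dot_nonneg _))).2 (h1.trans_lt (by simp))

/-- Membership in L^γ at each time gives no bound uniform in time. The energy inequality does, since
every other term on its left side is nonnegative. -/
theorem IsWeakSolution.exists_pressure_bound (hX : IsWeakSolution P D K X) :
    ∃ C : ℝ, ∀ᵐ t ∂(volume.restrict (Ioo 0 P.T)), ∫ y in X.dom t, P.p (X.ρ t y) ≤ C := by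
  set E₀ := (∫ y in X.dom 0, fluidEnergy P (D.ρ₀ y) (D.u₀ y))
      + ∫ x in cell, plateEnergy (D.w₁ x) (lap (X.w.hess 0 x)) with hE
  have hc : 0 < P.ε ^ 2 * (P.γ - 1) := mul_pos P.ε_sq_pos P.γ_sub_pos
  refine ⟨P.ε ^ 2 * (P.γ - 1) * E₀, ?_⟩
  filter_upwards [hX.energy, hX.finiteEnergy_slice, ae_restrict_mem measurableSet_Ioo]
    with τ h1 h2 hτ
  have a1 : 0 ≤ ∫ x in cell, plateEnergy (X.w.vel τ x) (lap (X.w.hess τ x)) :=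
    integral_nonneg fun x => by simp only [plateEnergy]; positivity
  have a2 : 0 ≤ P.ν * ∫ t in (0)..τ, ∫ y in X.dom t, frob (P.S (X.Du t y)) (X.Du t y) :=
    mul_nonneg P.ν_pos.le (intervalIntegral.integral_nonneg_of_forall hτ.1.le fun t =>
      integral_nonneg fun y => frob_S_nonneg P _)
  have a3 : 0 ≤ ∫ t in (0)..τ, ∫ x in cell, plateDissipation P X t x :=
    intervalIntegral.integral_nonneg_of_forall hτ.1.le fun t =>
      integral_nonneg fun x => plateDissipation_nonneg P X t x
  have a4 : ∫ y in X.dom τ, fluidEnergy P (X.ρ τ y) (X.u τ y) ≤ E₀ := by linarith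
  have a5 : ∫ y in X.dom τ, 1 / (P.ε ^ 2 * (P.γ - 1)) * P.p (X.ρ τ y) ≤ E₀ := by
    refine (integral_mono (h2.pressure.const_mul _) h2.fluidEnergy fun y => ?_).trans a4
    have b1 := mul_nonneg (hX.ρ_nonneg τ y) (dot_nonneg (X.u τ y))
    have b2 : 0 ≤ 1 / P.ε ^ 2 * P.p P.ρbar :=
      mul_nonneg (by have := P.ε_sq_pos; positivity) (P.p_nonneg P.ρbar_pos.le)
    have b3 : 1 / (P.ε ^ 2 * (P.γ - 1)) * P.p (X.ρ τ y)
        = 1 / P.ε ^ 2 * (P.p (X.ρ τ y) / (P.γ - 1)) := by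
      have := P.γ_sub_pos.ne'
      have := P.ε_pos.ne'
      field_simp
    simp only [fluidEnergy]
    rw [b3, mul_add]
    linarith
  rw [integral_const_mul, one_div, inv_mul_le_iff₀ hc] at a5
  exact a5

theorem IsWeakSolution.finiteEnergy (hX : IsWeakSolution P D K X) :
    FiniteEnergy P (volume.restrict (QT X.w.val P.T)) (fun p => X.ρ p.1 p.2)
      (fun p => X.u p.1 p.2) := by
  obtain ⟨M, -, hM⟩ := hX.exists_height_bound
  obtain ⟨C, hC⟩ := hX.kinetic
  obtain ⟨C', hC'⟩ := hX.exists_pressure_bound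
  refine ⟨by simpa using volume_QT_lt_top hM, fun p => hX.ρ_nonneg _ _, hX.ρ_meas, hX.u_meas, ?_,
    ?_⟩
  · refine integrableOn_QT_of_bound hX.w_cont (C := C'.toNNReal)
      (P.continuous_p.comp_aestronglyMeasurable hX.ρ_meas) (fun p => P.p_nonneg
        (hX.ρ_nonneg _ _)) ?_
    filter_upwards [hC', hX.finiteEnergy_slice] with t h1 h2
    rw [← ofReal_integral_eq_lintegral_ofReal h2.pressure
      (Filter.Eventually.of_forall fun y => P.p_nonneg (hX.ρ_nonneg t y))]
    exact ENNReal.ofReal_le_ofReal h1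
  · exact integrableOn_QT_of_bound hX.w_cont hX.aesm_kinetic
      (fun p => mul_nonneg (hX.ρ_nonneg _ _) (dot_nonneg _)) hC

/-- The Sobolev bound with exponent q = 1 suffices, and square integrability in time is weakened by
x ≤ 1 + x². -/
theorem IsWeakSolution.integrable_Du (hX : IsWeakSolution P D K X) (i j : Fin 3) :
    IntegrableOn (fun p : ℝ × E3 => X.Du p.1 p.2 i j) (QT X.w.val P.T) := by
  have h : IntegrableOn (fun p : ℝ × E3 => X.Du p.1 p.2) (QT X.w.val P.T) := by
    refine ⟨hX.Du_meas, ?_⟩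
    rw [HasFiniteIntegral, lintegral_QT hX.w_cont hX.Du_meas.enorm]
    have h1 := (hX.u_sobolev 1 le_rfl one_lt_two).2
    simp only [ENNReal.ofReal_one, eLpNorm_one_eq_lintegral_enorm] at h1
    have h2 : ∀ x : ℝ≥0∞, x ≤ 1 + x ^ 2 := fun x => by
      rcases le_total x 1 with hx | hx
      · exact hx.trans le_self_add
      · calc x = x * 1 := (mul_one x).symm
          _ ≤ x * x := by gcongr
          _ ≤ 1 + x ^ 2 := by rw [pow_two]; exact le_add_self
    refine (lintegral_mono fun t => h2 _).trans_lt ?_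
    rw [lintegral_add_left measurable_const]
    exact ENNReal.add_lt_top.2 ⟨by simp, h1⟩
  refine Integrable.mono h ((continuous_apply j).comp_aestronglyMeasurable
    ((continuous_apply i).comp_aestronglyMeasurable hX.Du_meas))
    (Filter.Eventually.of_forall fun p => ?_)
  exact (norm_le_pi_norm (X.Du p.1 p.2 i) j).trans (norm_le_pi_norm (X.Du p.1 p.2) i)

theorem bddMeas_QT {w : ℝ → E2 → ℝ} {T M : ℝ} (hM : ∀ t ∈ Icc 0 T, ∀ x, |1 + w t x| ≤ M)
    (hw : ContinuousOn (fun p : ℝ × E2 => w p.1 p.2) (Icc 0 T ×ˢ univ))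
    {g : ℝ × E3 → ℝ} (hg : Continuous g) : BddMeas (volume.restrict (QT w T)) g := by
  obtain ⟨C, hC⟩ := (isCompact_Icc.prod (isCompact_box M)).exists_bound_of_continuousOn
    (f := g) (s := Icc 0 T ×ˢ box M) hg.continuousOn
  refine ⟨hg.aestronglyMeasurable, C, ?_⟩
  filter_upwards [ae_restrict_mem (measurableSet_QT hw)] with p hp
  exact hC p (QT_subset_box hM hp)

theorem bddMeas_Omega {w : ℝ → E2 → ℝ} {T M : ℝ} (hM : ∀ t ∈ Icc 0 T, ∀ x, |1 + w t x| ≤ M)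
    (hw : ContinuousOn (fun p : ℝ × E2 => w p.1 p.2) (Icc 0 T ×ˢ univ)) {t : ℝ} (ht : t ∈ Icc 0 T)
    {g : E3 → ℝ} (hg : Continuous g) : BddMeas (volume.restrict (Omega w t)) g := by
  obtain ⟨C, hC⟩ := (isCompact_box M).exists_bound_of_continuousOn (f := g) hg.continuousOn
  refine ⟨hg.aestronglyMeasurable, C, ?_⟩
  filter_upwards [ae_restrict_mem (measurableSet_Omega hw ht)] with p hp
  exact hC p (subgraph_subset_box (fun x => (le_abs_self _).trans (hM t ht x)) hp)

end Fluid

/-! ### Calculus of smooth fields -/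

section Calculus

variable {f g : ℝ → E3 → ℝ} {U : ℝ → E3 → E3} {t : ℝ} {y : E3}

theorem IsSmoothField.contDiff_one {β : Type} [NormedAddCommGroup β] [NormedSpace ℝ β]
    {F : ℝ → E3 → β} (hF : IsSmoothField F) : ContDiff ℝ 1 fun p : ℝ × E3 => F p.1 p.2 :=
  hF.1.of_le (by exact_mod_cast le_top)

theorem IsSmoothField.continuous {β : Type} [NormedAddCommGroup β] [NormedSpace ℝ β]
    {F : ℝ → E3 → β} (hF : IsSmoothField F) : Continuous fun p : ℝ × E3 => F p.1 p.2 :=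
  hF.1.continuous

theorem IsSmoothField.coord (hU : IsSmoothField U) (i : Fin 3) :
    IsSmoothField fun t y => U t y i :=
  ⟨contDiff_pi.1 hU.1 i, fun t y k => congrFun (hU.2 t y k) i⟩

theorem IsSmoothField.comp {φ : ℝ → ℝ} (hf : IsSmoothField f)
    (hφ : ∀ t y, ContDiffAt ℝ ∞ φ (f t y)) : IsSmoothField fun t y => φ (f t y) :=
  ⟨contDiff_iff_contDiffAt.2 fun p => ContDiffAt.comp p (hφ p.1 p.2) hf.1.contDiffAt,
    fun t y k => congrArg φ (hf.2 t y k)⟩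

theorem IsSmoothField.half_dot (hU : IsSmoothField U) :
    IsSmoothField fun t y => 1 / 2 * (U t y ⬝ᵥ U t y) := by
  refine ⟨?_, fun t y k => by simp only [hU.2 t y k]⟩
  simp only [dotProduct]
  exact contDiff_const.mul (ContDiff.sum fun i _ => (hU.coord i).1.mul (hU.coord i).1)

theorem IsSmoothField.sub_const (hf : IsSmoothField f) (c : ℝ) :
    IsSmoothField fun t y => f t y - c :=
  ⟨hf.1.sub contDiff_const, fun t y k => by simp only [hf.2 t y k]⟩

theorem IsSmoothField.smul (hf : IsSmoothField f) (hU : IsSmoothField U) :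
    IsSmoothField fun t y => f t y • U t y :=
  ⟨hf.1.smul hU.1, fun t y k => by simp only [hf.2 t y k, hU.2 t y k]⟩

theorem IsSmoothField.hasDerivAt_dt {β : Type} [NormedAddCommGroup β] [NormedSpace ℝ β]
    {F : ℝ → E3 → β} (hF : IsSmoothField F) (t : ℝ) (y : E3) :
    HasDerivAt (fun s => F s y) (dt F t y) t :=
  (DifferentiableAt.comp (g := fun p : ℝ × E3 => F p.1 p.2) (f := fun r => (r, y)) t
    (hF.1.differentiable (by simp) (t, y))
    (differentiableAt_id.prodMk (differentiableAt_const _))).hasDerivAt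

theorem IsSmoothField.differentiableAt_section {β : Type} [NormedAddCommGroup β] [NormedSpace ℝ β]
    {F : ℝ → E3 → β} (hF : IsSmoothField F) (t : ℝ) (y : E3) : DifferentiableAt ℝ (F t) y :=
  (contDiff_section hF.1 t).differentiable (by simp) y

theorem IsSmoothField.dt_coord (hU : IsSmoothField U) (t : ℝ) (y : E3) (i : Fin 3) :
    dt (fun s z => U s z i) t y = dt U t y i :=
  (hasDerivAt_pi.1 (hU.hasDerivAt_dt t y) i).deriv

theorem IsSmoothField.continuous_dt_coord (hU : IsSmoothField U) (i : Fin 3) :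
    Continuous fun p : ℝ × E3 => dt U p.1 p.2 i := by
  simp only [← hU.dt_coord]
  exact continuous_dt (hU.coord i).contDiff_one

theorem IsSmoothField.continuous_jac (hU : IsSmoothField U) (i j : Fin 3) :
    Continuous fun p : ℝ × E3 => jac (U p.1) p.2 i j :=
  continuous_gradE_section (f := fun t y => U t y i) (hU.coord i).contDiff_one j

theorem dt_comp {φ : ℝ → ℝ} {φ' : ℝ} (hf : IsSmoothField f) (hφ : HasDerivAt φ φ' (f t y)) :
    dt (fun s z => φ (f s z)) t y = φ' * dt f t y :=
  (hφ.comp t (hf.hasDerivAt_dt t y)).deriv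

theorem gradE_comp {φ : ℝ → ℝ} {φ' : ℝ} (hf : IsSmoothField f) (hφ : HasDerivAt φ φ' (f t y)) :
    gradE (fun z => φ (f t z)) y = φ' • gradE (f t) y := by
  ext j
  have h := hφ.comp_hasFDerivAt y (hf.differentiableAt_section t y).hasFDerivAt
  have h2 : fderiv ℝ (fun z => φ (f t z)) y = _ := h.fderiv
  simp [gradE, h2]

theorem dt_half_dot (hU : IsSmoothField U) :
    dt (fun s z => 1 / 2 * (U s z ⬝ᵥ U s z)) t y = U t y ⬝ᵥ dt U t y := by
  have h := fun i => hasDerivAt_pi.1 (hU.hasDerivAt_dt t y) i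
  have h2 := (HasDerivAt.fun_sum (u := Finset.univ) fun i _ => (h i).mul (h i)).const_mul
    (1 / 2 : ℝ)
  refine h2.deriv.trans ?_
  simp only [dotProduct, Finset.mul_sum]
  refine Finset.sum_congr rfl fun i _ => ?_
  ring

theorem gradE_half_dot (hU : IsSmoothField U) :
    gradE (fun z => 1 / 2 * (U t z ⬝ᵥ U t z)) y = fun j => ∑ i, U t y i * jac (U t) y i j := by
  ext j
  have h := fun i => ((hU.coord i).differentiableAt_section t y).hasFDerivAt
  have h2 := (HasFDerivAt.fun_sum (u := Finset.univ) fun i _ =>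
    (h i).mul (h i)).const_mul (1 / 2 : ℝ)
  have h3 : fderiv ℝ (fun z => 1 / 2 * (U t z ⬝ᵥ U t z)) y = _ := h2.fderiv
  simp only [gradE, h3, jac, Fin.sum_univ_three, _root_.smul_apply, _root_.add_apply, smul_eq_mul]
  ring

theorem tr3_jac_smul (hf : IsSmoothField f) (hU : IsSmoothField U) :
    tr3 (jac (fun z => f t z • U t z) y)
      = U t y ⬝ᵥ gradE (f t) y + f t y * tr3 (jac (U t) y) := by
  have h : ∀ i, jac (fun z => f t z • U t z) y i i
      = U t y i * gradE (f t) y i + f t y * jac (U t) y i i := by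
    intro i
    have h1 := (hf.differentiableAt_section t y).hasFDerivAt.mul
      ((hU.coord i).differentiableAt_section t y).hasFDerivAt
    have h2 : fderiv ℝ (fun z => f t z * U t z i) y = _ := h1.fderiv
    simp only [jac, gradE, Pi.smul_apply, smul_eq_mul, h2, _root_.add_apply, _root_.smul_apply]
    ring
  simp only [tr3, h, Finset.sum_add_distrib, Finset.mul_sum, dotProduct]

end Calculus

/-- Integrand of the continuity equation, `ρ (∂ₜφ + u · ∇φ)`. -/
noncomputable def continuityBulk (X : State) (φ : ℝ → E3 → ℝ) (t : ℝ) (y : E3) : ℝ :=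
  X.ρ t y * (dt φ t y + X.u t y ⬝ᵥ gradE (φ t) y)

/-! ### Pointwise algebra of the fluid remainder -/

theorem frob_sub_sub (P : Params) (A B : Fin 3 → Fin 3 → ℝ) :
    frob (P.S A - P.S B) (A - B) + frob (P.S B) (A - B)
      = frob (P.S A) A - frob (P.S A) B := by
  simp only [frob, Pi.sub_apply, ← Finset.sum_add_distrib, ← Finset.sum_sub_distrib]
  refine Finset.sum_congr rfl fun i _ => Finset.sum_congr rfl fun j _ => ?_
  ring

theorem Params.hasDerivAt_p (P : Params) {s : ℝ} (hs : 0 < s) : HasDerivAt P.p (P.p' s) s :=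
  Real.hasDerivAt_rpow_const (Or.inl hs.ne')

theorem Params.hasDerivAt_p' (P : Params) {s : ℝ} (hs : 0 < s) :
    HasDerivAt P.p' (P.γ * ((P.γ - 1) * s ^ (P.γ - 1 - 1))) s :=
  (Real.hasDerivAt_rpow_const (Or.inl hs.ne')).const_mul P.γ

/-- For the power law r ∂(p'(r)) = (γ - 1) ∂(p(r)) for each derivative ∂. The terms with r ∂(p'(r))
therefore become the transport of p(r) by U, and together with the part of the pressure term in div
U they form ∂ₜq + div(qU) for q = p(r) - p(ρbar). What is left regroups into the momentum integrand
for U and the continuity integrands for |U|²/2 and p'(r). -/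
theorem bulk_identity (P : Params) (X : State) {r : ℝ → E3 → ℝ} {U : ℝ → E3 → E3}
    (hr : IsSmoothField r) (hU : IsSmoothField U) {t : ℝ} {y : E3} (hpos : 0 < r t y) :
    remainderBulk P X r U t y = P.ν * relViscous P X U t y
      - P.ν * frob (P.S (X.Du t y)) (X.Du t y)
      - momentumBulk P X U t y
      + continuityBulk X (fun s z => 1 / 2 * (U s z ⬝ᵥ U s z)) t y
      - 1 / (P.ε ^ 2 * (P.γ - 1)) * continuityBulk X (fun s z => P.p' (r s z)) t y
      + 1 / P.ε ^ 2 * (dt (fun s z => P.p (r s z) - P.p P.ρbar) t y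
        + (U t y ⬝ᵥ gradE (fun z => P.p (r t z) - P.p P.ρbar) y
          + (P.p (r t y) - P.p P.ρbar) * tr3 (jac (U t) y))) := by
  have h1 := dt_comp hr ((P.hasDerivAt_p hpos).sub_const (P.p P.ρbar))
  have h2 := gradE_comp hr ((P.hasDerivAt_p hpos).sub_const (P.p P.ρbar))
  have h3 := dt_comp hr (P.hasDerivAt_p' hpos)
  have h4 := gradE_comp hr (P.hasDerivAt_p' hpos)
  have h5 : P.p' (r t y) = r t y * (P.γ * r t y ^ (P.γ - 1 - 1)) := by
    have : r t y ^ (P.γ - 1) = r t y ^ (P.γ - 1 - 1) * r t y := by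
      rw [← Real.rpow_add_one hpos.ne', sub_add_cancel]
    rw [Params.p', this]; ring
  have h6 := frob_sub_sub P (X.Du t y) (jac (U t) y)
  have h7 := P.γ_sub_pos.ne'
  have h8 := P.ε_pos.ne'
  have h9 : X.u t y ⬝ᵥ gradE (fun z => 1 / 2 * (U t z ⬝ᵥ U t z)) y
      = U t y ⬝ᵥ advect (X.u t y) (jac (U t) y) := by
    rw [gradE_half_dot hU]
    simp only [dotProduct, advect, Finset.mul_sum]
    rw [Finset.sum_comm]
    refine Finset.sum_congr rfl fun i _ => Finset.sum_congr rfl fun j _ => ?_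
    ring
  have h10 : frob (P.S (jac (U t) y)) (X.Du t y - jac (U t) y)
      = frob (P.S (X.Du t y)) (X.Du t y) - frob (P.S (X.Du t y)) (jac (U t) y)
        - relViscous P X U t y := by
    rw [relViscous]; linarith
  simp only [remainderBulk, momentumBulk, continuityBulk, h10, h9, dt_half_dot hU, h3, h4, h1, h2,
    h5, sub_dotProduct, dotProduct_add, dotProduct_smul, smul_eq_mul]
  field_simp
  ring

/-! ### Space-time integrals -/

section SpaceTime

variable {w : ℝ → E2 → ℝ} {T τ : ℝ}

theorem QT_mono (hτ : τ ≤ T) : QT w τ ⊆ QT w T := fun _ hp => ⟨⟨hp.1.1, hp.1.2.trans_le hτ⟩, hp.2⟩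

theorem GammaT_mono (hτ : τ ≤ T) : GammaT τ ⊆ GammaT T :=
  prod_mono (Ioo_subset_Ioo_right hτ) le_rfl

theorem intervalIntegral_QT (hw : ContinuousOn (fun p : ℝ × E2 => w p.1 p.2) (Icc 0 T ×ˢ univ))
    {f : ℝ → E3 → ℝ} (hf : IntegrableOn (fun p : ℝ × E3 => f p.1 p.2) (QT w T))
    (hτ : τ ∈ Icc 0 T) :
    ∫ t in (0)..τ, ∫ y in Omega w t, f t y = ∫ p in QT w τ, f p.1 p.2 := by
  have hw' := hw.mono (prod_mono_left (Icc_subset_Icc_right hτ.2))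
  have hf' := (integrable_indicator_iff (measurableSet_QT hw')).2 (hf.mono_set (QT_mono hτ.2))
  rw [← integral_indicator (measurableSet_QT hw'), Measure.volume_eq_prod, integral_prod _ hf',
    intervalIntegral.integral_of_le hτ.1, integral_Ioc_eq_integral_Ioo,
    ← integral_indicator measurableSet_Ioo]
  congr 1
  ext t
  by_cases ht : t ∈ Ioo 0 τ
  · rw [indicator_of_mem ht]
    simp only [indicator_QT _ ht]
    rw [integral_indicator (measurableSet_Omega hw (Ioo_subset_Icc_self
      (Ioo_subset_Ioo_right hτ.2 ht)))]
  · rw [indicator_of_notMem ht]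
    simp only [indicator_QT_of_notMem _ ht, integral_zero]

theorem intervalIntegral_GammaT {f : ℝ → E2 → ℝ}
    (hf : IntegrableOn (fun p : ℝ × E2 => f p.1 p.2) (GammaT T)) (hτ : τ ∈ Icc 0 T) :
    ∫ t in (0)..τ, ∫ x in cell, f t x = ∫ p in GammaT τ, f p.1 p.2 := by
  have hf' := hf.mono_set (GammaT_mono hτ.2)
  rw [IntegrableOn, volume_GammaT] at hf'
  rw [volume_GammaT, integral_prod _ hf', intervalIntegral.integral_of_le hτ.1,
    integral_Ioc_eq_integral_Ioo]

end SpaceTime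

/-! ### Evolution identities along a weak solution -/

section Evolution

variable {P : Params} {D : InitialData} {K : Set (ℝ → E2 → ℝ)} {X : State}
  {U : ℝ → E3 → E3} {W : TestPlate}

theorem isRenorm_id : IsRenorm fun s => s :=
  ⟨contDiffOn_id, rfl, Or.inr fun _ _ => rfl⟩

theorem IsWeakSolution.continuity_eq (hX : IsWeakSolution P D K X) {φ : ℝ → E3 → ℝ}
    (hφ : IsSmoothField φ) : ∀ᵐ τ ∂(volume.restrict (Ioo 0 P.T)),
      (∫ t in (0)..τ, ∫ y in X.dom t, continuityBulk X φ t y)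
        = (∫ y in X.dom τ, X.ρ τ y * φ τ y) - ∫ y in X.dom 0, D.ρ₀ y * φ 0 y := by
  filter_upwards [hX.continuity _ isRenorm_id φ hφ] with τ hτ
  rw [← hτ]
  congr 1; ext t
  congr 1; ext y
  -- The one-sided derivative equals 1 also at vacuum, so the factor of div u vanishes.
  have : derivWithin (fun s : ℝ => s) (Ici 0) (X.ρ t y) = 1 :=
    derivWithin_id' _ _ (uniqueDiffOn_Ici 0 _ (hX.ρ_nonneg t y))
  rw [this, continuityBulk]
  ring

/-- The displacement frozen outside `[0, T]`. -/
noncomputable def clampTime (T : ℝ) (w : ℝ → E2 → ℝ) (t : ℝ) : E2 → ℝ := w (max 0 (min t T))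

theorem clampTime_of_mem {T : ℝ} (w : ℝ → E2 → ℝ) {t : ℝ} (ht : t ∈ Icc 0 T) :
    clampTime T w t = w t := by
  rw [clampTime, min_eq_left ht.2, max_eq_right ht.1]

/-- `FSI.transport` wants a displacement that is continuous and nondegenerate at all real times;
freezing it outside [0,T] provides one and does not alter the domains involved. -/
theorem IsWeakSolution.transport (hX : IsWeakSolution P D K X) {q : ℝ → E3 → ℝ}
    (hq : IsSmoothField q) {τ : ℝ} (hτ : τ ∈ Icc 0 P.T) :
    (∫ y in X.dom τ, q τ y) - (∫ y in X.dom 0, q 0 y)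
      = (∫ t in (0)..τ, ∫ y in X.dom t, dt q t y)
        + ∫ t in (0)..τ, ∫ x in cell, q t (Phi X.w.val t x) * X.w.vel t x := by
  obtain ⟨M, -, hM⟩ := hX.exists_height_bound
  have h0 : (0 : ℝ) ∈ Icc 0 P.T := ⟨le_rfl, P.T_pos.le⟩
  have hc : ∀ t : ℝ, max 0 (min t P.T) ∈ Icc 0 P.T := fun t =>
    ⟨le_max_left _ _, max_le P.T_pos.le (min_le_right _ _)⟩
  have e : ∀ t ∈ Icc 0 P.T, Omega (clampTime P.T X.w.val) t = X.dom t := fun t ht => by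
    rw [Omega, clampTime_of_mem _ ht]; rfl
  have e' : ∀ t ∈ Icc 0 P.T, ∀ x, Phi (clampTime P.T X.w.val) t x = Phi X.w.val t x :=
    fun t ht x => by rw [Phi, clampTime_of_mem _ ht, Phi]
  have hcont : Continuous fun p : ℝ × E2 => clampTime P.T X.w.val p.1 p.2 :=
    hX.w_cont.comp_continuous
      (f := fun p : ℝ × E2 => (max 0 (min p.1 P.T), p.2)) (by fun_prop)
      fun p => ⟨hc p.1, mem_univ _⟩
  have h := FSI.transport (T := P.T) (w := clampTime P.T X.w.val) (v := X.w.vel) hcont (M := M)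
    (fun t x => (le_abs_self _).trans (hM _ (hc t) x))
    (fun t x => by have := hX.w_gt _ (hc t) x; simp only [clampTime]; linarith)
    (integrableOn_of_memLp hX.w_class.vel_memLp)
    (fun t ht => by
      rw [clampTime_of_mem _ ht, clampTime_of_mem _ h0]; exact hX.w_class.primitive t ht)
    hq.contDiff_one hτ
  rw [e τ hτ, e 0 h0] at h
  rw [h]
  have hsub : ∀ t ∈ uIcc 0 τ, t ∈ Icc 0 P.T := fun t ht => by
    rw [uIcc_of_le hτ.1] at ht; exact ⟨ht.1, ht.2.trans hτ.2⟩
  congr 1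
  · refine intervalIntegral.integral_congr fun t ht => ?_
    simp only [e t (hsub t ht)]
  · refine intervalIntegral.integral_congr fun t ht => ?_
    simp only [e' t (hsub t ht)]

theorem IsWeakSolution.integral_divergence (hX : IsWeakSolution P D K X) {F : ℝ → E3 → E3}
    (hF : IsSmoothField F) (hbot : ∀ t ∈ Icc 0 P.T, ∀ x, F t (pt x 0) ⬝ᵥ e3 = 0)
    {t : ℝ} (ht : t ∈ Icc 0 P.T) :
    ∫ y in X.dom t, tr3 (jac (F t) y)
      = ∫ x in cell, F t (Phi X.w.val t x) ⬝ᵥ X.nrm t x := by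
  obtain ⟨M, -, hM⟩ := hX.exists_height_bound
  have hm := hX.w_class.memLp_slice t ht
  refine FSI.integral_divergence (continuous_slice hX.w_cont ht)
    (fun x => (le_abs_self _).trans (hM t ht x)) (fun x => by linarith [hX.w_gt t ht x])
    (hX.w_class.weakGrad t ht) (hX.w_class.weakHess t ht) hm.1 hm.2.1 hm.2.2
    (contDiff_section hF.contDiff_one t) (hF.2 t) fun x => ?_
  simpa [dotProduct, e3, Fin.sum_univ_three] using hbot t ht x

/-- The trace of u is only integrable and the normal only square integrable, so their product is not
obviously integrable. The kinematic conditions identify it with a difference of plate velocities,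
which is in L². -/
theorem IsWeakSolution.ae_top (hX : IsWeakSolution P D K X) (hU : IsSmoothField U)
    (hW : W.Admissible P.T K) (hUW : Compatible P X U W.fields.vel) :
    ∀ᵐ p ∂(volume.restrict (GammaT P.T)),
      (X.uTop p.1 p.2 - U p.1 (Phi X.w.val p.1 p.2)) ⬝ᵥ X.nrm p.1 p.2
        = X.w.vel p.1 p.2 - W.fields.vel p.1 p.2 := by
  have hn : AEStronglyMeasurable (fun p : ℝ × E2 => X.nrm p.1 p.2) (volume.restrict (GammaT P.T)) :=
    continuous_normal.comp_aestronglyMeasurable hX.w_class.meas_grad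
  refine ae_GammaT_of_ae_ae (f := fun p : ℝ × E2 =>
    (X.uTop p.1 p.2 - U p.1 (Phi X.w.val p.1 p.2)) ⬝ᵥ X.nrm p.1 p.2)
    (g := fun p => X.w.vel p.1 p.2 - W.fields.vel p.1 p.2)
    (continuous_dot.comp_aestronglyMeasurable
      ((hX.uTop_int.1.sub (hX.aestronglyMeasurable_top hU.continuous)).prodMk hn))
    (hX.w_class.vel_memLp.1.sub hW.vel_test.memLp.1) ?_
  filter_upwards [hX.coupling_top, hUW.1] with t h1 h2
  filter_upwards [h1, h2] with x a b
  rw [sub_dotProduct, a, b]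

/-- The work of a smooth pressure `q` on the moving boundary. -/
theorem IsWeakSolution.pressure_work (hX : IsWeakSolution P D K X) (hU : IsSmoothField U)
    (hW : W.Admissible P.T K) (hUW : Compatible P X U W.fields.vel) {q : ℝ → E3 → ℝ}
    (hq : IsSmoothField q) :
    IntegrableOn (fun p : ℝ × E3 => dt q p.1 p.2 + (U p.1 p.2 ⬝ᵥ gradE (q p.1) p.2
      + q p.1 p.2 * tr3 (jac (U p.1) p.2))) (QT X.w.val P.T) ∧
    IntegrableOn (fun p : ℝ × E2 => q p.1 (Phi X.w.val p.1 p.2) *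
      ((X.uTop p.1 p.2 - U p.1 (Phi X.w.val p.1 p.2)) ⬝ᵥ X.nrm p.1 p.2)) (GammaT P.T) ∧
    ∀ τ ∈ Icc 0 P.T,
      (∫ p in QT X.w.val τ, (dt q p.1 p.2 + (U p.1 p.2 ⬝ᵥ gradE (q p.1) p.2
        + q p.1 p.2 * tr3 (jac (U p.1) p.2))))
      + (∫ p in GammaT τ, q p.1 (Phi X.w.val p.1 p.2) *
        ((X.uTop p.1 p.2 - U p.1 (Phi X.w.val p.1 p.2)) ⬝ᵥ X.nrm p.1 p.2))
      = (∫ y in X.dom τ, q τ y) - ∫ y in X.dom 0, q 0 y := by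
  obtain ⟨M, -, hM⟩ := hX.exists_height_bound
  have hqU := hq.smul hU
  have ejac : ∀ t y, U t y ⬝ᵥ gradE (q t) y + q t y * tr3 (jac (U t) y)
      = tr3 (jac (fun z => q t z • U t z) y) := fun t y => (tr3_jac_smul hq hU).symm
  have cjac : Continuous fun p : ℝ × E3 => tr3 (jac (fun z => q p.1 z • U p.1 z) p.2) := by
    simp only [tr3]
    exact continuous_finsetSum _ fun i _ => hqU.continuous_jac i i
  have i1 : IntegrableOn (fun p : ℝ × E3 => dt q p.1 p.2) (QT X.w.val P.T) :=
    integrableOn_QT_continuous hM (continuous_dt hq.contDiff_one)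
  have i2 : IntegrableOn (fun p : ℝ × E3 => tr3 (jac (fun z => q p.1 z • U p.1 z) p.2))
    (QT X.w.val P.T) := integrableOn_QT_continuous hM cjac
  have hv := hX.integrable_top_mul hq.continuous (integrableOn_of_memLp hX.w_class.vel_memLp)
  have hV := hX.integrable_top_mul hq.continuous (integrableOn_of_memLp hW.vel_test.memLp)
  have etop : (fun p : ℝ × E2 => q p.1 (Phi X.w.val p.1 p.2) *
      ((X.uTop p.1 p.2 - U p.1 (Phi X.w.val p.1 p.2)) ⬝ᵥ X.nrm p.1 p.2))
      =ᵐ[volume.restrict (GammaT P.T)] fun p => q p.1 (Phi X.w.val p.1 p.2) * X.w.vel p.1 p.2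
        - q p.1 (Phi X.w.val p.1 p.2) * W.fields.vel p.1 p.2 := by
    filter_upwards [hX.ae_top hU hW hUW] with p hp
    rw [hp, mul_sub]
  simp only [ejac]
  refine ⟨i1.add i2, (hv.sub hV).congr etop.symm, fun τ hτ => ?_⟩
  have etop' := ae_restrict_of_ae_restrict_of_subset (GammaT_mono hτ.2) etop
  rw [hX.transport hq hτ, integral_congr_ae etop',
    integral_sub (hv.mono_set (GammaT_mono hτ.2)) (hV.mono_set (GammaT_mono hτ.2)),
    integral_add (i1.mono_set (QT_mono hτ.2)) (i2.mono_set (QT_mono hτ.2)),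
    ← intervalIntegral_QT (f := fun t y => dt q t y) hX.w_cont i1 hτ,
    ← intervalIntegral_QT (f := fun t y => tr3 (jac (fun z => q t z • U t z) y)) hX.w_cont i2 hτ,
    ← intervalIntegral_GammaT (f := fun t x => q t (Phi X.w.val t x) * X.w.vel t x) hv hτ,
    ← intervalIntegral_GammaT (f := fun t x => q t (Phi X.w.val t x) * W.fields.vel t x) hV hτ]
  -- The flux of qU leaves only through the moving boundary, where U·n = ∂ₜW; the bottom is
  -- impermeable.
  have hdiv : ∫ t in (0)..τ, ∫ y in X.dom t, tr3 (jac (fun z => q t z • U t z) y)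
      = ∫ t in (0)..τ, ∫ x in cell, q t (Phi X.w.val t x) * W.fields.vel t x := by
    rw [intervalIntegral.integral_of_le hτ.1, intervalIntegral.integral_of_le hτ.1,
      integral_Ioc_eq_integral_Ioo, integral_Ioc_eq_integral_Ioo]
    refine integral_congr_ae ?_
    filter_upwards [ae_restrict_of_ae_restrict_of_subset (Ioo_subset_Ioo_right hτ.2) hUW.1,
      ae_restrict_mem measurableSet_Ioo] with t h1 ht
    have ht' : t ∈ Icc 0 P.T := ⟨ht.1.le, ht.2.le.trans hτ.2⟩
    rw [hX.integral_divergence hqU (fun t ht x => by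
      rw [smul_dotProduct, hUW.2 t ht x, smul_zero]) ht']
    refine integral_congr_ae ?_
    filter_upwards [h1] with x hx
    rw [smul_dotProduct, hx, smul_eq_mul]
  rw [hdiv]
  ring

/-- The work of the plate terms that involve only the displacements. -/
theorem IsWeakSolution.plate_work (hX : IsWeakSolution P D K X) (hW : W.Admissible P.T K) {τ : ℝ}
    (hτ : τ ∈ Icc 0 P.T) :
    (∫ p in GammaT τ, W.fields.vel p.1 p.2 * W.acc p.1 p.2
      = 1 / 2 * (∫ x in cell, W.fields.vel τ x ^ 2) - 1 / 2 * ∫ x in cell, W.fields.vel 0 x ^ 2) ∧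
    (∫ p in GammaT τ, (lap (X.w.hess p.1 p.2) * lap (W.velHess p.1 p.2)
        - X.w.velGrad p.1 p.2 ⬝ᵥ W.gradLap p.1 p.2)
      = (∫ x in cell, lap (X.w.hess τ x) * lap (W.fields.hess τ x))
        - ∫ x in cell, lap (X.w.hess 0 x) * lap (W.fields.hess 0 x)) ∧
    (∫ p in GammaT τ, W.fields.velGrad p.1 p.2 ⬝ᵥ W.gradLap p.1 p.2
      = -(1 / 2 * ((∫ x in cell, lap (W.fields.hess τ x) ^ 2)
        - ∫ x in cell, lap (W.fields.hess 0 x) ^ 2))) ∧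
    (∫ p in GammaT τ, ((X.w.velGrad p.1 p.2 - W.fields.velGrad p.1 p.2)
        ⬝ᵥ W.fields.velGrad p.1 p.2
      + (X.w.vel p.1 p.2 - W.fields.vel p.1 p.2) * lap (W.velHess p.1 p.2)) = 0) := by
  have hWE := hW.energyClass
  have hV := hW.vel_test
  have hac := fun {p : ℝ → Prop} (h : ∀ᵐ t ∂(volume.restrict (Ioo 0 P.T)), p t) =>
    ae_restrict_of_ae_restrict_of_subset (Ioo_subset_Ioo_right hτ.2) h
  have iVa := integrable_mul_of_memLp hV.memLp hV.memLp_dt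
  have ilap := integrable_mul_of_memLp (memLp_lap hX.w_class.hess_memLp) (memLp_lap hV.memLp_hess)
  have iLlap := integrable_mul_of_memLp (memLp_lap hWE.hess_memLp) (memLp_lap hV.memLp_hess)
  have ivgL := integrable_dot_of_memLp hX.w_class.velGrad_memLp hW.gradLap_memLp
  have iVgL := integrable_dot_of_memLp hWE.velGrad_memLp hW.gradLap_memLp
  refine ⟨?_, ?_, ?_, ?_⟩
  · have h1 := hV.integral_sq_sub P.T_pos hτ
    rw [intervalIntegral_GammaT (f := fun t x => 2 * (W.fields.vel t x * W.acc t x))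
      (iVa.const_mul 2) hτ, integral_const_mul] at h1
    linarith
  · rw [integral_lap_mul_lap_sub hX.w_class hWE hV hW.gradLap_memLp hW.weakGradLap hτ]
    exact (intervalIntegral_GammaT (f := fun t x => lap (X.w.hess t x) * lap (W.velHess t x)
      - X.w.velGrad t x ⬝ᵥ W.gradLap t x) (ilap.sub ivgL) hτ).symm
  · have h1 := integral_lap_mul_lap_sub hWE hWE hV hW.gradLap_memLp hW.weakGradLap hτ
    rw [intervalIntegral_GammaT (f := fun t x => lap (W.fields.hess t x) * lap (W.velHess t x)
      - W.fields.velGrad t x ⬝ᵥ W.gradLap t x) (iLlap.sub iVgL) hτ,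
      integral_sub (IntegrableOn.mono_set iLlap (GammaT_mono hτ.2))
        (IntegrableOn.mono_set iVgL (GammaT_mono hτ.2))] at h1
    -- By Green's formula the two halves of the evolution of ∫ |ΔW|² are equal, so each accounts for
    -- half of the change.
    have h2 : ∫ p in GammaT τ, lap (W.fields.hess p.1 p.2) * lap (W.velHess p.1 p.2)
        = -∫ p in GammaT τ, W.fields.velGrad p.1 p.2 ⬝ᵥ W.gradLap p.1 p.2 := by
      rw [← intervalIntegral_GammaT (f := fun t x => lap (W.fields.hess t x) * lap (W.velHess t x))
        iLlap hτ, ← intervalIntegral_GammaT (f := fun t x => W.fields.velGrad t x ⬝ᵥ W.gradLap t x)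
        iVgL hτ, ← intervalIntegral.integral_neg, intervalIntegral.integral_of_le hτ.1,
        intervalIntegral.integral_of_le hτ.1, integral_Ioc_eq_integral_Ioo,
        integral_Ioc_eq_integral_Ioo]
      refine integral_congr_ae ?_
      filter_upwards [hac hW.weakGradLap, hac hV.weakHess, hac (memLp_slice_GammaT hV.memLp_grad),
        hac (memLp_slice_GammaT hV.memLp_hess), hac (memLp_slice_GammaT hW.gradLap_memLp),
        ae_restrict_mem measurableSet_Ioo] with t a1 a2 a3 a4 a5 ht
      rw [integral_mul_lap a1 a2
        (memLp_lap (hWE.memLp_slice t ⟨ht.1.le, ht.2.le.trans hτ.2⟩).2.2) a5 a3 a4]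
      simp only [dotProduct_comm]
    simp only [← pow_two] at h1
    linarith
  · have hgd := hX.w_class.velGrad_memLp.sub hWE.velGrad_memLp
    have hvd := hX.w_class.vel_memLp.sub hWE.vel_memLp
    have j1 := integrable_dot_of_memLp hgd hV.memLp_grad
    have j2 := integrable_mul_of_memLp hvd (memLp_lap hV.memLp_hess)
    refine (intervalIntegral_GammaT (f := fun t x => (X.w.velGrad t x - W.fields.velGrad t x)
        ⬝ᵥ W.fields.velGrad t x + (X.w.vel t x - W.fields.vel t x) * lap (W.velHess t x))
      (j1.add j2) hτ).symm.trans ?_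
    rw [intervalIntegral.integral_of_le hτ.1, integral_Ioc_eq_integral_Ioo]
    refine integral_eq_zero_of_ae ?_
    filter_upwards [hac hX.w_class.vel_weakGrad, hac hWE.vel_weakGrad, hac hV.weakHess,
      hac (memLp_slice_GammaT hX.w_class.vel_memLp), hac (memLp_slice_GammaT hWE.vel_memLp),
      hac (memLp_slice_GammaT hX.w_class.velGrad_memLp),
      hac (memLp_slice_GammaT hWE.velGrad_memLp),
      hac (memLp_slice_GammaT hV.memLp_hess)] with t a1 a2 a3 a4 a5 a6 a7 a8
    -- Green's formula against ∂ₜW, for ∂ₜw and for ∂ₜW separately, shows that the damping group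
    -- vanishes at almost every time.
    have h1 := integral_mul_lap a1 a3 a4 a6 a7 a8
    have h2 := integral_mul_lap a2 a3 a5 a7 a7 a8
    have i1 := integrable_dot_of_memLp a6 a7
    have i2 := integrable_dot_of_memLp a7 a7
    have i3 := integrable_mul_of_memLp a4 (memLp_lap a8)
    have i4 := integrable_mul_of_memLp a5 (memLp_lap a8)
    have i5 : Integrable (fun x => X.w.velGrad t x ⬝ᵥ W.fields.velGrad t x
      - W.fields.velGrad t x ⬝ᵥ W.fields.velGrad t x) (volume.restrict cell) := i1.sub i2
    have i6 : Integrable (fun x => X.w.vel t x * lap (W.velHess t x)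
      - W.fields.vel t x * lap (W.velHess t x)) (volume.restrict cell) := i3.sub i4
    simp only [sub_dotProduct, sub_mul]
    rw [integral_add i5 i6, integral_sub i1 i2, integral_sub i3 i4, h1, h2,
      Pi.zero_apply]
    ring

end Evolution

/-! ### Assembly of the relative energy inequality -/

section RelativeEnergy

variable {P : Params} {D : InitialData} {K : Set (ℝ → E2 → ℝ)} {X : State}
  {r : ℝ → E3 → ℝ} {U : ℝ → E3 → E3} {W : TestPlate}

theorem integrable_relPlate {v l V L : E2 → ℝ} {μ : Measure E2} (hv : MemLp v 2 μ)
    (hl : MemLp l 2 μ) (hV : MemLp V 2 μ) (hL : MemLp L 2 μ) :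
    Integrable (fun x => relPlate (v x) (l x) (V x) (L x)) μ ∧
    ∫ x, relPlate (v x) (l x) (V x) (L x) ∂μ = (∫ x, plateEnergy (v x) (l x) ∂μ)
      - (∫ x, v x * V x ∂μ) + 1 / 2 * (∫ x, V x ^ 2 ∂μ) - (∫ x, l x * L x ∂μ)
      + 1 / 2 * ∫ x, L x ^ 2 ∂μ := by
  have i0 : Integrable (fun x => plateEnergy (v x) (l x)) μ :=
    (hv.integrable_sq.const_mul (1 / 2)).add (hl.integrable_sq.const_mul (1 / 2))
  have i1 := integrable_mul_of_memLp hv hV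
  have i2 := hV.integrable_sq.const_mul (1 / 2)
  have i3 := integrable_mul_of_memLp hl hL
  have i4 := hL.integrable_sq.const_mul (1 / 2)
  have e : (fun x => relPlate (v x) (l x) (V x) (L x)) = fun x =>
      plateEnergy (v x) (l x) - v x * V x + 1 / 2 * V x ^ 2 - l x * L x + 1 / 2 * L x ^ 2 := by
    ext x; simp only [relPlate, plateEnergy]; ring
  have j1 : Integrable (fun x => plateEnergy (v x) (l x) - v x * V x) μ := i0.sub i1
  have j2 : Integrable (fun x => plateEnergy (v x) (l x) - v x * V x + 1 / 2 * V x ^ 2) μ :=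
    j1.add i2
  have j3 : Integrable (fun x => plateEnergy (v x) (l x) - v x * V x + 1 / 2 * V x ^ 2
    - l x * L x) μ := j2.sub i3
  rw [e]
  refine ⟨j3.add i4, ?_⟩
  rw [integral_add j3 i4, integral_sub j2 i3, integral_add j1 i2, integral_sub i0 i1,
    integral_const_mul, integral_const_mul]

theorem IsWeakSolution.integrable_stress (hX : IsWeakSolution P D K X) (i j : Fin 3) :
    IntegrableOn (fun p : ℝ × E3 => P.S (X.Du p.1 p.2) i j) (QT X.w.val P.T) := by
  have h1 := ((hX.integrable_Du i j).add (hX.integrable_Du j i)).const_mul P.μ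
  by_cases h : i = j
  · refine (h1.add ((integrable_finsetSum Finset.univ fun k _ =>
      hX.integrable_Du k k).const_mul P.lam)).congr (Filter.Eventually.of_forall fun p => ?_)
    simp [Params.S, tr3, h]
  · refine h1.congr (Filter.Eventually.of_forall fun p => ?_)
    simp [Params.S, h]

theorem continuous_stress (P : Params) (hU : IsSmoothField U) (i j : Fin 3) :
    Continuous fun p : ℝ × E3 => P.S (jac (U p.1) p.2) i j := by
  have h1 : Continuous fun p : ℝ × E3 => P.μ * (jac (U p.1) p.2 i j + jac (U p.1) p.2 j i) :=
    continuous_const.mul ((hU.continuous_jac i j).add (hU.continuous_jac j i))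
  by_cases h : i = j
  · simp only [Params.S, tr3, h, if_true]
    exact (h ▸ h1).add (continuous_const.mul (continuous_finsetSum _ fun k _ =>
      hU.continuous_jac k k))
  · simpa [Params.S, h] using h1

theorem IsWeakSolution.integrable_stress_frob (hX : IsWeakSolution P D K X)
    (hU : IsSmoothField U) :
    IntegrableOn (fun p : ℝ × E3 => frob (P.S (X.Du p.1 p.2)) (jac (U p.1) p.2))
      (QT X.w.val P.T) := by
  obtain ⟨M, -, hM⟩ := hX.exists_height_bound
  exact integrable_finsetSum _ fun i _ => integrable_finsetSum _ fun j _ =>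
    integrableOn_QT_mul_continuous hM hX.w_cont (hX.integrable_stress i j) (hU.continuous_jac i j)

/-- The velocity gradient is only assumed in L^q for q < 2, so its quadratic terms cannot be
estimated singly. `frob_sub_sub` reduces them to S(∇u):∇u, integrable by finite dissipation, and to
terms linear in ∇u. -/
theorem IsWeakSolution.integrable_relViscous (hX : IsWeakSolution P D K X)
    (hU : IsSmoothField U) :
    IntegrableOn (fun p : ℝ × E3 => relViscous P X U p.1 p.2) (QT X.w.val P.T) := by
  obtain ⟨M, -, hM⟩ := hX.exists_height_bound
  have h1 : IntegrableOn (fun p : ℝ × E3 => frob (P.S (jac (U p.1) p.2))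
      (X.Du p.1 p.2 - jac (U p.1) p.2)) (QT X.w.val P.T) := by
    refine integrable_finsetSum _ fun i _ => integrable_finsetSum _ fun j _ => ?_
    refine (integrableOn_QT_mul_continuous hM hX.w_cont ((hX.integrable_Du i j).sub
      (integrableOn_QT_continuous hM (hU.continuous_jac i j)))
      (continuous_stress P hU i j)).congr (Filter.Eventually.of_forall fun p => ?_)
    simp only [Pi.sub_apply]
    ring
  refine ((hX.viscous_int.sub (hX.integrable_stress_frob hU)).sub h1).congr
    (Filter.Eventually.of_forall fun p => ?_)
  have := frob_sub_sub P (X.Du p.1 p.2) (jac (U p.1) p.2)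
  simp only [Pi.sub_apply, relViscous]
  linarith

theorem IsWeakSolution.integrable_momentumBulk (hX : IsWeakSolution P D K X)
    (hU : IsSmoothField U) :
    IntegrableOn (fun p : ℝ × E3 => momentumBulk P X U p.1 p.2) (QT X.w.val P.T) := by
  obtain ⟨M, -, hM⟩ := hX.exists_height_bound
  have hF := hX.finiteEnergy
  have h1 := hF.momentum_dot (V := fun p => dt U p.1 p.2) fun i =>
    bddMeas_QT hM hX.w_cont (hU.continuous_dt_coord i)
  have h2 := hF.convection_dot (A := fun p => jac (U p.1) p.2) fun i j =>
    bddMeas_QT hM hX.w_cont (hU.continuous_jac i j)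
  have htr : Continuous fun p : ℝ × E3 => tr3 (jac (U p.1) p.2) :=
    continuous_finsetSum _ fun i _ => hU.continuous_jac i i
  have h3 := integrableOn_QT_mul_continuous hM hX.w_cont ((Integrable.sub hF.pressure
    (integrableOn_QT_continuous hM (continuous_const (y := P.p P.ρbar)))).const_mul
    (1 / P.ε ^ 2)) htr
  have h4 := (hX.integrable_stress_frob hU).const_mul P.ν
  exact ((h1.add h2).add h3).sub h4

theorem IsWeakSolution.integrable_continuityBulk (hX : IsWeakSolution P D K X)
    {φ : ℝ → E3 → ℝ} (hφ : IsSmoothField φ) :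
    IntegrableOn (fun p : ℝ × E3 => continuityBulk X φ p.1 p.2) (QT X.w.val P.T) := by
  obtain ⟨M, -, hM⟩ := hX.exists_height_bound
  have hF := hX.finiteEnergy
  have h1 := hF.momentum_dot (V := fun p => gradE (φ p.1) p.2) fun i =>
    bddMeas_QT hM hX.w_cont (continuous_gradE_section hφ.contDiff_one i)
  have h2 := Integrable.mul_bddMeas hF.density (bddMeas_QT hM hX.w_cont
    (continuous_dt hφ.contDiff_one))
  refine (h2.add h1).congr (Filter.Eventually.of_forall fun p => ?_)
  simp only [Pi.add_apply, continuityBulk]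
  ring

/-- The assertion of the relative energy inequality, with the integrability of its terms. -/
def RelEnergyInequality (P : Params) (D : InitialData) (X : State) (r : ℝ → E3 → ℝ)
    (U : ℝ → E3 → E3) (W : TestPlate) : Prop :=
  IntegrableOn (fun p : ℝ × E3 => relViscous P X U p.1 p.2) (QT X.w.val P.T) ∧
  IntegrableOn (fun p : ℝ × E2 => relPlateDissipation P X U W p.1 p.2) (GammaT P.T) ∧
  IntegrableOn (fun p : ℝ × E3 => remainderBulk P X r U p.1 p.2) (QT X.w.val P.T) ∧
  IntegrableOn (fun p : ℝ × E2 => remainderPlate P X r U W p.1 p.2) (GammaT P.T) ∧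
  (∀ᵐ τ ∂(volume.restrict (Ioo 0 P.T)),
    IntegrableOn (fun y => relFluid P (X.ρ τ y) (X.u τ y) (r τ y) (U τ y)) (X.dom τ) ∧
    IntegrableOn (fun x => relPlate (X.w.vel τ x) (lap (X.w.hess τ x))
      (W.fields.vel τ x) (lap (W.fields.hess τ x))) cell) ∧
  IntegrableOn (fun y => relFluid P (D.ρ₀ y) (D.u₀ y) (r 0 y) (U 0 y)) (X.dom 0) ∧
  IntegrableOn (fun x => relPlate (D.w₁ x) (lap (X.w.hess 0 x))
    (W.fields.vel 0 x) (lap (W.fields.hess 0 x))) cell ∧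
  ∀ᵐ τ ∂(volume.restrict (Ioo 0 P.T)),
    relEnergy P X r U W τ
        + P.ν * (∫ t in (0)..τ, ∫ y in X.dom t, relViscous P X U t y)
        + (∫ t in (0)..τ, ∫ x in cell, relPlateDissipation P X U W t x)
      ≤ relEnergyInit P D X r U W + ∫ t in (0)..τ, remainder P X r U W t

theorem IsWeakSolution.integral_remainder (hX : IsWeakSolution P D K X)
    (h1 : IntegrableOn (fun p : ℝ × E3 => remainderBulk P X r U p.1 p.2) (QT X.w.val P.T))
    (h2 : IntegrableOn (fun p : ℝ × E2 => remainderPlate P X r U W p.1 p.2) (GammaT P.T)) {τ : ℝ}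
    (hτ : τ ∈ Icc 0 P.T) :
    ∫ t in (0)..τ, remainder P X r U W t
      = (∫ p in QT X.w.val τ, remainderBulk P X r U p.1 p.2)
        + ∫ p in GammaT τ, remainderPlate P X r U W p.1 p.2 := by
  rw [← intervalIntegral_QT (f := remainderBulk P X r U) hX.w_cont h1 hτ,
    ← intervalIntegral_GammaT (f := remainderPlate P X r U W) h2 hτ,
    ← intervalIntegral.integral_add]
  · rfl
  · exact intervalIntegrable_of_Ioo (integrableOn_slice_QT hX.w_cont h1) hτ
  · exact intervalIntegrable_of_Ioo (integrableOn_slice_GammaT h2) hτ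

/-- With r positive everywhere, p(r) and p'(r) are smooth fields; in particular p'(r) is an
admissible test function in the continuity equation. -/
theorem IsWeakSolution.relEnergyInequality_of_pos (hX : IsWeakSolution P D K X)
    (hr : IsSmoothField r) (hpos : ∀ t y, 0 < r t y) (hU : IsSmoothField U)
    (hW : W.Admissible P.T K) (hUW : Compatible P X U W.fields.vel) :
    RelEnergyInequality P D X r U W := by
  obtain ⟨M, -, hM⟩ := hX.exists_height_bound
  set c := 1 / (P.ε ^ 2 * (P.γ - 1)) with hc
  set d := 1 / P.ε ^ 2 with hd
  have hp : IsSmoothField fun t y => P.p (r t y) := hr.comp fun t y =>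
    Real.contDiffAt_rpow_const_of_ne (hpos t y).ne'
  have hp' : IsSmoothField fun t y => P.p' (r t y) := hr.comp fun t y =>
    contDiffAt_const.mul (Real.contDiffAt_rpow_const_of_ne (hpos t y).ne')
  have hq : IsSmoothField fun t y => P.p (r t y) - P.p P.ρbar := hp.sub_const _
  have hUU := hU.half_dot
  have iV := hX.integrable_relViscous hU
  have iPD := hX.integrable_relPlateDissipation hU.continuous hW
  have iA := hX.viscous_int
  have iM := hX.integrable_momentumBulk hU
  have iC1 := hX.integrable_continuityBulk hUU
  have iC2 := hX.integrable_continuityBulk hp'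
  obtain ⟨iQ, iQtop, hwork⟩ := hX.pressure_work hU hW hUW hq
  have iD := hX.plate_int
  have iMP := hX.integrable_momentumPlate hU.continuous hW
  have hV := hW.vel_test
  have hWE := hW.energyClass
  have iVa := integrable_mul_of_memLp hV.memLp hV.memLp_dt
  have ilg : IntegrableOn (fun p : ℝ × E2 => lap (X.w.hess p.1 p.2) * lap (W.velHess p.1 p.2)
      - X.w.velGrad p.1 p.2 ⬝ᵥ W.gradLap p.1 p.2) (GammaT P.T) :=
    (integrable_mul_of_memLp (memLp_lap hX.w_class.hess_memLp) (memLp_lap hV.memLp_hess)).sub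
      (integrable_dot_of_memLp hX.w_class.velGrad_memLp hW.gradLap_memLp)
  have iVg := integrable_dot_of_memLp hWE.velGrad_memLp hW.gradLap_memLp
  have iνs : IntegrableOn (fun p : ℝ × E2 => (X.w.velGrad p.1 p.2 - W.fields.velGrad p.1 p.2)
        ⬝ᵥ W.fields.velGrad p.1 p.2
      + (X.w.vel p.1 p.2 - W.fields.vel p.1 p.2) * lap (W.velHess p.1 p.2)) (GammaT P.T) :=
    (integrable_dot_of_memLp (hX.w_class.velGrad_memLp.sub hWE.velGrad_memLp) hV.memLp_grad).add
      (integrable_mul_of_memLp (hX.w_class.vel_memLp.sub hWE.vel_memLp) (memLp_lap hV.memLp_hess))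
  -- Stated for every smaller measure: the full cylinder yields the integrability claim, and its
  -- restriction to times below τ yields the value of the integral. `intP` plays the same role on
  -- the plate.
  have intB : ∀ {μ : Measure (ℝ × E3)}, μ ≤ volume.restrict (QT X.w.val P.T) →
      Integrable (fun p => remainderBulk P X r U p.1 p.2) μ ∧
      ∫ p, remainderBulk P X r U p.1 p.2 ∂μ = P.ν * (∫ p, relViscous P X U p.1 p.2 ∂μ)
        - P.ν * (∫ p, frob (P.S (X.Du p.1 p.2)) (X.Du p.1 p.2) ∂μ)
        - (∫ p, momentumBulk P X U p.1 p.2 ∂μ)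
        + (∫ p, continuityBulk X (fun s z => 1 / 2 * (U s z ⬝ᵥ U s z)) p.1 p.2 ∂μ)
        - c * (∫ p, continuityBulk X (fun s z => P.p' (r s z)) p.1 p.2 ∂μ)
        + d * (∫ p, (dt (fun s z => P.p (r s z) - P.p P.ρbar) p.1 p.2
          + (U p.1 p.2 ⬝ᵥ gradE (fun z => P.p (r p.1 z) - P.p P.ρbar) p.2
            + (P.p (r p.1 p.2) - P.p P.ρbar) * tr3 (jac (U p.1) p.2))) ∂μ) := by
    intro μ hμ
    have a1 := (Integrable.mono_measure iV hμ).const_mul P.ν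
    have a2 := (Integrable.mono_measure iA hμ).const_mul P.ν
    have a3 := Integrable.mono_measure iM hμ
    have a4 := Integrable.mono_measure iC1 hμ
    have a5 := (Integrable.mono_measure iC2 hμ).const_mul c
    have a6 := (Integrable.mono_measure iQ hμ).const_mul d
    have e : (fun p : ℝ × E3 => remainderBulk P X r U p.1 p.2) = _ :=
      funext fun p => bulk_identity P X hr hU (hpos p.1 p.2)
    rw [e]
    refine ⟨((((a1.sub a2).sub a3).add a4).sub a5).add a6, ?_⟩
    rw [← integral_const_mul, ← integral_const_mul, ← integral_const_mul, ← integral_const_mul,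
      ← integral_sub a1 a2]
    refine (integral_add ((((a1.sub a2).sub a3).add a4).sub a5) a6).trans ?_
    congr 1
    refine (integral_sub (((a1.sub a2).sub a3).add a4) a5).trans ?_
    congr 1
    refine (integral_add ((a1.sub a2).sub a3) a4).trans ?_
    congr 1
    exact integral_sub (a1.sub a2) a3
  have intP : ∀ {μ : Measure (ℝ × E2)}, μ ≤ volume.restrict (GammaT P.T) →
      Integrable (fun p => remainderPlate P X r U W p.1 p.2) μ ∧
      ∫ p, remainderPlate P X r U W p.1 p.2 ∂μ = (∫ p, relPlateDissipation P X U W p.1 p.2 ∂μ)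
        - (∫ p, plateDissipation P X p.1 p.2 ∂μ)
        - (∫ p, momentumPlate P X U W.fields.vel W.acc W.fields.velGrad W.velHess p.1 p.2 ∂μ)
        + (∫ p, W.fields.vel p.1 p.2 * W.acc p.1 p.2 ∂μ)
        - (∫ p, (lap (X.w.hess p.1 p.2) * lap (W.velHess p.1 p.2)
          - X.w.velGrad p.1 p.2 ⬝ᵥ W.gradLap p.1 p.2) ∂μ)
        - (∫ p, W.fields.velGrad p.1 p.2 ⬝ᵥ W.gradLap p.1 p.2 ∂μ)
        + P.νs * (∫ p, ((X.w.velGrad p.1 p.2 - W.fields.velGrad p.1 p.2)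
            ⬝ᵥ W.fields.velGrad p.1 p.2
          + (X.w.vel p.1 p.2 - W.fields.vel p.1 p.2) * lap (W.velHess p.1 p.2)) ∂μ)
        + d * (∫ p, (P.p (r p.1 (Phi X.w.val p.1 p.2)) - P.p P.ρbar) *
          ((X.uTop p.1 p.2 - U p.1 (Phi X.w.val p.1 p.2)) ⬝ᵥ X.nrm p.1 p.2) ∂μ) := by
    intro μ hμ
    have a1 := Integrable.mono_measure iPD hμ
    have a2 := Integrable.mono_measure iD hμ
    have a3 := Integrable.mono_measure iMP hμ
    have a4 := Integrable.mono_measure iVa hμ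
    have a5 := Integrable.mono_measure ilg hμ
    have a6 := Integrable.mono_measure iVg hμ
    have a7 := (Integrable.mono_measure iνs hμ).const_mul P.νs
    have a8 := (Integrable.mono_measure iQtop hμ).const_mul d
    have e : (fun p : ℝ × E2 => remainderPlate P X r U W p.1 p.2) = _ :=
      funext fun p => plate_identity P X r U W p.1 p.2
    rw [e]
    refine ⟨((((((a1.sub a2).sub a3).add a4).sub a5).sub a6).add a7).add a8, ?_⟩
    rw [← integral_const_mul, ← integral_const_mul, ← integral_sub a1 a2]
    refine (integral_add ((((((a1.sub a2).sub a3).add a4).sub a5).sub a6).add a7) a8).trans ?_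
    congr 1
    refine (integral_add (((((a1.sub a2).sub a3).add a4).sub a5).sub a6) a7).trans ?_
    congr 1
    refine (integral_sub ((((a1.sub a2).sub a3).add a4).sub a5) a6).trans ?_
    congr 1
    refine (integral_sub (((a1.sub a2).sub a3).add a4) a5).trans ?_
    congr 1
    refine (integral_add ((a1.sub a2).sub a3) a4).trans ?_
    congr 1
    exact integral_sub (a1.sub a2) a3
  have h0 : (0 : ℝ) ∈ Icc 0 P.T := ⟨le_rfl, P.T_pos.le⟩
  have fluid : ∀ t ∈ Icc 0 P.T, ∀ {ρ : E3 → ℝ} {u : E3 → E3},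
      FiniteEnergy P (volume.restrict (X.dom t)) ρ u → _ := fun t ht ρ u h =>
    h.relFluid (r := r t) (U := U t) (Filter.Eventually.of_forall (hpos t))
      (fun i => bddMeas_Omega hM hX.w_cont ht (contDiff_section (f := fun t y => U t y i)
        (hU.coord i).1 t).continuous)
      (bddMeas_Omega hM hX.w_cont ht (contDiff_section (f := fun t y => 1 / 2 *
        (U t y ⬝ᵥ U t y)) hUU.1 t).continuous)
      (bddMeas_Omega hM hX.w_cont ht (contDiff_section (f := fun t y => P.p'
        (r t y)) hp'.1 t).continuous)
      (bddMeas_Omega hM hX.w_cont ht (contDiff_section (f := fun t y => P.p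
        (r t y) - P.p P.ρbar) hq.1 t).continuous)
  have plate : ∀ t ∈ Icc 0 P.T, ∀ {v : E2 → ℝ}, MemLp v 2 (volume.restrict cell) → _ :=
    fun t ht v hv => integrable_relPlate hv (memLp_lap (hX.w_class.memLp_slice t ht).2.2)
      (hV.memLp_slice P.T_pos ht) (memLp_lap (hWE.memLp_slice t ht).2.2)
  have fluid0 := fluid 0 h0 hX.finiteEnergy_init
  have plate0 := plate 0 h0 hX.w₁_memLp
  refine ⟨iV, iPD, (intB le_rfl).1, (intP le_rfl).1, ?_, fluid0.1, plate0.1, ?_⟩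
  · filter_upwards [hX.finiteEnergy_slice, memLp_slice_GammaT hX.w_class.vel_memLp,
      ae_restrict_mem measurableSet_Ioo] with τ h1 h2 hτ
    exact ⟨(fluid τ (Ioo_subset_Icc_self hτ) h1).1, (plate τ (Ioo_subset_Icc_self hτ) h2).1⟩
  filter_upwards [hX.finiteEnergy_slice, memLp_slice_GammaT hX.w_class.vel_memLp,
    ae_restrict_mem measurableSet_Ioo, hX.energy, hX.continuity_eq hUU, hX.continuity_eq hp',
    hX.momentum U hU _ hW.vel_mem _ _ _ hV hUW] with τ h1 h2 hτ hE hC1 hC2 hMo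
  have hτ' := Ioo_subset_Icc_self hτ
  have hf := (fluid τ hτ' h1).2
  have hpl := (plate τ hτ' h2).2
  have hw := hwork τ hτ'
  obtain ⟨w1, w2, w3, w4⟩ := hX.plate_work hW hτ'
  rw [hX.integral_remainder (intB le_rfl).1 (intP le_rfl).1 hτ',
    (intB (Measure.restrict_mono (QT_mono hτ'.2) le_rfl)).2,
    (intP (Measure.restrict_mono (GammaT_mono hτ'.2) le_rfl)).2, w1, w2, w3, w4,
    relEnergy, relEnergyInit, hf, hpl, fluid0.2, plate0.2,
    intervalIntegral_QT (f := relViscous P X U) hX.w_cont iV hτ',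
    intervalIntegral_GammaT (f := relPlateDissipation P X U W) iPD hτ']
  rw [intervalIntegral_QT (f := fun t y => frob (P.S (X.Du t y)) (X.Du t y)) hX.w_cont iA hτ',
    intervalIntegral_GammaT (f := plateDissipation P X) iD hτ'] at hE
  rw [intervalIntegral_QT (f := continuityBulk X _) hX.w_cont iC1 hτ'] at hC1
  rw [intervalIntegral_QT (f := continuityBulk X _) hX.w_cont iC2 hτ'] at hC2
  rw [intervalIntegral_QT (f := momentumBulk P X U) hX.w_cont iM hτ',
    intervalIntegral_GammaT (f := momentumPlate P X U W.fields.vel W.acc W.fields.velGrad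
      W.velHess) iMP hτ'] at hMo
  -- The constants `d` and `c` are multiplied through beforehand, so that the conclusion is linear
  -- in the integrals: the energy inequality plus equalities.
  have hwd := congrArg (d * ·) hw
  have hC2c := congrArg (c * ·) hC2
  simp only [mul_add, mul_sub] at hwd hC2c
  rw [← hc, ← hd]
  linarith

end RelativeEnergy

/-! ### Test densities that are positive only on the closed fluid domain -/

section Positivity

open Filter Topology

/-- A smooth positive modification of the identity below `c / 2`. -/
noncomputable def liftPos (c s : ℝ) : ℝ :=
  s * Real.smoothTransition (4 / c * s - 1) + c / 4 * (1 - Real.smoothTransition (4 / c * s - 1))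

theorem contDiff_liftPos (c : ℝ) : ContDiff ℝ ∞ (liftPos c) := by
  have h : ContDiff ℝ ∞ fun s : ℝ => Real.smoothTransition (4 / c * s - 1) :=
    Real.smoothTransition.contDiff.comp (by fun_prop)
  exact (contDiff_id.mul h).add (contDiff_const.mul (contDiff_const.sub h))

/-- A convex combination of s and c/4 in which the weight of s vanishes for s ≤ c/4. -/
theorem liftPos_pos {c : ℝ} (hc : 0 < c) (s : ℝ) : 0 < liftPos c s := by
  have h0 := Real.smoothTransition.nonneg (4 / c * s - 1)
  have h1 := Real.smoothTransition.le_one (4 / c * s - 1)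
  rcases le_or_gt (4 / c * s - 1) 0 with h | h
  · rw [liftPos, Real.smoothTransition.zero_of_nonpos h]
    simpa using by positivity
  · have hs : 0 < s := by
      have : 0 < 4 / c * s := by linarith
      exact (pos_iff_pos_of_mul_pos this).1 (by positivity)
    have h2 := Real.smoothTransition.pos_of_pos h
    have h3 : 0 ≤ c / 4 * (1 - Real.smoothTransition (4 / c * s - 1)) :=
      mul_nonneg (by positivity) (by linarith)
    have h4 := mul_pos hs h2
    rw [liftPos]
    linarith

theorem liftPos_of_le {c : ℝ} (hc : 0 < c) {s : ℝ} (hs : c / 2 ≤ s) : liftPos c s = s := by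
  have h : 1 ≤ 4 / c * s - 1 := by
    have : 4 / c * (c / 2) ≤ 4 / c * s := mul_le_mul_of_nonneg_left hs (by positivity)
    have h2 : 4 / c * (c / 2) = 2 := by field_simp; norm_num
    linarith
  rw [liftPos, Real.smoothTransition.one_of_one_le h]
  ring

variable {P : Params} {D : InitialData} {K : Set (ℝ → E2 → ℝ)} {X : State}
  {r : ℝ → E3 → ℝ} {U : ℝ → E3 → E3} {W : TestPlate}

/-- Rescaling heights to [0,1] presents the closed moving domain over the closed unit square as the
image of a compact set, on which r attains its minimum. -/
theorem IsWeakSolution.exists_pos_lower_bound (hX : IsWeakSolution P D K X)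
    (hr : IsSmoothField r) (hpos : ∀ t ∈ Icc 0 P.T, ∀ y : E3,
      0 ≤ y 2 → y 2 ≤ 1 + X.w.val t (base y) → 0 < r t y) :
    ∃ c > 0, ∀ t ∈ Icc 0 P.T, ∀ y : E3, base y ∈ cell → 0 ≤ y 2 → y 2 ≤ 1 + X.w.val t (base y) →
      c ≤ r t y := by
  set S : Set ((ℝ × E2) × ℝ) := (Icc 0 P.T ×ˢ (Icc 0 1 : Set E2)) ×ˢ Icc (0 : ℝ) 1 with hS
  have hSc : IsCompact S := (isCompact_Icc.prod isCompact_Icc).prod isCompact_Icc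
  have hne : S.Nonempty := ⟨((0, 0), 0), ⟨⟨le_rfl, P.T_pos.le⟩, ⟨le_rfl, zero_le_one⟩⟩,
    ⟨le_rfl, zero_le_one⟩⟩
  have h1 : ContinuousOn (fun q : (ℝ × E2) × ℝ => 1 + X.w.val q.1.1 q.1.2) S :=
    continuousOn_const.add (hX.w_cont.comp continuousOn_fst fun q hq => ⟨hq.1.1, mem_univ _⟩)
  have h2 : ContinuousOn (fun q : (ℝ × E2) × ℝ =>
      r q.1.1 (pt q.1.2 (q.2 * (1 + X.w.val q.1.1 q.1.2)))) S := by
    refine hr.continuous.comp_continuousOn (f := fun q : (ℝ × E2) × ℝ =>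
      (q.1.1, pt q.1.2 (q.2 * (1 + X.w.val q.1.1 q.1.2)))) ?_
    refine ContinuousOn.prodMk (by fun_prop) ?_
    exact continuous_pt.comp_continuousOn (f := fun q : (ℝ × E2) × ℝ =>
      (q.1.2, q.2 * (1 + X.w.val q.1.1 q.1.2)))
      (ContinuousOn.prodMk (by fun_prop) (continuousOn_snd.mul h1))
  obtain ⟨q₀, hq₀, hmin⟩ := hSc.exists_isMinOn hne h2
  have hh : ∀ t ∈ Icc 0 P.T, ∀ x, 0 < 1 + X.w.val t x := fun t ht x => by
    linarith [hX.w_gt t ht x]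
  refine ⟨_, hpos q₀.1.1 hq₀.1.1 (pt q₀.1.2 (q₀.2 * (1 + X.w.val q₀.1.1 q₀.1.2))) ?_ ?_, ?_⟩
  · rw [pt_two]; exact mul_nonneg hq₀.2.1 (hh _ hq₀.1.1 _).le
  · rw [pt_two, base_pt]; exact mul_le_of_le_one_left (hh _ hq₀.1.1 _).le hq₀.2.2
  · intro t ht y hy h0 hy1
    have hp := hh t ht (base y)
    have := hmin (show ((t, base y), y 2 / (1 + X.w.val t (base y))) ∈ S from
      ⟨⟨ht, cell_subset_Icc hy⟩, ⟨div_nonneg h0 hp.le, (div_le_one hp).2 hy1⟩⟩)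
    simpa only [mem_ofPred_eq, div_mul_cancel₀ _ hp.ne', pt_base] using this

/-- The remainder contains derivatives of p'(r) in time and space, so the densities have to agree in
a space-time neighbourhood of the point. -/
theorem remainderBulk_congr {r r' : ℝ → E3 → ℝ} {t : ℝ} {y : E3}
    (h : ∀ᶠ p : ℝ × E3 in 𝓝 (t, y), r p.1 p.2 = r' p.1 p.2) :
    remainderBulk P X r U t y = remainderBulk P X r' U t y := by
  have h0 : r t y = r' t y := h.self_of_nhds
  have h1 : (fun s => P.p' (r s y)) =ᶠ[𝓝 t] fun s => P.p' (r' s y) := by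
    have hc : Tendsto (fun s : ℝ => (s, y)) (𝓝 t) (𝓝 (t, y)) :=
      (by fun_prop : Continuous fun s : ℝ => (s, y)).tendsto t
    filter_upwards [hc.eventually h] with s hs
    simp only [hs]
  have h2 : (fun z => P.p' (r t z)) =ᶠ[𝓝 y] fun z => P.p' (r' t z) := by
    have hc : Tendsto (fun z : E3 => (t, z)) (𝓝 y) (𝓝 (t, y)) :=
      (by fun_prop : Continuous fun z : E3 => (t, z)).tendsto y
    filter_upwards [hc.eventually h] with z hz
    simp only [hz]
  have e1 : dt (fun s z => P.p' (r s z)) t y = dt (fun s z => P.p' (r' s z)) t y := h1.deriv_eq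
  have e2 : gradE (fun z => P.p' (r t z)) y = gradE (fun z => P.p' (r' t z)) y := by
    ext j; simp only [gradE, h2.fderiv_eq]
  simp only [remainderBulk, h0, e1, e2]

/-- The relative energy inequality depends on `r` only in the closed fluid domain. -/
theorem IsWeakSolution.relEnergyInequality_congr (hX : IsWeakSolution P D K X)
    {r r' : ℝ → E3 → ℝ} (h : ∀ t ∈ Icc 0 P.T, ∀ y : E3, base y ∈ cell → 0 ≤ y 2 →
      y 2 ≤ 1 + X.w.val t (base y) → ∀ᶠ p : ℝ × E3 in 𝓝 (t, y), r p.1 p.2 = r' p.1 p.2)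
    (hi : RelEnergyInequality P D X r U W) : RelEnergyInequality P D X r' U W := by
  obtain ⟨h1, h2, h3, h4, h5, h6, h7, h8⟩ := hi
  have h0 : (0 : ℝ) ∈ Icc 0 P.T := ⟨le_rfl, P.T_pos.le⟩
  have hO : ∀ t ∈ Icc 0 P.T, ∀ y ∈ X.dom t,
      ∀ᶠ p : ℝ × E3 in 𝓝 (t, y), r p.1 p.2 = r' p.1 p.2 :=
    fun t ht y hy => h t ht y hy.1 hy.2.1.le hy.2.2.le
  have eB : ∀ t ∈ Icc 0 P.T, ∀ y ∈ X.dom t,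
      remainderBulk P X r U t y = remainderBulk P X r' U t y :=
    fun t ht y hy => remainderBulk_congr (hO t ht y hy)
  have eP : ∀ t ∈ Icc 0 P.T, ∀ x ∈ cell,
      remainderPlate P X r U W t x = remainderPlate P X r' U W t x := fun t ht x hx => by
    have := (h t ht (Phi X.w.val t x) (by simpa [Phi] using hx)
      (by simp only [Phi, pt_two]; linarith [hX.w_gt t ht x]) (by simp [Phi])).self_of_nhds
    simp only at this
    simp only [remainderPlate, this]
  have eF : ∀ t ∈ Icc 0 P.T, ∀ (ρ : E3 → ℝ) (u : E3 → E3), ∀ y ∈ X.dom t,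
      relFluid P (ρ y) (u y) (r t y) (U t y) = relFluid P (ρ y) (u y) (r' t y) (U t y) :=
    fun t ht ρ u y hy => by
      have := (hO t ht y hy).self_of_nhds
      simp only at this
      rw [this]
  have mO := fun t ht => measurableSet_Omega hX.w_cont (t := t) ht
  refine ⟨h1, h2, h3.congr_fun (fun p hp => eB _ (Ioo_subset_Icc_self hp.1) _ hp.2)
    (measurableSet_QT hX.w_cont), h4.congr_fun (fun p hp => eP _ (Ioo_subset_Icc_self hp.1) _ hp.2)
    (measurableSet_GammaT _), ?_, h6.congr_fun (eF 0 h0 _ _) (mO 0 h0), h7, ?_⟩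
  · filter_upwards [h5, ae_restrict_mem measurableSet_Ioo] with τ a hτ
    have hτ' := Ioo_subset_Icc_self hτ
    exact ⟨a.1.congr_fun (eF τ hτ' _ _) (mO τ hτ'), a.2⟩
  · filter_upwards [h8, ae_restrict_mem measurableSet_Ioo] with τ a hτ
    have hτ' := Ioo_subset_Icc_self hτ
    have e1 : relEnergy P X r U W τ = relEnergy P X r' U W τ := by
      rw [relEnergy, relEnergy, setIntegral_congr_fun (mO τ hτ') (eF τ hτ' _ _)]
    have e2 : relEnergyInit P D X r U W = relEnergyInit P D X r' U W := by
      rw [relEnergyInit, relEnergyInit, setIntegral_congr_fun (mO 0 h0) (eF 0 h0 _ _)]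
    have e3 : ∫ t in (0)..τ, remainder P X r U W t = ∫ t in (0)..τ, remainder P X r' U W t := by
      refine intervalIntegral.integral_congr fun t ht => ?_
      rw [uIcc_of_le hτ.1.le] at ht
      have ht' : t ∈ Icc 0 P.T := ⟨ht.1, ht.2.trans hτ'.2⟩
      simp only [remainder]
      rw [setIntegral_congr_fun (mO t ht') (eB t ht'),
        setIntegral_congr_fun measurableSet_cell (eP t ht')]
    rw [← e1, ← e2, ← e3]
    exact a

theorem IsWeakSolution.relEnergyInequality (hX : IsWeakSolution P D K X)
    (hr : IsSmoothField r) (hpos : ∀ t ∈ Icc 0 P.T, ∀ y : E3,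
      0 ≤ y 2 → y 2 ≤ 1 + X.w.val t (base y) → 0 < r t y) (hU : IsSmoothField U)
    (hW : W.Admissible P.T K) (hUW : Compatible P X U W.fields.vel) :
    RelEnergyInequality P D X r U W := by
  obtain ⟨c, hc, hcr⟩ := hX.exists_pos_lower_bound hr hpos
  have hl : IsSmoothField fun t y => liftPos c (r t y) :=
    hr.comp fun t y => (contDiff_liftPos c).contDiffAt
  refine hX.relEnergyInequality_congr (fun t ht y h1 h2 h3 => ?_)
    (hX.relEnergyInequality_of_pos hl (fun t y => liftPos_pos hc _) hU hW hUW)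
  -- The lower bound is `c` but `liftPos c` is the identity already from c/2 on. This margin makes r
  -- and its modification agree in a neighbourhood of each point of the closed domain.
  have h4 : c / 2 < r t y := (half_lt_self hc).trans_le (hcr t ht y h1 h2 h3)
  filter_upwards [hr.continuous.continuousAt.eventually (lt_mem_nhds h4)] with p hp
  exact liftPos_of_le hc hp.le

end Positivity

end FSI

theorem proposition4p1 (P : FSI.Params) (D : FSI.InitialData) (K : Set (ℝ → FSI.E2 → ℝ))
    (hK : FSI.IsPlateTestClass P.T K) (X : FSI.State) (hX : FSI.IsWeakSolution P D K X)
    (r : ℝ → FSI.E3 → ℝ) (U : ℝ → FSI.E3 → FSI.E3) (W : FSI.TestPlate)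
    (hr : FSI.IsSmoothField r)
    (hr_pos : ∀ t ∈ Set.Icc 0 P.T, ∀ y : FSI.E3,
      0 ≤ y 2 → y 2 ≤ 1 + X.w.val t (FSI.base y) → 0 < r t y)
    (hU : FSI.IsSmoothField U) (hW : W.Admissible P.T K)
    (hUW : FSI.Compatible P X U W.fields.vel) :
    -- all integrals in the inequality are integrals of integrable functions
    MeasureTheory.IntegrableOn
        (fun p : ℝ × FSI.E3 => FSI.relViscous P X U p.1 p.2) (FSI.QT X.w.val P.T) ∧
      MeasureTheory.IntegrableOn
        (fun p : ℝ × FSI.E2 => FSI.relPlateDissipation P X U W p.1 p.2) (FSI.GammaT P.T) ∧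
      MeasureTheory.IntegrableOn
        (fun p : ℝ × FSI.E3 => FSI.remainderBulk P X r U p.1 p.2) (FSI.QT X.w.val P.T) ∧
      MeasureTheory.IntegrableOn
        (fun p : ℝ × FSI.E2 => FSI.remainderPlate P X r U W p.1 p.2) (FSI.GammaT P.T) ∧
      (∀ᵐ τ ∂(MeasureTheory.volume.restrict (Set.Ioo 0 P.T)),
        MeasureTheory.IntegrableOn
          (fun y => FSI.relFluid P (X.ρ τ y) (X.u τ y) (r τ y) (U τ y)) (X.dom τ) ∧
        MeasureTheory.IntegrableOn
          (fun x => FSI.relPlate (X.w.vel τ x) (FSI.lap (X.w.hess τ x))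
            (W.fields.vel τ x) (FSI.lap (W.fields.hess τ x))) FSI.cell) ∧
      MeasureTheory.IntegrableOn
        (fun y => FSI.relFluid P (D.ρ₀ y) (D.u₀ y) (r 0 y) (U 0 y)) (X.dom 0) ∧
      MeasureTheory.IntegrableOn
        (fun x => FSI.relPlate (D.w₁ x) (FSI.lap (X.w.hess 0 x))
          (W.fields.vel 0 x) (FSI.lap (W.fields.hess 0 x))) FSI.cell ∧
      -- the relative energy inequality
      ∀ᵐ τ ∂(MeasureTheory.volume.restrict (Set.Ioo 0 P.T)),
        FSI.relEnergy P X r U W τ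
            + P.ν * (∫ t in (0)..τ, ∫ y in X.dom t, FSI.relViscous P X U t y)
            + (∫ t in (0)..τ, ∫ x in FSI.cell, FSI.relPlateDissipation P X U W t x)
          ≤ FSI.relEnergyInit P D X r U W + ∫ t in (0)..τ, FSI.remainder P X r U W t :=
  hX.relEnergyInequality hr hr_pos hU hW hUW
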